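/- Let $\sigma:(0,\infty)\to\mathbb R$, let $W(p)=\int_1^p\sigma(z)\,dz$ for $p>0$ (with $W(0)=\lim_{p\to0+}W(p)\in(-\infty,\infty]$), and let $\mu>0$. Assume that (H1) $\sigma$ is locally Lipschitz continuous on $(0,\infty)$; (H2) $\sigma(p)\to-\infty$ as $p\to0+$; and that $W$ is $\lambda$-convex, i.e. $p\mapsto W(p)+\frac\lambda2p^2$ is convex for some $\lambda\ge0$. For $T>0$ and $p_0\in L^2(0,1)$, a measurable function $p=p(x,t)$ is called a solution on $(0,1)\times[0,T]$ of $$(P)\qquad p_t(x,t)=-\sigma(p(x,t))+\int_0^1\sigma(p(y,t))\,dy,\qquad p(x,0)=p_0(x),$$ if (i) $p\in C([0,T];L^2(0,1))$ with $p(\cdot,0)=p_0$; (ii) $p(x,t)>0$ for a.e. $(x,t)\in(0,1)\times[0,T]$, $\sigma(p(\cdot,t))\in L^1(0,1)$ for a.e. $t\in[0,T]$, and, for a.e. $x\in(0,1)$ and all $\tau\in(0,T)$, $\sigma(p(x,\cdot))-\int_0^1\sigma(p(y,\cdot))\,dy\in L^1(\tau,T)$; (iii) for a.e. $x\in(0,1)$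 and all $s,t\in(0,T]$, $p(x,t)=p(x,s)-\int_s^t\big(\sigma(p(x,r))-\int_0^1\sigma(p(y,r))\,dy\big)\,dr$. A solution on $(0,1)\times[0,\infty)$ is a function that is a solution on $(0,1)\times[0,T]$ for every $T>0$. Let $X=\{q\in L^2(0,1): q\ge0\text{ a.e.},\ \int_0^1q\,dx=\mu\}$. Then for every $p_0\in X$ there exists a solution $p$ of $(P)$ on $(0,1)\times[0,\infty)$; it satisfies $\int_0^1p(x,t)\,dx=\mu$ for all $t\ge0$. It is unique: for every $T>0$, any two solutions of $(P)$ on $(0,1)\times[0,T]$ with initial data $p_0\in X$ coincide as elements of $C([0,T];L^2(0,1))$. The map $(p_0,t)\mapsto p(\cdot,t)$ is continuous from $X\times[0,\infty)$ to $L^2(0,1)$, where $X$ carries the $L^2(0,1)$ norm. Furthermore, the time derivative $p_t(x,t)$ exists for a.e. $(x,t)\in(0,1)\times(0,\infty)$, $\int_0^1W(p(x,t))\,dx$ exists and is finite for every $t>0$, and for all $t\ge\tau>0$ the function $p_s^2$ is integrable on $(0,1)\times(\tau,t)$ and the energy equation $$\int_0^1W(p(x,t))\,dx=\int_0^1W(p(x,\tau))\,dx-\int_\tau^t\int_0^1p_s(x,s)^2\,dx\,ds$$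 holds. -/

import Mathlib

open MeasureTheory Set Filter Topology
open scoped NNReal ENNReal

noncomputable section

namespace Viscoelastic

/-- Lebesgue measure on the interval `(0,1)`. -/
abbrev unitVol : Measure ℝ := (volume : Measure ℝ).restrict (Ioo (0 : ℝ) 1)

/-- The Hilbert space `L²(0,1)`. -/
abbrev L2 : Type := Lp ℝ 2 unitVol

/-- Admissible initial data: `q ∈ L²(0,1)` with `q ≥ 0` a.e. and `∫₀¹ q dx = μ`. -/
def admissible (μ : ℝ) : Set L2 :=
  {q | (∀ᵐ x ∂unitVol, 0 ≤ q x) ∧ ∫ x, q x ∂unitVol = μ}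

/-- The stored energy `W(p) = ∫₁^p σ(z) dz` for `p > 0`. The stress `σ` is a function on `(0,∞)`;
its values elsewhere are irrelevant. -/
def storedEnergy (σ : ℝ → ℝ) (p : ℝ) : ℝ := ∫ z in (1 : ℝ)..p, σ z

/-- The stored energy on `[0,∞)` with values in `(-∞,∞]`: at `p = 0` it is the (possibly infinite)
limit of `W(q)` as `q → 0+`. -/
def storedEnergyExt (σ : ℝ → ℝ) (p : ℝ) : EReal :=
  if 0 < p then (storedEnergy σ p : EReal)
  else if p = 0 then liminf (fun q : ℝ => (storedEnergy σ q : EReal)) (𝓝[>] (0 : ℝ))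
  else ⊤

/-- `φ` is `λ`-convex on `K`: `φ + (λ/2) ‖·‖²` is convex on `K` for some `λ ≥ 0`. -/
def IsLambdaConvexOn {V : Type*} [NormedAddCommGroup V] [NormedSpace ℝ V]
    (K : Set V) (φ : V → ℝ) : Prop :=
  ∃ lam : ℝ, 0 ≤ lam ∧ ConvexOn ℝ K (fun v => φ v + lam / 2 * ‖v‖ ^ 2)

/-- `σ(p(x,t)) - ∫₀¹ σ(p(y,t)) dy`, which is minus the right-hand side of the equation. -/
def excessStress (σ : ℝ → ℝ) (p : ℝ → ℝ → ℝ) (x t : ℝ) : ℝ :=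
  σ (p x t) - ∫ y, σ (p y t) ∂unitVol

/-- `p = p(x,t)` is a solution on `(0,1) × [0,T]` of `p_t = -σ(p) + ∫₀¹ σ(p) dy`, `p(·,0) = p₀`. -/
structure IsSolutionOn (σ : ℝ → ℝ) (p₀ : L2) (T : ℝ) (p : ℝ → ℝ → ℝ) : Prop where
  /-- `p` is a measurable function of `(x,t)`. -/
  aestronglyMeasurable : AEStronglyMeasurable (fun z : ℝ × ℝ => p z.1 z.2)
    ((volume : Measure (ℝ × ℝ)).restrict (Ioo (0 : ℝ) 1 ×ˢ Icc 0 T))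
  /-- `p ∈ C([0,T]; L²(0,1))` with `p(·,0) = p₀`. -/
  continuous_L2 : ∃ u : ℝ → L2, ContinuousOn u (Icc 0 T) ∧ u 0 = p₀ ∧
    ∀ t ∈ Icc 0 T, ∀ᵐ x ∂unitVol, u t x = p x t
  /-- `p > 0` almost everywhere on `(0,1) × [0,T]`. -/
  pos : ∀ᵐ z ∂((volume : Measure (ℝ × ℝ)).restrict (Ioo (0 : ℝ) 1 ×ˢ Icc 0 T)), 0 < p z.1 z.2
  /-- `σ(p(·,t)) ∈ L¹(0,1)` for a.e. `t`. -/
  integrable_stress : ∀ᵐ t ∂((volume : Measure ℝ).restrict (Icc 0 T)),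
    Integrable (fun x => σ (p x t)) unitVol
  /-- `σ(p(x,·)) - ∫₀¹ σ(p(y,·)) dy ∈ L¹(τ,T)` for a.e. `x` and all `τ > 0`. -/
  integrable_excess : ∀ᵐ x ∂unitVol, ∀ τ ∈ Ioo 0 T,
    IntegrableOn (fun t => excessStress σ p x t) (Ioo τ T) volume
  /-- The integrated equation, for a.e. `x` and all positive times. -/
  equation : ∀ᵐ x ∂unitVol, ∀ s ∈ Ioc 0 T, ∀ t ∈ Ioc 0 T,
    p x t = p x s - ∫ r in s..t, excessStress σ p x r

/-- `p` is a solution on `(0,1) × [0,∞)`, i.e. on `(0,1) × [0,T]` for every `T > 0`. -/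
def IsSolution (σ : ℝ → ℝ) (p₀ : L2) (p : ℝ → ℝ → ℝ) : Prop :=
  ∀ T : ℝ, 0 < T → IsSolutionOn σ p₀ T p

/-- The total energy `∫₀¹ W(f(x)) dx` exists and is finite. -/
def HasFiniteEnergy (σ : ℝ → ℝ) (f : ℝ → ℝ) : Prop :=
  (∀ᵐ x ∂unitVol, storedEnergyExt σ (f x) ≠ ⊤) ∧
    Integrable (fun x => (storedEnergyExt σ (f x)).toReal) unitVol

/-- The total energy `∫₀¹ W(f(x)) dx`, meaningful under `HasFiniteEnergy σ f`. -/
def energy (σ : ℝ → ℝ) (f : ℝ → ℝ) : ℝ :=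
  ∫ x, (storedEnergyExt σ (f x)).toReal ∂unitVol

end Viscoelastic

end

/-!
Write `c(t) = ∫₀¹ σ(p(y,t)) dy` for the mean stress and `σ(p) - c` for the excess stress. The
equation `p_t = -(σ(p) - c)` is the gradient flow in `L²(0,1)` of `E(p) = ∫ W(p)` on the affine
space of functions with mean `μ`; the number `c(t)` is the multiplier of the constraint and drops
out on testing with functions of mean zero. Since `W` is `lam`-convex, `r ↦ σ(r) + lam * r` is
nondecreasing (`IsStress`), and two solutions with the same mean satisfy
`‖p(t) - q(t)‖ ≤ exp (lam * t) * ‖p(0) - q(0)‖`.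

*Arbitrary solutions.* The definition of a solution gives integrability in time of the excess
stress for almost every `x` only, whereas the contraction estimate requires integrability in
`(x,t)`. The key is `IsStress.exists_abs_le_excess`: a function with mean bounded below and
bounded `L²` norm takes values in a fixed compact subset of `(0,∞)` on a set of positive measure,
and there `σ(p)` is bounded, so the excess stress controls `c`. Restricting it to a set of `x` of
almost full measure on which the time integral of the excess stress is bounded shows that `c` is
integrable in time (`IsStrip.integrable_meanStress`). Testing with `p - 1` then makes `σ(p)`
integrable in `(x,t)` (`IsStrip.integrable_stress`). Hence the mean is conserved and the
contraction estimate holds (`IsSolutionOn.integral_eq`, `IsSolutionOn.norm_sub_le`), which yields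
uniqueness and continuous dependence on the initial datum.

*Existence.* For initial data that are positive simple functions the equation is a system of
ordinary differential equations (`exists_isFiniteFlow`). Its solutions do not reach `0`:
differences of values stay bounded, so values above `μ / 2` are taken on a set whose measure is
bounded below, and a sufficiently low value `a` satisfies `σ(a) ≤ c(t)`, which makes it a barrier.
The Lyapunov function `½ ‖p - μ‖² + t (E(p) - E(μ))` bounds the velocity, and with it the stress,
in `L²(0,1)` for `t > 0` in terms of the `L²` norm of the initial datum alone
(`IsFiniteFlow.sq_mul_sum_sq_velocity_le`, `IsStress.exists_stress_bound`). A general datum is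
approximated; the curves converge in `L²` by contraction, the limit is positive because `σ` is
unbounded near `0`, the mean stresses converge by uniform integrability
(`IsStress.tendsto_integral`), and for fixed `x` the scalar equation with prescribed `c` is stable
under convergence of `c` (`IsStress.exists_tendsto_of_scalar`).

*Regularity and energy.* By uniqueness every solution is the one so constructed, so its stress is
locally bounded in time in `L²(0,1)` for `t > 0`. Therefore `c` is continuous, the equation holds
classically for almost every `x`, and the energy equation is the chain rule for `W(p(x,·))`
integrated over `x`, where `∫ σ(p) p_t = -∫ (σ(p) - c)²` because the excess stress has mean zero.
-/

namespace Viscoelastic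

/-! ### Scalar facts: the stress, the stored energy, Grönwall estimates -/

/-- The standing hypotheses on the stress. The `lam`-convexity of the stored energy is recorded
through its derivative: `p ↦ σ p + lam * p` is nondecreasing on `(0,∞)`. -/
structure IsStress (σ : ℝ → ℝ) (lam : ℝ) : Prop where
  lip : LocallyLipschitzOn (Ioi (0 : ℝ)) σ
  atBot : Tendsto σ (𝓝[>] (0 : ℝ)) atBot
  lam_nonneg : 0 ≤ lam
  mono : MonotoneOn (fun p => σ p + lam * p) (Ioi (0 : ℝ))

theorem hasDerivAt_storedEnergy {σ : ℝ → ℝ} (hσ : ContinuousOn σ (Ioi (0 : ℝ))) {p : ℝ}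
    (hp : 0 < p) : HasDerivAt (storedEnergy σ) (σ p) p := by
  have hc : ContinuousAt σ p := hσ.continuousAt (Ioi_mem_nhds hp)
  refine intervalIntegral.integral_hasDerivAt_right ?_ ?_ hc
  · refine (hσ.mono ?_).intervalIntegrable
    intro z hz
    exact lt_of_lt_of_le (lt_min one_pos hp) hz.1
  · exact hσ.stronglyMeasurableAtFilter isOpen_Ioi p hp

theorem exists_isStress {σ : ℝ → ℝ} (H1 : LocallyLipschitzOn (Ioi (0 : ℝ)) σ)
    (H2 : Tendsto σ (𝓝[>] (0 : ℝ)) atBot)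
    (hW : IsLambdaConvexOn (Ioi (0 : ℝ)) (storedEnergy σ)) : ∃ lam, IsStress σ lam := by
  obtain ⟨lam, hlam, hc⟩ := hW
  have hd : ∀ p ∈ Ioi (0 : ℝ), HasDerivAt (fun v => storedEnergy σ v + lam / 2 * ‖v‖ ^ 2)
      (σ p + lam * p) p := by
    intro p hp
    have h2 := ((hasDerivAt_pow 2 p).const_mul (lam / 2))
    have h3 := (hasDerivAt_storedEnergy H1.continuousOn hp).add h2
    refine (h3.congr_deriv ?_).congr_of_eventuallyEq ?_
    · simp; ring
    · exact Eventually.of_forall fun v => by simp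
  refine ⟨lam, H1, H2, hlam, ?_⟩
  intro p hp q hq hpq
  have := hc.monotoneOn_deriv (fun x hx => (hd x hx).differentiableAt) hp hq hpq
  rwa [(hd p hp).deriv, (hd q hq).deriv] at this

namespace IsStress

variable {σ : ℝ → ℝ} {lam : ℝ}

theorem continuousOn (h : IsStress σ lam) : ContinuousOn σ (Ioi (0 : ℝ)) := h.lip.continuousOn

theorem neg_le_sub_mul_sub (h : IsStress σ lam) {p q : ℝ} (hp : 0 < p) (hq : 0 < q) :
    -lam * (p - q) ^ 2 ≤ (σ p - σ q) * (p - q) := by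
  rcases le_total p q with hpq | hpq
  · have := h.mono hp hq hpq
    simp only at this
    nlinarith
  · have := h.mono hq hp hpq
    simp only at this
    nlinarith

/-- The tangent inequality for the `lam`-convex function `W`. -/
theorem storedEnergy_tangent (h : IsStress σ lam) {p q : ℝ} (hp : 0 < p) (hq : 0 < q) :
    storedEnergy σ p + σ p * (q - p) - lam / 2 * (q - p) ^ 2 ≤ storedEnergy σ q := by
  -- `f` has derivative `σ r - σ p + lam * (r - p)`, which has the sign of `r - p`.
  set f : ℝ → ℝ := fun r => storedEnergy σ r - σ p * (r - p) + lam / 2 * (r - p) ^ 2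
  have hd : ∀ r ∈ Ioi (0 : ℝ), HasDerivAt f (σ r - σ p + lam * (r - p)) r := by
    intro r hr
    have h1 := hasDerivAt_storedEnergy h.continuousOn hr
    have h2 : HasDerivAt (fun r : ℝ => r - p) 1 r := (hasDerivAt_id r).sub_const p
    refine ((h1.sub (h2.const_mul (σ p))).add ((h2.pow 2).const_mul (lam / 2))).congr_deriv ?_
    simp; ring
  have hfp : f p = storedEnergy σ p := by simp [f]
  suffices f p ≤ f q by
    rw [hfp] at this; simp only [f] at this; nlinarith
  rcases le_total p q with hpq | hpq
  · have hm : MonotoneOn f (Icc p q) := by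
      refine monotoneOn_of_deriv_nonneg (convex_Icc _ _) (fun r hr => ?_) (fun r hr => ?_)
        (fun r hr => ?_)
      · exact (hd r (hp.trans_le hr.1)).continuousAt.continuousWithinAt
      · rw [interior_Icc] at hr
        exact (hd r (hp.trans hr.1)).differentiableAt.differentiableWithinAt
      · rw [interior_Icc] at hr
        rw [(hd r (hp.trans hr.1)).deriv]
        have := h.mono hp (hp.trans hr.1) hr.1.le
        simp only at this
        linarith
    exact hm (left_mem_Icc.2 hpq) (right_mem_Icc.2 hpq) hpq
  · have hm : AntitoneOn f (Icc q p) := by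
      refine antitoneOn_of_deriv_nonpos (convex_Icc _ _) (fun r hr => ?_) (fun r hr => ?_)
        (fun r hr => ?_)
      · exact (hd r (hq.trans_le hr.1)).continuousAt.continuousWithinAt
      · rw [interior_Icc] at hr
        exact (hd r (hq.trans hr.1)).differentiableAt.differentiableWithinAt
      · rw [interior_Icc] at hr
        rw [(hd r (hq.trans hr.1)).deriv]
        have := h.mono (hq.trans hr.1) hp hr.2.le
        simp only at this
        linarith
    exact hm (left_mem_Icc.2 hpq) (right_mem_Icc.2 hpq) hpq

/-- Near `0` the stress lies below any prescribed level. -/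
theorem exists_le_of_lt (h : IsStress σ lam) (C : ℝ) :
    ∃ a, 0 < a ∧ ∀ p, 0 < p → p ≤ a → σ p ≤ C := by
  have := h.atBot.eventually_le_atBot C
  rw [eventually_nhdsWithin_iff, Metric.eventually_nhds_iff] at this
  obtain ⟨ε, hε, H⟩ := this
  refine ⟨ε / 2, by positivity, fun p hp hpa => H ?_ hp⟩
  rw [Real.dist_eq, sub_zero, abs_of_pos hp]
  linarith

theorem exists_abs_le (h : IsStress σ lam) {a : ℝ} (ha : 0 < a) (b : ℝ) :
    ∃ C, 0 ≤ C ∧ ∀ p ∈ Icc a b, |σ p| ≤ C := by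
  have hc : ContinuousOn σ (Icc a b) := h.continuousOn.mono fun p hp => ha.trans_le hp.1
  obtain ⟨C, hC⟩ := isCompact_Icc.exists_bound_of_continuousOn hc
  exact ⟨max C 0, le_max_right _ _, fun p hp => (hC p hp).trans (le_max_left _ _)⟩

end IsStress

/-- A Grönwall estimate: if `w w' ≤ K w² + |w| |e|` then `w²` is controlled by its initial value
and by the `L²` norm of `e`. -/
theorem sq_le_of_mul_deriv_le {w w' e : ℝ → ℝ} {a b K : ℝ} (hK : 0 ≤ K) (hab : a ≤ b)
    (hw : ∀ t ∈ Icc a b, HasDerivWithinAt w (w' t) (Icc a b) t) (he : ContinuousOn e (Icc a b))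
    (h : ∀ t ∈ Icc a b, w t * w' t ≤ K * w t ^ 2 + |w t| * |e t|) :
    w b ^ 2 ≤ Real.exp ((2 * K + 1) * (b - a)) * (w a ^ 2 + ∫ t in a..b, e t ^ 2) := by
  set k := 2 * K + 1
  set G : ℝ → ℝ := fun t => Real.exp (-(k * (t - a))) * w t ^ 2 - ∫ s in a..t, e s ^ 2
  have hint : IntervalIntegrable (fun s => e s ^ 2) volume a b :=
    ContinuousOn.intervalIntegrable (by rw [uIcc_of_le hab]; exact he.pow 2)
  have hanti : AntitoneOn G (Icc a b) := by
    refine antitoneOn_of_deriv_nonpos (convex_Icc _ _) ?_ ?_ ?_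
    · refine ContinuousOn.sub (ContinuousOn.mul (by fun_prop) ?_) ?_
      · exact fun t ht => ((hw t ht).continuousWithinAt).pow 2
      · have := intervalIntegral.continuousOn_primitive_interval (μ := volume) (a := a) (b := b)
          (f := fun s => e s ^ 2) (by
            rw [uIcc_of_le hab]; exact (he.pow 2).integrableOn_Icc)
        rwa [uIcc_of_le hab] at this
    all_goals
      intro t ht
      rw [interior_Icc] at ht
      have hmem := Icc_mem_nhds ht.1 ht.2
      have h1 : HasDerivAt w (w' t) t := (hw t (Ioo_subset_Icc_self ht)).hasDerivAt hmem
      have h2 : HasDerivAt (fun t => ∫ s in a..t, e s ^ 2) (e t ^ 2) t := by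
        refine intervalIntegral.integral_hasDerivAt_right ?_ ?_ ?_
        · exact hint.mono_set (by
            rw [uIcc_of_le hab, uIcc_of_le ht.1.le]; exact Icc_subset_Icc_right ht.2.le)
        · exact ((he.pow 2).mono Ioo_subset_Icc_self).stronglyMeasurableAtFilter isOpen_Ioo t ht
        · exact (he.pow 2).continuousAt hmem
      have h3 : HasDerivAt (fun t => Real.exp (-(k * (t - a))))
          (Real.exp (-(k * (t - a))) * (-k)) t := by
        have : HasDerivAt (fun t => -(k * (t - a))) (-k) t := by
          simpa using (((hasDerivAt_id t).sub_const a).const_mul k).fun_neg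
        exact this.exp
      have h4 := (h3.mul (h1.pow 2)).sub h2
    · exact h4.differentiableAt.differentiableWithinAt
    · have h5 : deriv G t = _ := h4.deriv
      rw [h5]
      have hh := h t (Ioo_subset_Icc_self ht)
      have hE0 := Real.exp_pos (-(k * (t - a)))
      have hE1 : Real.exp (-(k * (t - a))) ≤ 1 := by
        rw [Real.exp_le_one_iff]
        have : 0 ≤ k * (t - a) := mul_nonneg (by positivity) (by linarith [ht.1])
        linarith
      have h6 : 2 * (w t * w' t) - k * w t ^ 2 ≤ e t ^ 2 := by
        have := two_mul_le_add_sq (|w t|) (|e t|)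
        rw [sq_abs, sq_abs] at this
        simp only [k]; nlinarith
      have h7 : Real.exp (-(k * (t - a))) * (2 * (w t * w' t) - k * w t ^ 2) ≤ e t ^ 2 := by
        have := sq_nonneg (e t)
        nlinarith
      simp only [Nat.cast_ofNat]
      simp only [Pi.pow_apply]
      ring_nf at h7 ⊢
      linarith
  have := hanti (left_mem_Icc.2 hab) (right_mem_Icc.2 hab) hab
  simp only [G] at this
  simp only [sub_self, mul_zero, neg_zero, Real.exp_zero, one_mul,
    intervalIntegral.integral_same, sub_zero] at this
  have h8 : Real.exp (-(k * (b - a))) * w b ^ 2 ≤ w a ^ 2 + ∫ t in a..b, e t ^ 2 := by linarith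
  rw [Real.exp_neg, inv_mul_le_iff₀ (Real.exp_pos _)] at h8
  exact h8

/-- A barrier from below: if `y` increases whenever it lies below `a`, it stays above `a`. -/
theorem le_of_deriv_nonneg_of_le {y y' : ℝ → ℝ} {s T a : ℝ}
    (hy : ∀ t ∈ Icc s T, HasDerivWithinAt y (y' t) (Icc s T) t) (h0 : a ≤ y s)
    (h : ∀ t ∈ Icc s T, y t ≤ a → 0 ≤ y' t) : ∀ t ∈ Icc s T, a ≤ y t := by
  intro t ht
  by_contra! hlt
  have hcont : ContinuousOn y (Icc s T) := fun r hr => (hy r hr).continuousWithinAt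
  set Z := Icc s t ∩ y ⁻¹' Ici a
  have hsub : Icc s t ⊆ Icc s T := Icc_subset_Icc_right ht.2
  have hZc : IsCompact Z :=
    isCompact_Icc.of_isClosed_subset
      ((hcont.mono hsub).preimage_isClosed_of_isClosed isClosed_Icc isClosed_Ici) inter_subset_left
  have hZn : Z.Nonempty := ⟨s, left_mem_Icc.2 ht.1, h0⟩
  obtain ⟨r, ⟨hrZ, hra⟩, hmax⟩ := hZc.exists_isGreatest hZn
  have hrt : r < t := lt_of_le_of_ne hrZ.2 (by rintro rfl; exact absurd hra (not_le.2 hlt))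
  have hsub' : Icc r t ⊆ Icc s T := (Icc_subset_Icc_left hrZ.1).trans hsub
  have hm : MonotoneOn y (Icc r t) := by
    refine monotoneOn_of_deriv_nonneg (convex_Icc _ _) (hcont.mono hsub') ?_ ?_
    all_goals
      intro q hq
      rw [interior_Icc] at hq
      have hq' := hsub' (Ioo_subset_Icc_self hq)
      have hd : HasDerivAt y (y' q) q := (hy q hq').hasDerivAt
        (Icc_mem_nhds (hrZ.1.trans_lt hq.1) (hq.2.trans_le ht.2))
    · exact hd.differentiableAt.differentiableWithinAt
    · rw [hd.deriv]
      refine h q hq' (le_of_not_gt fun hgt => ?_)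
      exact absurd (hmax ⟨⟨hrZ.1.trans hq.1.le, hq.2.le⟩, hgt.le⟩) (not_le.2 hq.1)
  have := hm (left_mem_Icc.2 hrt.le) (right_mem_Icc.2 hrt.le) hrt.le
  exact absurd (le_trans hra this) (not_le.2 hlt)

/-- The square of an absolutely continuous function. -/
theorem sq_sub_sq_eq_integral {w h : ℝ → ℝ} {a b : ℝ} (hab : a ≤ b)
    (hh : IntervalIntegrable h volume a b)
    (hw : ∀ t ∈ Icc a b, w t = w a + ∫ r in a..t, h r) :
    w b ^ 2 - w a ^ 2 = 2 * ∫ r in a..b, w r * h r := by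
  set F : ℝ → ℝ := fun t => w a + ∫ r in a..t, h r
  have hac : AbsolutelyContinuousOnInterval F a b := by
    have h1 := hh.absolutelyContinuousOnInterval_intervalIntegral (c := a) (by simp)
    have h2 : AbsolutelyContinuousOnInterval (fun _ : ℝ => w a) a b :=
      (LipschitzWith.const (w a)).lipschitzOnWith.absolutelyContinuousOnInterval (K := 0)
    exact h2.add h1
  have hmul := hac.integral_deriv_mul_eq_sub hac
  have hFb : F b = w b := (hw b (right_mem_Icc.2 hab)).symm
  have hFa : F a = w a := (hw a (left_mem_Icc.2 hab)).symm
  rw [hFb, hFa] at hmul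
  have hder : ∀ᵐ r, r ∈ uIoc a b → deriv F r * F r + F r * deriv F r = 2 * (w r * h r) := by
    have := hh.ae_hasDerivAt_integral
    filter_upwards [this] with r hr hrm
    have hr' := hr (uIoc_subset_uIcc hrm) a (by simp)
    have hd : deriv F r = h r := (hr'.const_add (w a)).deriv
    rw [hd]
    rw [uIoc_of_le hab] at hrm
    have : F r = w r := (hw r (Ioc_subset_Icc_self hrm)).symm
    rw [this]; ring
  rw [intervalIntegral.integral_congr_ae hder, intervalIntegral.integral_const_mul] at hmul
  rw [hmul]; ring

/-! ### The equation for functions with finitely many values -/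

/-- A function of time whose derivative is at most `k` times itself grows at most like `exp`. -/
theorem le_exp_mul_of_deriv_le {Q Q' : ℝ → ℝ} {k a b : ℝ}
    (hQ : ∀ t ∈ Icc a b, HasDerivWithinAt Q (Q' t) (Icc a b) t)
    (h : ∀ t ∈ Icc a b, Q' t ≤ k * Q t) {s t : ℝ} (hs : a ≤ s) (hst : s ≤ t) (ht : t ≤ b) :
    Q t ≤ Real.exp (k * (t - s)) * Q s := by
  have hd : ∀ r ∈ Icc a b, HasDerivWithinAt (fun r => Real.exp (-(k * r)) * Q r)
      (Real.exp (-(k * r)) * (-k) * Q r + Real.exp (-(k * r)) * Q' r) (Icc a b) r := by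
    intro r hr
    have h1 : HasDerivAt (fun r => Real.exp (-(k * r))) (Real.exp (-(k * r)) * (-k)) r := by
      have : HasDerivAt (fun r => -(k * r)) (-k) r := by
        simpa using ((hasDerivAt_id r).const_mul k).fun_neg
      exact this.exp
    exact h1.hasDerivWithinAt.mul (hQ r hr)
  have hanti : AntitoneOn (fun r => Real.exp (-(k * r)) * Q r) (Icc a b) := by
    refine antitoneOn_of_deriv_nonpos (convex_Icc _ _)
      (fun r hr => (hd r hr).continuousWithinAt) ?_ ?_
    all_goals
      intro r hr
      rw [interior_Icc] at hr
      have := (hd r (Ioo_subset_Icc_self hr)).hasDerivAt (Icc_mem_nhds hr.1 hr.2)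
    · exact this.differentiableAt.differentiableWithinAt
    · rw [this.deriv]
      have := h r (Ioo_subset_Icc_self hr)
      have h2 := Real.exp_pos (-(k * r))
      nlinarith
  have h3 := hanti ⟨hs, hst.trans ht⟩ ⟨hs.trans hst, ht⟩ hst
  simp only at h3
  have h4 : Real.exp (k * t) * (Real.exp (-(k * t)) * Q t) = Q t := by
    rw [← mul_assoc, ← Real.exp_add]; simp
  have h5 : Real.exp (k * t) * (Real.exp (-(k * s)) * Q s) = Real.exp (k * (t - s)) * Q s := by
    rw [← mul_assoc, ← Real.exp_add]; congr 2; ring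
  calc Q t = Real.exp (k * t) * (Real.exp (-(k * t)) * Q t) := h4.symm
    _ ≤ Real.exp (k * t) * (Real.exp (-(k * s)) * Q s) :=
        mul_le_mul_of_nonneg_left h3 (Real.exp_pos _).le
    _ = _ := h5

section FiniteFlow

variable {ι : Type*} [Fintype ι]

/-- The equation `p_t = -σ(p) + ∫ σ(p)` for functions `p(·,t)` with finitely many values: `y t i`
is the `i`-th value at time `t`, taken on a set of measure `m i`. -/
structure IsFiniteFlow (σ : ℝ → ℝ) (m : ι → ℝ) (T : ℝ) (y : ℝ → ι → ℝ) : Prop where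
  pos : ∀ t ∈ Icc 0 T, ∀ i, 0 < y t i
  hasDeriv : ∀ t ∈ Icc 0 T, ∀ i, HasDerivWithinAt (fun s => y s i)
    (-σ (y t i) + ∑ j, m j * σ (y t j)) (Icc 0 T) t

/-- The finite system has global solutions. It is solved with `σ` composed with the projection `P`
onto an interval `[a,b]`, which makes the right-hand side bounded and globally Lipschitz. The
solution takes its values in `[a,b]`: the upper bound follows from the conservation of the mean and
the growth estimate for differences, the lower one because `a` is a barrier. -/
theorem exists_isFiniteFlow {σ : ℝ → ℝ} {lam : ℝ} (hσ : IsStress σ lam) {m : ι → ℝ}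
    (hm : ∀ i, 0 ≤ m i) (hm1 : ∑ i, m i = 1) {y₀ : ι → ℝ} (hy₀ : ∀ i, 0 < y₀ i) {T : ℝ}
    (hT : 0 < T) : ∃ y : ℝ → ι → ℝ, y 0 = y₀ ∧ IsFiniteFlow σ m T y := by
  set μ := ∑ i, m i * y₀ i with hμdef
  have hμ : 0 < μ := by
    by_contra! hle
    have h0 : ∑ i, m i * y₀ i = 0 :=
      le_antisymm hle (Finset.sum_nonneg fun i _ => mul_nonneg (hm i) (hy₀ i).le)
    rw [Finset.sum_eq_zero_iff_of_nonneg (fun i _ => mul_nonneg (hm i) (hy₀ i).le)] at h0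
    have : ∑ i, m i = 0 := Finset.sum_eq_zero fun i hi => by
      rcases mul_eq_zero.1 (h0 i hi) with h | h
      · exact h
      · exact absurd h (hy₀ i).ne'
    linarith
  obtain ⟨D, hD0, hD⟩ : ∃ D, 0 ≤ D ∧ ∀ i j, |y₀ i - y₀ j| ≤ D := by
    refine ⟨2 * ‖y₀‖, by positivity, fun i j => ?_⟩
    have h1 := norm_le_pi_norm y₀ i
    have h2 := norm_le_pi_norm y₀ j
    rw [Real.norm_eq_abs] at h1 h2
    have := abs_sub (y₀ i) (y₀ j)
    linarith
  have hlam := hσ.lam_nonneg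
  set E := Real.exp ((2 * lam + 1) * T) with hE
  have hE1 : 1 ≤ E := Real.one_le_exp (by positivity)
  set b := μ + E * D with hb
  have hED : 0 ≤ E * D := by positivity
  have hμb : μ ≤ b := by linarith
  have hbpos : 0 < b := hμ.trans_le hμb
  obtain ⟨C, hC0, hC⟩ := hσ.exists_abs_le (half_pos hμ) b
  -- The level `a` is so low that the mean stress can never lie below `σ a`.
  obtain ⟨a', ha'pos, ha'⟩ := hσ.exists_le_of_lt (-C - lam * b / (μ / (2 * b)))
  obtain ⟨d, hdpos, hd⟩ : ∃ d, 0 < d ∧ ∀ i, d ≤ y₀ i := by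
    rcases isEmpty_or_nonempty ι with hι | hι
    · exact ⟨1, one_pos, fun i => hι.elim i⟩
    · obtain ⟨i, hi⟩ := Finite.exists_min y₀
      exact ⟨y₀ i, hy₀ i, hi⟩
  set a := min (min a' d) (μ / 2) with ha
  have hapos : 0 < a := lt_min (lt_min ha'pos hdpos) (half_pos hμ)
  have haμ : a ≤ μ / 2 := min_le_right _ _
  have had : ∀ i, a ≤ y₀ i := fun i => ((min_le_left _ _).trans (min_le_right _ _)).trans (hd i)
  have hσa : σ a ≤ -C - lam * b / (μ / (2 * b)) :=
    ha' a hapos ((min_le_left _ _).trans (min_le_left _ _))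
  have hab : a ≤ b := by linarith
  set P : ℝ → ℝ := fun r => max a (min r b) with hP
  have hPmem : ∀ r, P r ∈ Icc a b := fun r => ⟨le_max_left _ _, max_le hab (min_le_right _ _)⟩
  have hPid : ∀ r ∈ Icc a b, P r = r := fun r hr => by
    simp only [hP]; rw [min_eq_left hr.2, max_eq_right hr.1]
  have hPlip : ∀ r s, |P r - P s| ≤ |r - s| := fun r s =>
    (abs_max_sub_max_le_max _ _ _ _).trans (max_le (by simp)
      ((abs_min_sub_min_le_max _ _ _ _).trans (max_le le_rfl (by simp))))
  have hPmono : Monotone P := fun r s hrs => max_le_max le_rfl (min_le_min hrs le_rfl)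
  set f : ℝ → ℝ := fun r => σ (P r) with hf
  have hPpos : ∀ r, 0 < P r := fun r => hapos.trans_le (hPmem r).1
  have hf_one : ∀ r s, -lam * (r - s) ^ 2 ≤ (f r - f s) * (r - s) := by
    have key : ∀ r s, s ≤ r → -lam * (r - s) ^ 2 ≤ (f r - f s) * (r - s) := by
      intro r s hsr
      have h1 := hσ.mono (hPpos s) (hPpos r) (hPmono hsr)
      have h2 := hPlip r s
      rw [abs_of_nonneg (sub_nonneg.2 (hPmono hsr)), abs_of_nonneg (sub_nonneg.2 hsr)] at h2
      simp only at h1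
      have h3 : -lam * (r - s) ≤ f r - f s := by simp only [hf]; nlinarith
      nlinarith [sub_nonneg.2 hsr]
    intro r s
    rcases le_total s r with h | h
    · exact key r s h
    · have := key s r h
      nlinarith
  have hsub : Icc a b ⊆ Ioi 0 := fun r hr => hapos.trans_le hr.1
  obtain ⟨K, hK⟩ := LocallyLipschitzOn.exists_lipschitzOnWith_of_compact isCompact_Icc
    (hσ.lip.mono hsub)
  have hflip : LipschitzWith K f := by
    refine LipschitzWith.of_dist_le_mul fun r s => ?_
    refine (hK.dist_le_mul _ (hPmem r) _ (hPmem s)).trans ?_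
    gcongr
    exact hPlip r s
  obtain ⟨C', hC'0, hC'⟩ := hσ.exists_abs_le hapos b
  have hfb : ∀ r, |f r| ≤ C' := fun r => hC' _ (hPmem r)
  set F : (ι → ℝ) → ι → ℝ := fun y i => -f (y i) + ∑ j, m j * f (y j) with hF
  have hFlip : LipschitzWith (K + K) F := by
    refine LipschitzWith.of_dist_le_mul fun y z => ?_
    rw [dist_pi_le_iff (by positivity)]
    intro i
    have h1 : ∀ j, |f (y j) - f (z j)| ≤ K * dist y z := fun j =>
      (hflip.dist_le_mul _ _).trans (by gcongr; exact dist_le_pi_dist y z j)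
    have h2 : |∑ j, m j * f (y j) - ∑ j, m j * f (z j)| ≤ K * dist y z := by
      rw [← Finset.sum_sub_distrib]
      calc |∑ j, (m j * f (y j) - m j * f (z j))|
          ≤ ∑ j, |m j * f (y j) - m j * f (z j)| := Finset.abs_sum_le_sum_abs _ _
        _ ≤ ∑ j, m j * (K * dist y z) := by
            refine Finset.sum_le_sum fun j _ => ?_
            rw [← mul_sub, abs_mul, abs_of_nonneg (hm j)]
            exact mul_le_mul_of_nonneg_left (h1 j) (hm j)
        _ = K * dist y z := by rw [← Finset.sum_mul, hm1, one_mul]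
    rw [Real.dist_eq]
    calc |F y i - F z i| = |(f (z i) - f (y i)) +
          (∑ j, m j * f (y j) - ∑ j, m j * f (z j))| := by simp only [hF]; congr 1; ring
      _ ≤ |f (z i) - f (y i)| + |∑ j, m j * f (y j) - ∑ j, m j * f (z j)| := abs_add_le _ _
      _ ≤ K * dist y z + K * dist y z := add_le_add (by rw [abs_sub_comm]; exact h1 i) h2
      _ = _ := by push_cast; ring
  have hFb : ∀ y, ‖F y‖ ≤ C' + C' := by
    intro y
    rw [pi_norm_le_iff_of_nonneg (by positivity)]
    intro i
    rw [Real.norm_eq_abs]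
    refine (abs_add_le _ _).trans (add_le_add (by rw [abs_neg]; exact hfb _) ?_)
    calc |∑ j, m j * f (y j)| ≤ ∑ j, |m j * f (y j)| := Finset.abs_sum_le_sum_abs _ _
      _ ≤ ∑ j, m j * C' := by
          refine Finset.sum_le_sum fun j _ => ?_
          rw [abs_mul, abs_of_nonneg (hm j)]
          exact mul_le_mul_of_nonneg_left (hfb _) (hm j)
      _ = C' := by rw [← Finset.sum_mul, hm1, one_mul]
  have hPL : IsPicardLindelof (fun _ : ℝ => F) (⟨0, left_mem_Icc.2 hT.le⟩ : Icc (0 : ℝ) T) y₀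
      ((Real.toNNReal (C' + C')) * Real.toNNReal T) 0 (Real.toNNReal (C' + C')) (K + K) := by
    refine ⟨fun t _ => hFlip.lipschitzOnWith, fun _ _ => continuousOn_const, fun t _ y _ => ?_, ?_⟩
    · rw [Real.coe_toNNReal _ (by positivity)]; exact hFb y
    · simp [hT.le]
  obtain ⟨y, hy0, hy⟩ := hPL.exists_eq_forall_mem_Icc_hasDerivWithinAt₀
  simp only at hy0 hy
  have hyi : ∀ t ∈ Icc 0 T, ∀ i, HasDerivWithinAt (fun s => y s i)
      (-f (y t i) + ∑ j, m j * f (y t j)) (Icc 0 T) t := fun t ht i =>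
    (hasDerivWithinAt_pi.1 (hy t ht)) i
  have hmean : ∀ t ∈ Icc 0 T, ∑ i, m i * y t i = μ := by
    have hd : ∀ t ∈ Icc 0 T, HasDerivWithinAt (fun s => ∑ i, m i * y s i) 0 (Icc 0 T) t := by
      intro t ht
      refine (HasDerivWithinAt.fun_sum fun i _ => (hyi t ht i).const_mul (m i)).congr_deriv ?_
      simp only [mul_add, mul_neg, Finset.sum_add_distrib, Finset.sum_neg_distrib]
      rw [← Finset.sum_mul, hm1]; ring
    intro t ht
    have := constant_of_derivWithin_zero (f := fun s => ∑ i, m i * y s i)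
      (fun r hr => (hd r hr).differentiableWithinAt)
      (fun r hr => (hd r (Ico_subset_Icc_self hr)).derivWithin
        (uniqueDiffOn_Icc hT r (Ico_subset_Icc_self hr))) t ht
    rw [this, hy0]
  have hpair : ∀ t ∈ Icc 0 T, ∀ i j, |y t i - y t j| ≤ E * D := by
    intro t ht i j
    have hsub : Icc 0 t ⊆ Icc 0 T := Icc_subset_Icc_right ht.2
    have := sq_le_of_mul_deriv_le (w := fun s => y s i - y s j) (e := fun _ => 0)
      (w' := fun s => -f (y s i) + f (y s j)) hlam ht.1 (fun s hs =>
        (((hyi s (hsub hs) i).mono hsub).sub ((hyi s (hsub hs) j).mono hsub)).congr_deriv (by ring))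
      continuousOn_const (fun s _ => by
        have := hf_one (y s i) (y s j)
        simp only [abs_zero, mul_zero, add_zero]
        nlinarith)
    simp only [hy0, ne_eq, OfNat.ofNat_ne_zero, not_false_eq_true, zero_pow,
      intervalIntegral.integral_zero, add_zero, sub_zero] at this
    refine abs_le_of_sq_le_sq' ?_ hED |> abs_le.2
    have h1 : Real.exp ((2 * lam + 1) * t) ≤ E := Real.exp_le_exp.2 (by nlinarith [ht.2])
    have h2 : (y₀ i - y₀ j) ^ 2 ≤ D ^ 2 := by rw [← sq_abs]; gcongr; exact hD i j
    calc (y t i - y t j) ^ 2 ≤ E * D ^ 2 := this.trans (by gcongr)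
      _ ≤ (E * D) ^ 2 := by rw [mul_pow]; gcongr; nlinarith
  have hyb : ∀ t ∈ Icc 0 T, ∀ i, y t i ≤ b := by
    intro t ht i
    have h1 : y t i - μ = ∑ j, m j * (y t i - y t j) := by
      simp only [mul_sub, Finset.sum_sub_distrib]
      rw [← Finset.sum_mul, hm1, hmean t ht, one_mul]
    have h2 : ∑ j, m j * (y t i - y t j) ≤ ∑ j, m j * (E * D) :=
      Finset.sum_le_sum fun j _ =>
        mul_le_mul_of_nonneg_left ((le_abs_self _).trans (hpair t ht i j)) (hm j)
    rw [← Finset.sum_mul, hm1, one_mul] at h2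
    linarith
  have hclow : ∀ t ∈ Icc 0 T, σ a ≤ ∑ j, m j * f (y t j) := by
    intro t ht
    set J : ι → ℝ := fun j => if μ / 2 ≤ y t j then 1 else 0 with hJ
    have hmass : μ / (2 * b) ≤ ∑ j, m j * J j := by
      have h1 : μ ≤ ∑ j, m j * (μ / 2 + b * J j) := by
        refine (hmean t ht).symm.le.trans (Finset.sum_le_sum fun j _ => ?_)
        refine mul_le_mul_of_nonneg_left ?_ (hm j)
        simp only [hJ]
        split_ifs with h
        · have := hyb t ht j; linarith
        · linarith [not_le.1 h]
      simp only [mul_add, Finset.sum_add_distrib] at h1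
      rw [← Finset.sum_mul, hm1] at h1
      have h2 : ∑ j, m j * (b * J j) = b * ∑ j, m j * J j := by
        rw [Finset.mul_sum]; exact Finset.sum_congr rfl fun j _ => by ring
      rw [h2] at h1
      rw [div_le_iff₀ (by positivity)]
      linarith
    -- `f` is at least `σ a - lam * b` everywhere, and at least `-C` at values above `μ / 2`.
    have hpt : ∀ j, σ a + -(lam * b) + J j * (-C - σ a) ≤ f (y t j) := by
      intro j
      simp only [hJ]
      split_ifs with h
      · have : f (y t j) = σ (y t j) := by simp only [hf]; rw [hPid _ ⟨haμ.trans h, hyb t ht j⟩]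
        rw [this]
        have := (abs_le.1 (hC (y t j) ⟨h, hyb t ht j⟩)).1
        have : 0 ≤ lam * b := by positivity
        linarith
      · have h1 := hσ.mono hapos (hPpos (y t j)) (hPmem (y t j)).1
        simp only at h1
        have h2 := mul_le_mul_of_nonneg_left (hPmem (y t j)).2 hlam
        have h3 : 0 ≤ lam * a := by positivity
        simp only [hf]
        linarith
    have hsum : ∑ j, m j * (σ a + -(lam * b) + J j * (-C - σ a)) ≤ ∑ j, m j * f (y t j) :=
      Finset.sum_le_sum fun j _ => mul_le_mul_of_nonneg_left (hpt j) (hm j)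
    have hsum' : ∑ j, m j * (σ a + -(lam * b) + J j * (-C - σ a)) =
        σ a + -(lam * b) + (∑ j, m j * J j) * (-C - σ a) := by
      simp only [mul_add, Finset.sum_add_distrib]
      rw [← Finset.sum_mul, ← Finset.sum_mul, hm1, Finset.sum_mul]
      simp only [one_mul, mul_assoc]
    rw [hsum'] at hsum
    have hδ : 0 < μ / (2 * b) := by positivity
    have h1 : lam * b / (μ / (2 * b)) ≤ -C - σ a := by linarith
    rw [div_le_iff₀ hδ] at h1
    have h0 : 0 ≤ -C - σ a := le_trans (by positivity) (by linarith : lam * b / (μ / (2 * b)) ≤ _)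
    nlinarith
  have hya : ∀ i, ∀ t ∈ Icc 0 T, a ≤ y t i := by
    intro i
    refine le_of_deriv_nonneg_of_le (fun t ht => hyi t ht i) (by rw [hy0]; exact had i) ?_
    intro t ht hle
    have : f (y t i) = σ a := by
      simp only [hf, hP]; rw [max_eq_left ((min_le_left _ _).trans hle)]
    rw [this]
    linarith [hclow t ht]
  have hfσ : ∀ t ∈ Icc 0 T, ∀ i, f (y t i) = σ (y t i) := fun t ht i => by
    simp only [hf]; rw [hPid _ ⟨hya i t ht, hyb t ht i⟩]
  refine ⟨y, hy0, ⟨fun t ht i => hapos.trans_le (hya i t ht), fun t ht i => ?_⟩⟩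
  have := hyi t ht i
  simpa only [hfσ t ht] using this

end FiniteFlow

/-! ### Contraction and regularizing effect for finite-valued functions -/

namespace IsFiniteFlow

variable {ι : Type*} [Fintype ι] {σ : ℝ → ℝ} {lam : ℝ} {m : ι → ℝ} {T : ℝ} {y z : ℝ → ι → ℝ}

/-- The right-hand side of the finite system. -/
def velocity (σ : ℝ → ℝ) (m : ι → ℝ) (v : ι → ℝ) (i : ι) : ℝ := -σ (v i) + ∑ j, m j * σ (v j)

theorem sum_mul_velocity (hm1 : ∑ i, m i = 1) (v : ι → ℝ) :
    ∑ i, m i * velocity σ m v i = 0 := by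
  simp only [velocity, mul_add, mul_neg, Finset.sum_add_distrib, Finset.sum_neg_distrib]
  rw [← Finset.sum_mul, hm1]; ring

theorem continuousOn (hy : IsFiniteFlow σ m T y) (i : ι) :
    ContinuousOn (fun t => y t i) (Icc 0 T) := fun t ht => (hy.hasDeriv t ht i).continuousWithinAt

theorem sum_eq (hm1 : ∑ i, m i = 1) (hT : 0 < T) (hy : IsFiniteFlow σ m T y) {t : ℝ}
    (ht : t ∈ Icc 0 T) : ∑ i, m i * y t i = ∑ i, m i * y 0 i := by
  have hd : ∀ t ∈ Icc 0 T, HasDerivWithinAt (fun s => ∑ i, m i * y s i) 0 (Icc 0 T) t := by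
    intro t ht
    exact (HasDerivWithinAt.fun_sum fun i _ => (hy.hasDeriv t ht i).const_mul (m i)).congr_deriv
      (sum_mul_velocity hm1 (y t))
  exact constant_of_derivWithin_zero (f := fun s => ∑ i, m i * y s i)
    (fun r hr => (hd r hr).differentiableWithinAt)
    (fun r hr => (hd r (Ico_subset_Icc_self hr)).derivWithin
      (uniqueDiffOn_Icc hT r (Ico_subset_Icc_self hr))) t ht

/-- Contraction, up to an exponential factor, of two flows with the same mean. -/
theorem sum_sq_sub_le (hσ : IsStress σ lam) (hm : ∀ i, 0 ≤ m i) (hm1 : ∑ i, m i = 1) (hT : 0 < T)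
    (hy : IsFiniteFlow σ m T y) (hz : IsFiniteFlow σ m T z)
    (h0 : ∑ i, m i * y 0 i = ∑ i, m i * z 0 i) {s t : ℝ} (hs : 0 ≤ s) (hst : s ≤ t) (ht : t ≤ T) :
    ∑ i, m i * (y t i - z t i) ^ 2 ≤
      Real.exp (2 * lam * (t - s)) * ∑ i, m i * (y s i - z s i) ^ 2 := by
  refine le_exp_mul_of_deriv_le (Q := fun t => ∑ i, m i * (y t i - z t i) ^ 2)
    (Q' := fun t => ∑ i, m i * (2 * (y t i - z t i) *
      (velocity σ m (y t) i - velocity σ m (z t) i))) ?_ ?_ hs hst ht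
  · intro r hr
    refine HasDerivWithinAt.fun_sum fun i _ => ?_
    refine ((((hy.hasDeriv r hr i).sub (hz.hasDeriv r hr i)).pow 2).const_mul (m i)).congr_deriv ?_
    simp only [velocity]
    simp
  · intro r hr
    set c := ∑ j, m j * σ (y r j) with hc
    set d := ∑ j, m j * σ (z r j) with hd
    have hmean : ∑ i, m i * (y r i - z r i) = 0 := by
      simp only [mul_sub, Finset.sum_sub_distrib]
      rw [hy.sum_eq hm1 hT hr, hz.sum_eq hm1 hT hr, h0, sub_self]
    have hz0 : ∑ i, 2 * (c - d) * (m i * (y r i - z r i)) = 0 := by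
      rw [← Finset.mul_sum, hmean, mul_zero]
    calc ∑ i, m i * (2 * (y r i - z r i) * (velocity σ m (y r) i - velocity σ m (z r) i))
        ≤ ∑ i, (2 * lam * (m i * (y r i - z r i) ^ 2) + 2 * (c - d) * (m i * (y r i - z r i))) := by
          refine Finset.sum_le_sum fun i _ => ?_
          have h1 := mul_le_mul_of_nonneg_left
            (hσ.neg_le_sub_mul_sub (hy.pos r hr i) (hz.pos r hr i)) (hm i)
          simp only [velocity, ← hc, ← hd]
          linarith
      _ = _ := by rw [Finset.sum_add_distrib, hz0, add_zero, ← Finset.mul_sum]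

theorem const (hm1 : ∑ i, m i = 1) {μ : ℝ} (hμ : 0 < μ) :
    IsFiniteFlow σ m T (fun _ _ => μ) := by
  refine ⟨fun _ _ _ => hμ, fun t _ i => ?_⟩
  refine (hasDerivWithinAt_const t (Icc 0 T) μ).congr_deriv ?_
  rw [← Finset.sum_mul, hm1]; ring

theorem shift (hy : IsFiniteFlow σ m T y) {h : ℝ} (hh : 0 ≤ h) :
    IsFiniteFlow σ m (T - h) (fun t => y (t + h)) := by
  have hmem : ∀ t ∈ Icc 0 (T - h), t + h ∈ Icc 0 T := fun t ht =>
    ⟨by linarith [ht.1], by linarith [ht.2]⟩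
  refine ⟨fun t ht i => hy.pos _ (hmem t ht) i, fun t ht i => ?_⟩
  have h1 := HasDerivWithinAt.scomp t (h := fun t => t + h) (h' := 1)
    (hy.hasDeriv (t + h) (hmem t ht) i) (hasDerivWithinAt_id t (Icc 0 (T - h)) |>.add_const h) hmem
  simpa [Function.comp_def] using h1

theorem mono (hy : IsFiniteFlow σ m T y) {T' : ℝ} (hT' : T' ≤ T) : IsFiniteFlow σ m T' y :=
  have hsub : Icc 0 T' ⊆ Icc 0 T := Icc_subset_Icc_right hT'
  ⟨fun t ht => hy.pos t (hsub ht), fun t ht i => (hy.hasDeriv t (hsub ht) i).mono hsub⟩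

/-- The size of the velocity grows at most exponentially: compare the flow with its own shifts. -/
theorem sum_sq_velocity_le (hσ : IsStress σ lam) (hm : ∀ i, 0 ≤ m i) (hm1 : ∑ i, m i = 1)
    (hy : IsFiniteFlow σ m T y) {s t : ℝ} (hs : 0 ≤ s) (hst : s ≤ t) (ht : t < T) :
    ∑ i, m i * velocity σ m (y t) i ^ 2 ≤
      Real.exp (2 * lam * (t - s)) * ∑ i, m i * velocity σ m (y s) i ^ 2 := by
  have hT : 0 < T := (hs.trans hst).trans_lt ht
  have hlim : ∀ r, 0 ≤ r → r < T → Tendsto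
      (fun h => ∑ i, m i * (h⁻¹ * (y (r + h) i - y r i)) ^ 2) (𝓝[>] 0)
      (𝓝 (∑ i, m i * velocity σ m (y r) i ^ 2)) := by
    intro r hr0 hrT
    refine tendsto_finsetSum _ fun i _ => Tendsto.const_mul _ (Tendsto.pow ?_ 2)
    have hd : HasDerivWithinAt (fun s => y s i) (velocity σ m (y r) i) (Ici r) r := by
      refine (hy.hasDeriv r ⟨hr0, hrT.le⟩ i).mono_of_mem_nhdsWithin ?_
      exact mem_of_superset (Icc_mem_nhdsGE hrT) (Icc_subset_Icc_left hr0)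
    have := (hasDerivWithinAt_iff_tendsto_slope' self_notMem_Ioi).1 hd.Ioi_of_Ici
    have hmap : Tendsto (fun h : ℝ => r + h) (𝓝[>] 0) (𝓝[>] r) := by
      refine tendsto_nhdsWithin_iff.2 ⟨?_, ?_⟩
      · have : Tendsto (fun h : ℝ => r + h) (𝓝 0) (𝓝 (r + 0)) := by
          exact (continuous_const.add continuous_id).tendsto 0
        rw [add_zero] at this
        exact this.mono_left nhdsWithin_le_nhds
      · filter_upwards [self_mem_nhdsWithin] with h hh
        simpa using hh
    refine (this.comp hmap).congr fun h => ?_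
    simp [slope_def_field, div_eq_inv_mul]
  refine le_of_tendsto_of_tendsto (hlim t (hs.trans hst) ht)
    ((hlim s hs (hst.trans_lt ht)).const_mul _) ?_
  filter_upwards [Ioo_mem_nhdsGT (sub_pos.2 ht)] with h hh
  have h1 := sum_sq_sub_le hσ hm hm1 (T := T - h) (by linarith [hh.2]) (hy.shift hh.1.le)
    (hy.mono (by linarith [hh.1])) (by
      simp only [zero_add]
      exact hy.sum_eq hm1 hT ⟨hh.1.le, by linarith [hh.2]⟩) hs hst (by linarith [hh.2])
  have h2 : ∀ r, ∑ i, m i * (h⁻¹ * (y (r + h) i - y r i)) ^ 2 =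
      h⁻¹ ^ 2 * ∑ i, m i * (y (r + h) i - y r i) ^ 2 := fun r => by
    rw [Finset.mul_sum]; exact Finset.sum_congr rfl fun i _ => by ring
  rw [h2, h2]
  have h3 := mul_le_mul_of_nonneg_left h1 (sq_nonneg h⁻¹)
  linarith

/-- The regularizing effect of the gradient flow: the velocity at time `t > 0` is controlled by the
`L²` distance of the initial value from equilibrium. The Lyapunov function is
`½ ‖y - μ‖² + s (E(y) - E(μ))`, corrected by terms that account for `lam` and collect the
dissipation. -/
theorem sq_mul_sum_sq_velocity_le (hσ : IsStress σ lam) (hm : ∀ i, 0 ≤ m i) (hm1 : ∑ i, m i = 1)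
    (hy : IsFiniteFlow σ m T y) {μ : ℝ} (hμ : 0 < μ) (hμy : ∑ i, m i * y 0 i = μ) {t : ℝ}
    (ht0 : 0 < t) (ht : t < T) :
    t ^ 2 * ∑ i, m i * velocity σ m (y t) i ^ 2 ≤
      Real.exp (2 * lam * T) * ((1 + 2 * lam * T * Real.exp (2 * lam * T)) *
        ∑ i, m i * (y 0 i - μ) ^ 2) := by
  have hT : 0 < T := ht0.trans ht
  have hlam := hσ.lam_nonneg
  set D := ∑ i, m i * (y 0 i - μ) ^ 2 with hD
  have hD0 : 0 ≤ D := Finset.sum_nonneg fun i _ => mul_nonneg (hm i) (sq_nonneg _)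
  set M := Real.exp (2 * lam * T) * D with hM
  have hM0 : 0 ≤ M := mul_nonneg (Real.exp_pos _).le hD0
  set N : ℝ → ℝ := fun s => ∑ i, m i * velocity σ m (y s) i ^ 2 with hN
  have hN0 : 0 ≤ N t := Finset.sum_nonneg fun i _ => mul_nonneg (hm i) (sq_nonneg _)
  set Q : ℝ → ℝ := fun s => ∑ i, m i * (y s i - μ) ^ 2 with hQ
  have hmean : ∀ s ∈ Icc 0 T, ∑ i, m i * y s i = μ := fun s hs => (hy.sum_eq hm1 hT hs).trans hμy
  have hQM : ∀ s ∈ Icc 0 T, Q s ≤ M := by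
    intro s hs
    have := sum_sq_sub_le hσ hm hm1 hT hy (const hm1 hμ) (by
      rw [hμy, ← Finset.sum_mul, hm1, one_mul]) le_rfl hs.1 hs.2
    refine this.trans ?_
    simp only [hM, hD]
    refine mul_le_mul_of_nonneg_right (Real.exp_le_exp.2 ?_) hD0
    have := mul_le_mul_of_nonneg_left hs.2 (mul_nonneg zero_le_two hlam)
    linarith
  -- `κ` bounds the dissipation `N` from below on all of `[0,t]`.
  set κ := Real.exp (-(2 * lam * T)) * N t with hκ
  have hκN : ∀ s ∈ Icc 0 t, κ ≤ N s := by
    intro s hs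
    have h1 := hy.sum_sq_velocity_le hσ hm hm1 hs.1 hs.2 ht
    have h2 : Real.exp (2 * lam * (t - s)) * N s ≤ Real.exp (2 * lam * T) * N s := by
      refine mul_le_mul_of_nonneg_right (Real.exp_le_exp.2 ?_)
        (Finset.sum_nonneg fun i _ => mul_nonneg (hm i) (sq_nonneg _))
      exact mul_le_mul_of_nonneg_left (by linarith [hs.1]) (mul_nonneg zero_le_two hlam)
    simp only [hκ]
    rw [Real.exp_neg, inv_mul_le_iff₀ (Real.exp_pos _)]
    exact h1.trans h2
  set E : ℝ → ℝ := fun s => ∑ i, m i * storedEnergy σ (y s i) with hE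
  set w := storedEnergy σ μ with hw
  set L : ℝ → ℝ := fun s => Q s / 2 + s * (E s - w) - lam / 2 * M * s + κ * s ^ 2 / 2 with hL
  have hsub : Icc 0 t ⊆ Icc 0 T := Icc_subset_Icc_right ht.le
  have hQd : ∀ s ∈ Icc 0 T, HasDerivWithinAt Q
      (∑ i, m i * (2 * (y s i - μ) * velocity σ m (y s) i)) (Icc 0 T) s := by
    intro s hs
    refine HasDerivWithinAt.fun_sum fun i _ => ?_
    refine ((((hy.hasDeriv s hs i).sub_const μ).pow 2).const_mul (m i)).congr_deriv ?_
    simp [velocity]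
  have hEd : ∀ s ∈ Icc 0 T, HasDerivWithinAt E (-N s) (Icc 0 T) s := by
    intro s hs
    have : HasDerivWithinAt E (∑ i, m i * (σ (y s i) * velocity σ m (y s) i)) (Icc 0 T) s := by
      refine HasDerivWithinAt.fun_sum fun i _ => HasDerivWithinAt.const_mul (m i) ?_
      exact (hasDerivAt_storedEnergy hσ.continuousOn (hy.pos s hs i)).comp_hasDerivWithinAt s
        (hy.hasDeriv s hs i)
    refine this.congr_deriv ?_
    set c := ∑ j, m j * σ (y s j) with hc
    have h0 : ∑ i, c * (m i * velocity σ m (y s) i) = 0 := by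
      rw [← Finset.mul_sum, sum_mul_velocity hm1, mul_zero]
    have : ∀ i, m i * (σ (y s i) * velocity σ m (y s) i) =
        c * (m i * velocity σ m (y s) i) - m i * velocity σ m (y s) i ^ 2 := by
      intro i
      have : σ (y s i) = c - velocity σ m (y s) i := by simp [velocity, hc]
      rw [this]; ring
    simp only [this, Finset.sum_sub_distrib, h0, hN, zero_sub]
  have hLd : ∀ s ∈ Icc 0 T, HasDerivWithinAt L
      ((∑ i, m i * (2 * (y s i - μ) * velocity σ m (y s) i)) / 2 + (1 * (E s - w) + s * (-N s)) -
        lam / 2 * M + κ * s) (Icc 0 T) s := by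
    intro s hs
    have hi := hasDerivWithinAt_id s (Icc 0 T)
    have h2 := ((hQd s hs).div_const 2).add (hi.mul ((hEd s hs).sub_const w))
    have h3 := (h2.sub (hi.const_mul (lam / 2 * M))).add (((hi.pow 2).const_mul κ).div_const 2)
    refine h3.congr_deriv ?_
    simp only [id, Nat.cast_ofNat, mul_one]
    ring
  have hanti : AntitoneOn L (Icc 0 t) := by
    refine antitoneOn_of_deriv_nonpos (convex_Icc _ _)
      (fun r hr => ((hLd r (hsub hr)).mono hsub).continuousWithinAt) ?_ ?_
    all_goals
      intro r hr
      rw [interior_Icc] at hr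
      have hr' := hsub (Ioo_subset_Icc_self hr)
      have := (hLd r hr').hasDerivAt (Icc_mem_nhds hr.1 (hr.2.trans ht))
    · exact this.differentiableAt.differentiableWithinAt
    · rw [this.deriv]
      have h1 : (∑ i, m i * (2 * (y r i - μ) * velocity σ m (y r) i)) / 2 + (E r - w) ≤
          lam / 2 * Q r := by
        have h0 : ∑ i, m i * (y r i - μ) = 0 := by
          simp only [mul_sub, Finset.sum_sub_distrib]
          rw [hmean r hr', ← Finset.sum_mul, hm1, one_mul, sub_self]
        have h2 : w = ∑ i, m i * w := by rw [← Finset.sum_mul, hm1, one_mul]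
        have h3 : ∀ i, m i * (2 * (y r i - μ) * velocity σ m (y r) i) / 2 +
            m i * storedEnergy σ (y r i) ≤ lam / 2 * (m i * (y r i - μ) ^ 2) + m i * w +
              (∑ j, m j * σ (y r j)) * (m i * (y r i - μ)) := by
          intro i
          have := mul_le_mul_of_nonneg_left (hσ.storedEnergy_tangent (hy.pos r hr' i) hμ) (hm i)
          simp only [velocity, hw]
          linarith
        have h4 := Finset.sum_le_sum fun i (_ : i ∈ Finset.univ) => h3 i
        rw [Finset.sum_add_distrib, Finset.sum_add_distrib, Finset.sum_add_distrib, ← h2,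
          ← Finset.mul_sum, ← Finset.mul_sum, h0, ← Finset.sum_div] at h4
        simp only [hE, hQ]
        linarith
      have h2 := mul_le_mul_of_nonneg_left (hQM r hr') (by positivity : 0 ≤ lam / 2)
      have h3 := mul_le_mul_of_nonneg_left (hκN r (Ioo_subset_Icc_self hr)) hr.1.le
      linarith
  have hfin := hanti (left_mem_Icc.2 ht0.le) (right_mem_Icc.2 ht0.le) ht0.le
  have htT : t ∈ Icc 0 T := ⟨ht0.le, ht.le⟩
  have hElow : -(lam / 2 * M) ≤ E t - w := by
    have h0 : ∑ i, m i * (y t i - μ) = 0 := by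
      simp only [mul_sub, Finset.sum_sub_distrib]
      rw [hmean t htT, ← Finset.sum_mul, hm1, one_mul, sub_self]
    have h2 : w = ∑ i, m i * w := by rw [← Finset.sum_mul, hm1, one_mul]
    have h3 : ∀ i, m i * w + σ μ * (m i * (y t i - μ)) - lam / 2 * (m i * (y t i - μ) ^ 2) ≤
        m i * storedEnergy σ (y t i) := by
      intro i
      have := mul_le_mul_of_nonneg_left (hσ.storedEnergy_tangent hμ (hy.pos t htT i)) (hm i)
      simp only [hw]
      linarith
    have h4 := Finset.sum_le_sum fun i (_ : i ∈ Finset.univ) => h3 i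
    rw [Finset.sum_sub_distrib, Finset.sum_add_distrib, ← h2, ← Finset.mul_sum, ← Finset.mul_sum,
      h0] at h4
    have h5 := mul_le_mul_of_nonneg_left (hQM t htT) (by positivity : 0 ≤ lam / 2)
    simp only [hE, hQ] at h5 ⊢
    linarith
  have hQt : 0 ≤ Q t := Finset.sum_nonneg fun i _ => mul_nonneg (hm i) (sq_nonneg _)
  have hL0 : L 0 = D / 2 := by simp [hL, hQ, hD]
  rw [hL0] at hfin
  simp only [hL] at hfin
  have h5 := mul_le_mul_of_nonneg_left hElow ht0.le
  have h6 : κ * t ^ 2 ≤ D + 2 * lam * M * t := by linarith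
  have h7 : D + 2 * lam * M * t ≤ (1 + 2 * lam * T * Real.exp (2 * lam * T)) * D := by
    have : 2 * lam * M * t ≤ 2 * lam * M * T :=
      mul_le_mul_of_nonneg_left ht.le (by positivity)
    have h8 : 2 * lam * M * T = 2 * lam * T * Real.exp (2 * lam * T) * D := by
      simp only [hM]; ring
    linarith
  have h8 : Real.exp (2 * lam * T) * κ = N t := by
    simp only [hκ]; rw [← mul_assoc, ← Real.exp_add]; simp
  calc t ^ 2 * N t = Real.exp (2 * lam * T) * (κ * t ^ 2) := by rw [← h8]; ring
    _ ≤ _ := mul_le_mul_of_nonneg_left (h6.trans h7) (Real.exp_pos _).le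

end IsFiniteFlow

/-! ### The mean stress of an arbitrary solution is integrable in time -/

theorem norm_sq_eq_integral (f : L2) : ‖f‖ ^ 2 = ∫ x, (f x) ^ 2 ∂unitVol := by
  rw [← real_inner_self_eq_norm_sq, L2.inner_def]
  exact integral_congr_ae (Eventually.of_forall fun x => by simp [sq])

theorem norm_sq_sub_eq_integral {f g : L2} {p q : ℝ → ℝ} (hf : ∀ᵐ x ∂unitVol, f x = p x)
    (hg : ∀ᵐ x ∂unitVol, g x = q x) : ‖f - g‖ ^ 2 = ∫ x, (p x - q x) ^ 2 ∂unitVol := by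
  rw [norm_sq_eq_integral]
  refine integral_congr_ae ?_
  filter_upwards [Lp.coeFn_sub f g, hf, hg] with x h1 h2 h3
  rw [h1, Pi.sub_apply, h2, h3]

instance : IsProbabilityMeasure unitVol := ⟨by simp [unitVol]⟩

/-- Integrability on a product from integrability in the first variable alone. -/
theorem integrable_prod_of_integral_norm_le {α β : Type*} [MeasurableSpace α] [MeasurableSpace β]
    {μ : Measure α} {ν : Measure β} [SFinite μ] [SFinite ν] {f : α × β → ℝ} {g : β → ℝ}
    (hf : AEStronglyMeasurable f (μ.prod ν)) (hg : Integrable g ν)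
    (h : ∀ᵐ t ∂ν, Integrable (fun x => f (x, t)) μ ∧ ∫ x, ‖f (x, t)‖ ∂μ ≤ g t) :
    Integrable f (μ.prod ν) := by
  rw [integrable_prod_iff' hf]
  refine ⟨h.mono fun t ht => ht.1, ?_⟩
  refine hg.mono' (hf.norm.prod_swap.integral_prod_right') ?_
  filter_upwards [h] with t ht
  rw [Real.norm_of_nonneg (integral_nonneg fun _ => norm_nonneg _)]
  exact ht.2

theorem aestronglyMeasurable_comp_of_continuousOn_Ioi {α : Type*} [MeasurableSpace α]
    {μ : Measure α} {σ : ℝ → ℝ} (hσ : ContinuousOn σ (Ioi (0 : ℝ))) {f : α → ℝ} (hf : AEStronglyMeasurable f μ)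
    (hpos : ∀ᵐ z ∂μ, 0 < f z) : AEStronglyMeasurable (fun z => σ (f z)) μ := by
  classical
  have hm : Measurable ((Ioi (0 : ℝ)).piecewise σ 0) :=
    hσ.measurable_piecewise continuousOn_const measurableSet_Ioi
  have h1 : AEStronglyMeasurable (fun z => (Ioi (0 : ℝ)).piecewise σ 0 (f z)) μ :=
    (hm.comp_aemeasurable hf.aemeasurable).aestronglyMeasurable
  refine h1.congr ?_
  filter_upwards [hpos] with z hz
  exact piecewise_eq_of_mem _ _ _ hz

/-- The mean stress is controlled by the excess stress, even if the latter is only known on a set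
`A` of almost full measure: a function `q` with mean bounded below and bounded `L²` norm takes
moderate values, where `σ` is bounded, on a set of positive measure. This set is weighted by the
positive part of `ψ(q) = q - κ - q² / k`. -/
theorem IsStress.exists_abs_le_excess {σ : ℝ → ℝ} {lam : ℝ} (hσ : IsStress σ lam) {κ R : ℝ}
    (hκ : 0 < κ) (hR : 0 < R) :
    ∃ K ε : ℝ, 0 ≤ K ∧ 0 < ε ∧ ∀ (q : ℝ → ℝ) (c : ℝ) (A : Set ℝ), MemLp q 2 unitVol →
      2 * κ ≤ ∫ x, q x ∂unitVol → ∫ x, q x ^ 2 ∂unitVol ≤ R → MeasurableSet A →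
      unitVol.real Aᶜ ≤ ε → IntegrableOn (fun x => σ (q x) - c) A unitVol →
      |c| ≤ K * (∫ x in A, |σ (q x) - c| ∂unitVol + 1) := by
  set k := 2 * R / κ with hk
  have hk0 : 0 < k := by positivity
  obtain ⟨C, hC0, hC⟩ := hσ.exists_abs_le hκ k
  refine ⟨k / κ * (C + 1), κ / k, by positivity, by positivity, ?_⟩
  intro q c A hq hmean hsq hA hAc hint
  have hq1 : Integrable q unitVol := hq.integrable (by norm_num)
  have hq2 : Integrable (fun x => q x ^ 2) unitVol := hq.integrable_sq
  set ψ : ℝ → ℝ := fun r => r - κ - r ^ 2 / k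
  have hψle : ∀ r, ψ r ≤ k / 4 := by
    intro r
    have h1 : r ^ 2 / k + k / 4 - r = (r - k / 2) ^ 2 / k := by field_simp; ring
    have h2 : 0 ≤ (r - k / 2) ^ 2 / k := by positivity
    simp only [ψ]; linarith
  have hψpos : ∀ r, 0 < ψ r → r ∈ Icc κ k := by
    intro r hr
    simp only [ψ] at hr
    have h2 : 0 ≤ r ^ 2 / k := by positivity
    have hrκ : κ < r := by linarith
    refine ⟨hrκ.le, ?_⟩
    by_contra! hlt
    have : r ≤ r ^ 2 / k := by rw [le_div_iff₀ hk0]; nlinarith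
    linarith
  have hψint : Integrable (fun x => ψ (q x)) unitVol :=
    (hq1.sub (integrable_const κ)).sub (hq2.div_const k)
  have hψlow : κ / 2 ≤ ∫ x, ψ (q x) ∂unitVol := by
    have h1 : ∫ x, ψ (q x) ∂unitVol =
        ∫ x, q x ∂unitVol - κ - (∫ x, q x ^ 2 ∂unitVol) / k := by
      simp only [ψ]
      have h2 : Integrable (fun x => q x - κ) unitVol := hq1.sub (integrable_const κ)
      rw [integral_sub h2 (hq2.div_const k), integral_sub hq1 (integrable_const κ), integral_div]
      simp
    have h2 : (∫ x, q x ^ 2 ∂unitVol) / k ≤ R / k := by gcongr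
    have h3 : R / k = κ / 2 := by simp only [hk]; field_simp
    rw [h1]; linarith
  have hon : |c| * ∫ x in A, ψ (q x) ∂unitVol ≤ k / 4 * (∫ x in A, |σ (q x) - c| ∂unitVol + C) := by
    have h1 : ∫ x in A, |c| * ψ (q x) ∂unitVol ≤
        ∫ x in A, k / 4 * (|σ (q x) - c| + C) ∂unitVol := by
      refine setIntegral_mono_on (hψint.const_mul _).integrableOn
        ((hint.abs.add (integrable_const C)).const_mul _) hA ?_
      intro x _
      rcases le_or_gt (ψ (q x)) 0 with h | h
      · exact (mul_nonpos_of_nonneg_of_nonpos (abs_nonneg _) h).trans (by positivity)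
      · have h2 := hC _ (hψpos _ h)
        have h3 : |c| ≤ |σ (q x) - c| + C := by
          have : |c| = |σ (q x) - (σ (q x) - c)| := by congr 1; ring
          rw [this]
          refine (abs_sub _ _).trans ?_
          linarith
        calc |c| * ψ (q x) ≤ (|σ (q x) - c| + C) * (k / 4) :=
              mul_le_mul h3 (hψle _) h.le (by positivity)
          _ = _ := mul_comm _ _
    rw [integral_const_mul, integral_const_mul, integral_add hint.abs (integrable_const C)] at h1
    refine h1.trans ?_
    gcongr
    rw [integral_const]
    simp only [smul_eq_mul]
    refine mul_le_of_le_one_left hC0 ?_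
    rw [measureReal_restrict_apply_univ]
    exact measureReal_le_one
  have hoff : ∫ x in Aᶜ, ψ (q x) ∂unitVol ≤ κ / 4 := by
    have h1 : ∫ x in Aᶜ, ψ (q x) ∂unitVol ≤ ∫ x in Aᶜ, k / 4 ∂unitVol :=
      integral_mono hψint.integrableOn (integrable_const _) fun x => hψle _
    rw [integral_const, measureReal_restrict_apply_univ, smul_eq_mul] at h1
    have h2 : unitVol.real Aᶜ * (k / 4) ≤ κ / k * (k / 4) := by gcongr
    have h3 : κ / k * (k / 4) = κ / 4 := by field_simp
    linarith
  have hsplit := integral_add_compl hA hψint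
  have hAlow : κ / 4 ≤ ∫ x in A, ψ (q x) ∂unitVol := by linarith
  have h5 : |c| * (κ / 4) ≤ k / 4 * (∫ x in A, |σ (q x) - c| ∂unitVol + C) :=
    (mul_le_mul_of_nonneg_left hAlow (abs_nonneg c)).trans hon
  have hI : 0 ≤ ∫ x in A, |σ (q x) - c| ∂unitVol := integral_nonneg fun _ => abs_nonneg _
  have h6 : |c| = 4 / κ * (|c| * (κ / 4)) := by field_simp
  rw [h6]
  calc 4 / κ * (|c| * (κ / 4))
      ≤ 4 / κ * (k / 4 * (∫ x in A, |σ (q x) - c| ∂unitVol + C)) := by gcongr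
    _ = k / κ * (∫ x in A, |σ (q x) - c| ∂unitVol + C) := by field_simp
    _ ≤ k / κ * (C + 1) * (∫ x in A, |σ (q x) - c| ∂unitVol + 1) := by
        rw [mul_assoc]
        gcongr
        nlinarith

/-- The mean stress `∫₀¹ σ(p(y,t)) dy`. -/
noncomputable def meanStress (σ : ℝ → ℝ) (p : ℝ → ℝ → ℝ) (t : ℝ) : ℝ := ∫ y, σ (p y t) ∂unitVol

theorem excessStress_eq (σ : ℝ → ℝ) (p : ℝ → ℝ → ℝ) (x t : ℝ) :
    excessStress σ p x t = σ (p x t) - meanStress σ p t := rfl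

/-- A solution on a time interval `[a,b]` that need not start at time `0`: all requirements hold
up to both ends of the interval. -/
structure IsStrip (σ : ℝ → ℝ) (a b : ℝ) (p : ℝ → ℝ → ℝ) : Prop where
  aesm : AEStronglyMeasurable (fun z : ℝ × ℝ => p z.1 z.2)
    (unitVol.prod (volume.restrict (Ioc a b)))
  memLp : ∀ t ∈ Icc a b, MemLp (fun x => p x t) 2 unitVol
  bound : ∃ R, 0 < R ∧ ∀ t ∈ Icc a b, ∫ x, p x t ^ 2 ∂unitVol ≤ R
  pos : ∀ᵐ z ∂(unitVol.prod (volume.restrict (Ioc a b))), 0 < p z.1 z.2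
  stress : ∀ᵐ t ∂(volume.restrict (Ioc a b)), Integrable (fun x => σ (p x t)) unitVol
  excess : ∀ᵐ x ∂unitVol, IntervalIntegrable (fun t => excessStress σ p x t) volume a b
  equation : ∀ᵐ x ∂unitVol, ∀ t ∈ Icc a b, p x t = p x a - ∫ r in a..t, excessStress σ p x r

theorem IsSolutionOn.isStrip {σ : ℝ → ℝ} {p₀ : L2} {T : ℝ} {p : ℝ → ℝ → ℝ}
    (hp : IsSolutionOn σ p₀ T p) {a b : ℝ} (ha : 0 < a) (hab : a ≤ b) (hb : b ≤ T) :
    IsStrip σ a b p := by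
  have hsub : Icc a b ⊆ Icc 0 T := Icc_subset_Icc ha.le hb
  have hsub' : Ioc a b ⊆ Icc 0 T := Ioc_subset_Icc_self.trans hsub
  have hmeas : unitVol.prod (volume.restrict (Ioc a b)) ≤
      (volume : Measure (ℝ × ℝ)).restrict (Ioo (0 : ℝ) 1 ×ˢ Icc 0 T) := by
    rw [Measure.prod_restrict, ← Measure.volume_eq_prod]
    exact Measure.restrict_mono (prod_mono_right hsub') le_rfl
  obtain ⟨u, huc, -, hu⟩ := hp.continuous_L2
  refine ⟨hp.aestronglyMeasurable.mono_measure hmeas, ?_, ?_, ?_, ?_, ?_, ?_⟩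
  · intro t ht
    exact (Lp.memLp (u t)).ae_eq (hu t (hsub ht))
  · obtain ⟨R, hR⟩ := isCompact_Icc.exists_bound_of_continuousOn huc
    refine ⟨R ^ 2 + 1, by positivity, fun t ht => ?_⟩
    have h1 : ∫ x, p x t ^ 2 ∂unitVol = ‖u t‖ ^ 2 := by
      rw [norm_sq_eq_integral]
      refine integral_congr_ae ?_
      filter_upwards [hu t (hsub ht)] with x hx
      rw [hx]
    rw [h1]
    have := hR t (hsub ht)
    have h0 := norm_nonneg (u t)
    nlinarith
  · exact (Measure.absolutelyContinuous_of_le hmeas).ae_le hp.pos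
  · exact (Measure.absolutelyContinuous_of_le (Measure.restrict_mono hsub' le_rfl)).ae_le
      hp.integrable_stress
  · rcases hab.eq_or_lt with rfl | hlt
    · exact Eventually.of_forall fun x => IntervalIntegrable.refl
    filter_upwards [hp.integrable_excess] with x hx
    have h1 := hx a ⟨ha, hlt.trans_le hb⟩
    rw [← integrableOn_Ioc_iff_integrableOn_Ioo] at h1
    rw [intervalIntegrable_iff_integrableOn_Ioc_of_le hab]
    exact h1.mono_set (Ioc_subset_Ioc_right hb)
  · filter_upwards [hp.equation] with x hx t ht
    exact hx a ⟨ha, hab.trans hb⟩ t ⟨ha.trans_le ht.1, ht.2.trans hb⟩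

namespace IsStrip

variable {σ : ℝ → ℝ} {lam a b κ : ℝ} {p q : ℝ → ℝ → ℝ}

theorem aesm_stress (hσ : IsStress σ lam) (hp : IsStrip σ a b p) :
    AEStronglyMeasurable (fun z : ℝ × ℝ => σ (p z.1 z.2))
      (unitVol.prod (volume.restrict (Ioc a b))) :=
  aestronglyMeasurable_comp_of_continuousOn_Ioi hσ.continuousOn hp.aesm hp.pos

theorem aesm_meanStress (hσ : IsStress σ lam) (hp : IsStrip σ a b p) :
    AEStronglyMeasurable (meanStress σ p) (volume.restrict (Ioc a b)) :=
  (hp.aesm_stress hσ).prod_swap.integral_prod_right'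

theorem aesm_excess (hσ : IsStress σ lam) (hp : IsStrip σ a b p) :
    AEStronglyMeasurable (fun z : ℝ × ℝ => excessStress σ p z.1 z.2)
      (unitVol.prod (volume.restrict (Ioc a b))) :=
  (hp.aesm_stress hσ).sub (hp.aesm_meanStress hσ).comp_snd

theorem continuousOn (hp : IsStrip σ a b p) (hab : a ≤ b) :
    ∀ᵐ x ∂unitVol, ContinuousOn (fun t => p x t) (Icc a b) := by
  filter_upwards [hp.equation, hp.excess] with x h1 h2
  refine ContinuousOn.congr (f := fun t => p x a - ∫ r in a..t, excessStress σ p x r) ?_ h1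
  refine continuousOn_const.sub ?_
  have := intervalIntegral.continuousOn_primitive_interval (μ := volume) (a := a) (b := b)
    (f := fun r => excessStress σ p x r) (by
      rw [uIcc_of_le hab, integrableOn_Icc_iff_integrableOn_Ioc]
      exact (intervalIntegrable_iff_integrableOn_Ioc_of_le hab).1 h2)
  rwa [uIcc_of_le hab] at this

/-- As long as the mean of `p` stays away from `0`, the mean stress is integrable in time. -/
theorem integrable_meanStress (hσ : IsStress σ lam) (hp : IsStrip σ a b p) (hab : a ≤ b)
    (hκ : 0 < κ) (hmean : ∀ t ∈ Icc a b, 2 * κ ≤ ∫ x, p x t ∂unitVol) :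
    Integrable (meanStress σ p) (volume.restrict (Ioc a b)) := by
  obtain ⟨R, hR0, hR⟩ := hp.bound
  obtain ⟨K, ε, hK0, hε, hK⟩ := hσ.exists_abs_le_excess hκ hR0
  set ν := (volume : Measure ℝ).restrict (Ioc a b) with hν
  have hem := hp.aesm_excess hσ
  -- `G x` is the time integral of the excess stress, which is finite for almost every `x`.
  set G : ℝ → ℝ≥0∞ := fun x => ∫⁻ t, ‖excessStress σ p x t‖ₑ ∂ν with hG
  have hGm : AEMeasurable G unitVol := hem.enorm.lintegral_prod_right'
  set G' := hGm.mk G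
  have hGfin : ∀ᵐ x ∂unitVol, G x < ⊤ := by
    filter_upwards [hp.excess] with x hx
    exact ((intervalIntegrable_iff_integrableOn_Ioc_of_le hab).1 hx).2
  have hG'fin : ∀ᵐ x ∂unitVol, G' x < ⊤ := by
    filter_upwards [hGfin, hGm.ae_eq_mk] with x h1 h2
    exact h2.symm.trans_lt h1
  obtain ⟨N, hN⟩ : ∃ N : ℕ, unitVol.real {x | G' x ≤ N}ᶜ ≤ ε := by
    have h1 : Tendsto (fun N : ℕ => unitVol {x | G' x ≤ N}ᶜ) atTop
        (𝓝 (unitVol (⋂ N : ℕ, {x | G' x ≤ N}ᶜ))) := by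
      refine tendsto_measure_iInter_atTop (fun N => ?_) ?_ ⟨0, measure_ne_top _ _⟩
      · exact (measurableSet_le hGm.measurable_mk measurable_const).compl.nullMeasurableSet
      · intro N M hNM x hx hx'
        refine hx (le_trans (show G' x ≤ N from hx') ?_)
        exact_mod_cast hNM
    have h2 : unitVol (⋂ N : ℕ, {x | G' x ≤ N}ᶜ) = 0 := by
      refine measure_mono_null ?_ (ae_iff.1 hG'fin)
      intro x hx hlt
      obtain ⟨N, hN⟩ := ENNReal.exists_nat_gt hlt.ne
      exact (mem_iInter.1 hx N) hN.le
    rw [h2] at h1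
    have h3 := (ENNReal.tendsto_toReal ENNReal.zero_ne_top).comp h1
    simp only [ENNReal.toReal_zero] at h3
    obtain ⟨N, hN⟩ := (h3.eventually (ge_mem_nhds hε)).exists
    exact ⟨N, hN⟩
  set A := {x | G' x ≤ N} with hA
  have hAm : MeasurableSet A := measurableSet_le hGm.measurable_mk measurable_const
  have hpt : ∀ᵐ t ∂ν, ‖meanStress σ p t‖ₑ ≤
      ENNReal.ofReal K * (∫⁻ x in A, ‖excessStress σ p x t‖ₑ ∂unitVol + 1) := by
    filter_upwards [hp.stress, ae_restrict_mem measurableSet_Ioc] with t h1 h2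
    have hmem := Ioc_subset_Icc_self h2
    have hint : Integrable (fun x => excessStress σ p x t) unitVol := h1.sub (integrable_const _)
    have h3 := hK (fun x => p x t) (meanStress σ p t) A (hp.memLp t hmem) (hmean t hmem)
      (hR t hmem) hAm hN hint.integrableOn
    rw [← ofReal_norm, Real.norm_eq_abs]
    refine (ENNReal.ofReal_le_ofReal h3).trans ?_
    rw [ENNReal.ofReal_mul hK0, ENNReal.ofReal_add (integral_nonneg fun _ => abs_nonneg _)
      zero_le_one, ENNReal.ofReal_one]
    gcongr
    have h4 := ofReal_integral_norm_eq_lintegral_enorm (hint.integrableOn (s := A))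
    exact h4.le
  refine ⟨hp.aesm_meanStress hσ, ?_⟩
  refine lt_of_le_of_lt (lintegral_mono_ae hpt) ?_
  have hem' : AEMeasurable (fun z : ℝ × ℝ => ‖excessStress σ p z.1 z.2‖ₑ)
      ((unitVol.restrict A).prod ν) :=
    hem.enorm.mono_measure (Measure.prod_mono Measure.restrict_le_self le_rfl)
  rw [lintegral_const_mul'' _ (by
    exact (hem'.prod_swap.lintegral_prod_right').add_const 1)]
  refine ENNReal.mul_lt_top ENNReal.ofReal_lt_top ?_
  rw [lintegral_add_right _ measurable_const]
  refine ENNReal.add_lt_top.2 ⟨?_, ?_⟩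
  · rw [lintegral_lintegral_swap (by exact hem'.prod_swap)]
    have h5 : ∫⁻ x in A, G x ∂unitVol ≤ ∫⁻ x in A, (N : ℝ≥0∞) ∂unitVol := by
      refine lintegral_mono_ae ?_
      filter_upwards [ae_restrict_of_ae hGm.ae_eq_mk, ae_restrict_mem hAm] with x h6 h7
      rw [h6]; exact h7
    refine lt_of_le_of_lt h5 ?_
    rw [lintegral_const]
    exact ENNReal.mul_lt_top (ENNReal.natCast_lt_top N) (measure_lt_top _ _)
  · rw [lintegral_const, one_mul]
    exact measure_lt_top _ _

end IsStrip

/-! ### Testing the equation: integrability of the stress, mean value, contraction -/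

namespace IsStrip

variable {σ : ℝ → ℝ} {lam a b κ : ℝ} {p q : ℝ → ℝ → ℝ}

/-- The `L¹(0,1)` norm is bounded by the bound on the `L²(0,1)` norm. -/
theorem integral_abs_le {R : ℝ} {f : ℝ → ℝ} (hf : MemLp f 2 unitVol)
    (hR : ∫ x, f x ^ 2 ∂unitVol ≤ R) : ∫ x, |f x| ∂unitVol ≤ R + 1 := by
  have h1 : Integrable f unitVol := hf.integrable (by norm_num)
  calc ∫ x, |f x| ∂unitVol ≤ ∫ x, (f x ^ 2 + 1) ∂unitVol := by
        refine integral_mono h1.abs (hf.integrable_sq.add (integrable_const 1)) fun x => ?_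
        have := sq_nonneg (|f x| - 1)
        have h2 := sq_abs (f x)
        simp only
        nlinarith [abs_nonneg (f x)]
    _ = ∫ x, f x ^ 2 ∂unitVol + 1 := by
        rw [integral_add hf.integrable_sq (integrable_const 1)]; simp
    _ ≤ R + 1 := by linarith

theorem integrable_sq_sub {w : ℝ × ℝ → ℝ} {ν : Measure ℝ} [IsFiniteMeasure ν]
    (hw : AEStronglyMeasurable w (unitVol.prod ν)) {R : ℝ}
    (h : ∀ᵐ t ∂ν, MemLp (fun x => w (x, t)) 2 unitVol ∧ ∫ x, w (x, t) ^ 2 ∂unitVol ≤ R) :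
    Integrable (fun z => w z ^ 2) (unitVol.prod ν) := by
  refine integrable_prod_of_integral_norm_le (hw.pow 2) (integrable_const R) ?_
  filter_upwards [h] with t ht
  refine ⟨ht.1.integrable_sq, ?_⟩
  simpa using ht.2

theorem integrable_mul_snd {w : ℝ × ℝ → ℝ} {ν : Measure ℝ} [IsFiniteMeasure ν]
    (hw : AEStronglyMeasurable w (unitVol.prod ν)) {R : ℝ}
    (h : ∀ᵐ t ∂ν, MemLp (fun x => w (x, t)) 2 unitVol ∧ ∫ x, w (x, t) ^ 2 ∂unitVol ≤ R)
    {c : ℝ → ℝ} (hc : Integrable c ν) :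
    Integrable (fun z : ℝ × ℝ => w z * c z.2) (unitVol.prod ν) := by
  refine integrable_prod_of_integral_norm_le (hw.mul hc.1.comp_snd)
    (hc.abs.const_mul (R + 1)) ?_
  filter_upwards [h] with t ht
  refine ⟨(ht.1.integrable (by norm_num)).mul_const _, ?_⟩
  simp only [norm_mul, Real.norm_eq_abs]
  rw [integral_mul_const]
  exact mul_le_mul_of_nonneg_right (integral_abs_le ht.1 ht.2) (abs_nonneg _)

theorem sub_sq_bound (hp : IsStrip σ a b p) (hq : IsStrip σ a b q) :
    ∃ R, ∀ t ∈ Icc a b, MemLp (fun x => p x t - q x t) 2 unitVol ∧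
      ∫ x, (p x t - q x t) ^ 2 ∂unitVol ≤ R := by
  obtain ⟨R, -, hR⟩ := hp.bound
  obtain ⟨R', -, hR'⟩ := hq.bound
  refine ⟨2 * (R + R'), fun t ht => ⟨(hp.memLp t ht).sub (hq.memLp t ht), ?_⟩⟩
  have h1 := (hp.memLp t ht).integrable_sq
  have h2 := (hq.memLp t ht).integrable_sq
  calc ∫ x, (p x t - q x t) ^ 2 ∂unitVol
      ≤ ∫ x, 2 * (p x t ^ 2 + q x t ^ 2) ∂unitVol := by
        refine integral_mono ((hp.memLp t ht).sub (hq.memLp t ht)).integrable_sq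
          ((h1.add h2).const_mul 2) fun x => ?_
        have := sq_nonneg (p x t + q x t)
        simp only
        nlinarith
    _ = 2 * (∫ x, p x t ^ 2 ∂unitVol + ∫ x, q x t ^ 2 ∂unitVol) := by
        rw [integral_const_mul, integral_add h1 h2]
    _ ≤ _ := by gcongr <;> [exact hR t ht; exact hR' t ht]

/-- The constant solution, with which an arbitrary one is compared. -/
theorem const_one : IsStrip σ a b (fun _ _ => 1) := by
  have he : ∀ x t, excessStress σ (fun _ _ => 1) x t = 0 := fun x t => by simp [excessStress]
  refine ⟨aestronglyMeasurable_const, fun _ _ => memLp_const 1, ⟨1, one_pos, fun t _ => by simp⟩,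
    Eventually.of_forall fun _ => one_pos, Eventually.of_forall fun _ => integrable_const _,
    Eventually.of_forall fun x => ?_, Eventually.of_forall fun x t _ => ?_⟩
  · simp only [he]; exact _root_.intervalIntegrable_const
  · simp [he]

/-- The square of the difference of two solutions, for almost every `x`. -/
theorem ae_sq_sub_eq (hp : IsStrip σ a b p) (hq : IsStrip σ a b q) (hab : a ≤ b) :
    ∀ᵐ x ∂unitVol,
      IntervalIntegrable (fun r => (p x r - q x r) *
        (excessStress σ p x r - excessStress σ q x r)) volume a b ∧
      (p x b - q x b) ^ 2 - (p x a - q x a) ^ 2 =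
        -(2 * ∫ r in a..b, (p x r - q x r) * (excessStress σ p x r - excessStress σ q x r)) := by
  filter_upwards [hp.excess, hq.excess, hp.equation, hq.equation, hp.continuousOn hab,
    hq.continuousOn hab] with x h1 h2 h3 h4 h5 h6
  have hi := h1.sub h2
  refine ⟨?_, ?_⟩
  · exact hi.continuousOn_mul (by rw [uIcc_of_le hab]; exact h5.sub h6)
  have := sq_sub_sq_eq_integral (w := fun r => p x r - q x r)
    (h := fun r => -(excessStress σ p x r - excessStress σ q x r)) hab hi.neg (by
      intro t ht
      have hsub : uIcc a t ⊆ uIcc a b := by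
        rw [uIcc_of_le hab, uIcc_of_le ht.1]; exact Icc_subset_Icc_right ht.2
      rw [intervalIntegral.integral_neg, intervalIntegral.integral_sub (h1.mono_set hsub)
        (h2.mono_set hsub)]
      rw [h3 t ht, h4 t ht]; ring)
  simp only [mul_neg, intervalIntegral.integral_neg] at this
  exact this

/-- The stress is integrable in space and time. Testing the equation with `p - 1` bounds the
space-time integral of the nonnegative function `(σ(p) - σ(1)) (p - 1) + lam (p - 1)²`. -/
theorem integrable_stress (hσ : IsStress σ lam) (hp : IsStrip σ a b p) (hab : a ≤ b)
    (hc : Integrable (meanStress σ p) (volume.restrict (Ioc a b))) :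
    Integrable (fun z : ℝ × ℝ => σ (p z.1 z.2)) (unitVol.prod (volume.restrict (Ioc a b))) := by
  set ν := (volume : Measure ℝ).restrict (Ioc a b) with hν
  have h1 := const_one (σ := σ) (a := a) (b := b)
  obtain ⟨R, hR⟩ := sub_sq_bound hp h1
  have hRν : ∀ᵐ t ∂ν, MemLp (fun x => p x t - 1) 2 unitVol ∧
      ∫ x, (p x t - 1) ^ 2 ∂unitVol ≤ R := by
    filter_upwards [ae_restrict_mem measurableSet_Ioc] with t ht
    exact hR t (Ioc_subset_Icc_self ht)
  have hwm : AEStronglyMeasurable (fun z : ℝ × ℝ => p z.1 z.2 - 1) (unitVol.prod ν) :=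
    hp.aesm.sub aestronglyMeasurable_const
  have hw2 := integrable_sq_sub hwm hRν
  have hwc := integrable_mul_snd hwm hRν (hc.sub (integrable_const (σ 1)))
  set F : ℝ × ℝ → ℝ := fun z =>
    (σ (p z.1 z.2) - σ 1) * (p z.1 z.2 - 1) + lam * (p z.1 z.2 - 1) ^ 2 with hF
  have hFm : AEStronglyMeasurable F (unitVol.prod ν) :=
    (((hp.aesm_stress hσ).sub aestronglyMeasurable_const).mul hwm).add
      ((hwm.pow 2).const_mul lam)
  have hF0 : ∀ᵐ z ∂unitVol.prod ν, 0 ≤ F z := by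
    filter_upwards [hp.pos] with z hz
    have := hσ.neg_le_sub_mul_sub hz one_pos
    simp only [hF]; linarith
  have hFint : Integrable F (unitVol.prod ν) := by
    rw [integrable_prod_iff hFm]
    have key : ∀ᵐ x ∂unitVol, Integrable (fun t => F (x, t)) ν ∧ ∫ t, ‖F (x, t)‖ ∂ν ≤
        (p x a - 1) ^ 2 + ∫ t, ((p x t - 1) * (meanStress σ p t - σ 1)) ∂ν +
          lam * ∫ t, (p x t - 1) ^ 2 ∂ν := by
      filter_upwards [ae_sq_sub_eq hp h1 hab, hw2.prod_right_ae, hwc.prod_right_ae,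
        Measure.ae_ae_of_ae_prod hF0] with x h2 h3 h4 h5
      have he : ∀ r, excessStress σ (fun _ _ => 1) x r = 0 := fun r => by simp [excessStress]
      simp only [he, sub_zero] at h2
      obtain ⟨h6, h7⟩ := h2
      rw [intervalIntegrable_iff_integrableOn_Ioc_of_le hab] at h6
      rw [intervalIntegral.integral_of_le hab] at h7
      have h6' : Integrable (fun t => (p x t - 1) * excessStress σ p x t) ν := h6
      have hFe : (fun t => F (x, t)) = fun t => (p x t - 1) * excessStress σ p x t +
          (p x t - 1) * (meanStress σ p t - σ 1) + lam * (p x t - 1) ^ 2 := by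
        funext t
        simp only [hF, excessStress_eq]; ring
      have h4' : Integrable (fun t => (p x t - 1) * (meanStress σ p t - σ 1)) ν := h4
      have h3' : Integrable (fun t => lam * (p x t - 1) ^ 2) ν := h3.const_mul lam
      have h64 : Integrable (fun t => (p x t - 1) * excessStress σ p x t +
          (p x t - 1) * (meanStress σ p t - σ 1)) ν := h6'.add h4'
      refine ⟨by rw [hFe]; exact h64.add h3', ?_⟩
      have h8 : ∫ t, ‖F (x, t)‖ ∂ν = ∫ t, F (x, t) ∂ν := by
        refine integral_congr_ae ?_
        filter_upwards [h5] with t ht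
        exact Real.norm_of_nonneg ht
      rw [h8, hFe, integral_add h64 h3', integral_add h6' h4', integral_const_mul]
      have h9 : ∫ t, (p x t - 1) * excessStress σ p x t ∂ν ≤ (p x a - 1) ^ 2 := by
        have := sq_nonneg (p x b - 1)
        have := sq_nonneg (p x a - 1)
        rw [← hν] at h7
        linarith
      linarith
    refine ⟨key.mono fun x hx => hx.1, ?_⟩
    refine Integrable.mono' (g := fun x => (p x a - 1) ^ 2 +
      ∫ t, ((p x t - 1) * (meanStress σ p t - σ 1)) ∂ν + lam * ∫ t, (p x t - 1) ^ 2 ∂ν) ?_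
      hFm.norm.integral_prod_right' ?_
    · exact ((hR a (left_mem_Icc.2 hab)).1.integrable_sq.add hwc.integral_prod_left).add
        (hw2.integral_prod_left.const_mul lam)
    · filter_upwards [key] with x hx
      rw [Real.norm_of_nonneg (integral_nonneg fun _ => norm_nonneg _)]
      exact hx.2
  obtain ⟨C, hC0, hC⟩ := hσ.exists_abs_le (a := 1 / 2) (by norm_num) 2
  refine Integrable.mono' (g := fun z => C + |σ 1| + 2 * F z + 2 * lam * (p z.1 z.2 - 1) ^ 2)
    (((integrable_const (C + |σ 1|)).add (hFint.const_mul 2)).add (hw2.const_mul (2 * lam)))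
    (hp.aesm_stress hσ) ?_
  filter_upwards [hp.pos, hF0] with z hz h0
  have hlam := hσ.lam_nonneg
  rw [Real.norm_eq_abs]
  by_cases hmem : p z.1 z.2 ∈ Icc (1 / 2) 2
  · have := hC _ hmem
    have := abs_nonneg (σ 1)
    have : 0 ≤ 2 * lam * (p z.1 z.2 - 1) ^ 2 := by positivity
    linarith
  · have h2 : 1 / 2 ≤ |p z.1 z.2 - 1| := by
      rw [le_abs]
      by_contra! hcon
      exact hmem ⟨by linarith, by linarith⟩
    have h3 : |σ (p z.1 z.2)| ≤ |σ (p z.1 z.2) - σ 1| + |σ 1| := by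
      have := abs_add_le (σ (p z.1 z.2) - σ 1) (σ 1)
      simpa using this
    have h4 : |σ (p z.1 z.2) - σ 1| * |p z.1 z.2 - 1| ≤ F z + lam * (p z.1 z.2 - 1) ^ 2 := by
      rw [← abs_mul]
      have : (σ (p z.1 z.2) - σ 1) * (p z.1 z.2 - 1) = F z - lam * (p z.1 z.2 - 1) ^ 2 := by
        simp only [hF]; ring
      rw [this]
      refine (abs_sub _ _).trans ?_
      rw [abs_of_nonneg h0, abs_of_nonneg (by positivity)]
    have h5 := abs_nonneg (σ (p z.1 z.2) - σ 1)
    nlinarith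

/-- The mean does not change as long as it stays away from `0`. -/
theorem integral_eq (hσ : IsStress σ lam) (hp : IsStrip σ a b p) (hab : a ≤ b) (hκ : 0 < κ)
    (hmean : ∀ t ∈ Icc a b, 2 * κ ≤ ∫ x, p x t ∂unitVol) :
    ∫ x, p x b ∂unitVol = ∫ x, p x a ∂unitVol := by
  have hc := hp.integrable_meanStress hσ hab hκ hmean
  have hs := hp.integrable_stress hσ hab hc
  have hex : Integrable (fun z : ℝ × ℝ => excessStress σ p z.1 z.2)
      (unitVol.prod (volume.restrict (Ioc a b))) := hs.sub (hc.comp_snd _)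
  have h1 : ∫ x, p x b ∂unitVol =
      ∫ x, (p x a - ∫ r in Ioc a b, excessStress σ p x r) ∂unitVol := by
    refine integral_congr_ae ?_
    filter_upwards [hp.equation] with x hx
    rw [hx b (right_mem_Icc.2 hab), intervalIntegral.integral_of_le hab]
  rw [h1, integral_sub ((hp.memLp a (left_mem_Icc.2 hab)).integrable (by norm_num))
    hex.integral_prod_left]
  have h2 : ∫ x, (∫ r in Ioc a b, excessStress σ p x r) ∂unitVol = 0 := by
    rw [integral_integral_swap hex]
    refine integral_eq_zero_of_ae ?_
    filter_upwards [hp.stress] with t ht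
    simp only [excessStress_eq]
    rw [integral_sub ht (integrable_const _)]
    simp [meanStress]
  simp only at h2 ⊢
  rw [h2, sub_zero]

/-- The integrated form of `d/dt ‖p - q‖² ≤ 2 lam ‖p - q‖²`. -/
theorem integral_sq_sub_le (hσ : IsStress σ lam) (hp : IsStrip σ a b p) (hq : IsStrip σ a b q)
    (hab : a ≤ b) (hcp : Integrable (meanStress σ p) (volume.restrict (Ioc a b)))
    (hcq : Integrable (meanStress σ q) (volume.restrict (Ioc a b)))
    (hmean : ∀ t ∈ Icc a b, ∫ x, p x t ∂unitVol = ∫ x, q x t ∂unitVol) :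
    ∫ x, (p x b - q x b) ^ 2 ∂unitVol ≤ ∫ x, (p x a - q x a) ^ 2 ∂unitVol +
      2 * lam * ∫ t in a..b, ∫ x, (p x t - q x t) ^ 2 ∂unitVol := by
  set ν := (volume : Measure ℝ).restrict (Ioc a b) with hν
  obtain ⟨R, hR⟩ := sub_sq_bound hp hq
  have hRν : ∀ᵐ t ∂ν, MemLp (fun x => p x t - q x t) 2 unitVol ∧
      ∫ x, (p x t - q x t) ^ 2 ∂unitVol ≤ R := by
    filter_upwards [ae_restrict_mem measurableSet_Ioc] with t ht
    exact hR t (Ioc_subset_Icc_self ht)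
  have hwm : AEStronglyMeasurable (fun z : ℝ × ℝ => p z.1 z.2 - q z.1 z.2) (unitVol.prod ν) :=
    hp.aesm.sub hq.aesm
  have hw2 := integrable_sq_sub hwm hRν
  have hwc := integrable_mul_snd hwm hRν (hcp.sub hcq)
  have key : ∀ᵐ x ∂unitVol, (p x b - q x b) ^ 2 ≤ (p x a - q x a) ^ 2 +
      2 * lam * ∫ t, (p x t - q x t) ^ 2 ∂ν +
      2 * ∫ t, (p x t - q x t) * (meanStress σ p t - meanStress σ q t) ∂ν := by
    filter_upwards [ae_sq_sub_eq hp hq hab, hw2.prod_right_ae, hwc.prod_right_ae,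
      Measure.ae_ae_of_ae_prod hp.pos, Measure.ae_ae_of_ae_prod hq.pos] with x h1 h2 h3 h4 h5
    obtain ⟨h6, h7⟩ := h1
    rw [intervalIntegrable_iff_integrableOn_Ioc_of_le hab] at h6
    rw [intervalIntegral.integral_of_le hab] at h7
    have h2' : Integrable (fun t => -lam * (p x t - q x t) ^ 2) ν := h2.const_mul (-lam)
    have h3' : Integrable (fun t => (p x t - q x t) * (meanStress σ p t - meanStress σ q t)) ν := h3
    have h8 : ∫ t, (-lam * (p x t - q x t) ^ 2 -
        (p x t - q x t) * (meanStress σ p t - meanStress σ q t)) ∂ν ≤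
        ∫ t, (p x t - q x t) * (excessStress σ p x t - excessStress σ q x t) ∂ν := by
      refine integral_mono_ae (h2'.sub h3') h6 ?_
      filter_upwards [h4, h5] with t h9 h10
      have := hσ.neg_le_sub_mul_sub h9 h10
      simp only [excessStress_eq]
      linarith
    rw [integral_sub h2' h3', integral_const_mul] at h8
    linarith
  have hI2 : ∫ x, ∫ t, (p x t - q x t) ^ 2 ∂ν ∂unitVol =
      ∫ t in a..b, ∫ x, (p x t - q x t) ^ 2 ∂unitVol := by
    rw [intervalIntegral.integral_of_le hab]
    exact integral_integral_swap hw2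
  have hI3 : ∫ x, ∫ t, (p x t - q x t) * (meanStress σ p t - meanStress σ q t) ∂ν ∂unitVol = 0 := by
    rw [integral_integral_swap hwc]
    refine integral_eq_zero_of_ae ?_
    filter_upwards [ae_restrict_mem measurableSet_Ioc] with t ht
    have ht' := Ioc_subset_Icc_self ht
    rw [integral_mul_const, integral_sub ((hp.memLp t ht').integrable (by norm_num))
      ((hq.memLp t ht').integrable (by norm_num)), hmean t ht', sub_self, zero_mul]
    rfl
  have ha := (hR a (left_mem_Icc.2 hab)).1.integrable_sq
  have hb := (hR b (right_mem_Icc.2 hab)).1.integrable_sq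
  have hJ2 : Integrable (fun x => 2 * lam * ∫ t, (p x t - q x t) ^ 2 ∂ν) unitVol :=
    hw2.integral_prod_left.const_mul _
  have hJ3 : Integrable (fun x => 2 * ∫ t, (p x t - q x t) *
      (meanStress σ p t - meanStress σ q t) ∂ν) unitVol := hwc.integral_prod_left.const_mul _
  have hJ : Integrable (fun x => (p x a - q x a) ^ 2 +
      2 * lam * ∫ t, (p x t - q x t) ^ 2 ∂ν) unitVol := ha.add hJ2
  have := integral_mono_ae hb (hJ.add hJ3) key
  simp only [Pi.add_apply] at this
  rw [integral_add hJ hJ3, integral_add ha hJ2, integral_const_mul, integral_const_mul, hI2,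
    hI3] at this
  linarith

end IsStrip

/-! ### Conservation of the mean and uniqueness -/

theorem continuous_integral_L2 : Continuous (fun f : L2 => ∫ x, f x ∂unitVol) := by
  have h : (fun f : L2 => ∫ x, f x ∂unitVol) = fun f : L2 =>
      inner ℝ (indicatorConstLp 2 MeasurableSet.univ (measure_ne_top unitVol univ) (1 : ℝ)) f := by
    funext f
    rw [L2.inner_indicatorConstLp_one]
    simp
  rw [h]
  exact continuous_const.inner continuous_id

namespace IsSolutionOn

variable {σ : ℝ → ℝ} {lam μ T : ℝ} {p₀ q₀ : L2} {p q : ℝ → ℝ → ℝ}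

theorem integral_eq_of_L2 {u : ℝ → L2} {t : ℝ} (hu : ∀ᵐ x ∂unitVol, u t x = p x t) :
    ∫ x, p x t ∂unitVol = ∫ x, u t x ∂unitVol := by
  refine integral_congr_ae ?_
  filter_upwards [hu] with x hx
  exact hx.symm

/-- The mean of a solution is conserved. By continuity it stays above `μ / 2` up to some first
time, and up to that time it is constant. -/
theorem integral_eq (hσ : IsStress σ lam) (hμ : 0 < μ) (hp₀ : ∫ x, p₀ x ∂unitVol = μ)
    (hp : IsSolutionOn σ p₀ T p) : ∀ t ∈ Icc 0 T, ∫ x, p x t ∂unitVol = μ := by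
  obtain ⟨u, huc, hu0, hu⟩ := hp.continuous_L2
  set m : ℝ → ℝ := fun t => ∫ x, u t x ∂unitVol with hm
  have hpm : ∀ t ∈ Icc 0 T, ∫ x, p x t ∂unitVol = m t := fun t ht => integral_eq_of_L2 (hu t ht)
  have hmc : ContinuousOn m (Icc 0 T) := continuous_integral_L2.comp_continuousOn huc
  have hm0 : m 0 = μ := by simp only [hm, hu0]; exact hp₀
  have hconst : ∀ t ∈ Icc 0 T, (∀ s ∈ Icc 0 t, μ / 2 ≤ m s) → m t = μ := by
    intro t ht hlow
    rcases ht.1.eq_or_lt with rfl | ht0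
    · exact hm0
    have hlim : Tendsto m (𝓝[>] 0) (𝓝 μ) := by
      have h1 := (hmc 0 ⟨le_rfl, ht.1.trans ht.2⟩).mono_left
        (nhdsWithin_le_of_mem (s := Ioo 0 T) (mem_of_superset
          (Ioo_mem_nhdsGT (ht0.trans_le ht.2)) fun _ h => h) |>.trans
          (nhdsWithin_mono 0 Ioo_subset_Icc_self))
      rwa [hm0] at h1
    refine tendsto_nhds_unique (tendsto_const_nhds.congr' ?_) hlim
    filter_upwards [Ioo_mem_nhdsGT ht0] with s hs
    have h2 := (hp.isStrip hs.1 hs.2.le ht.2).integral_eq hσ hs.2.le (κ := μ / 4) (by positivity)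
      (fun r hr => by
        rw [hpm r ⟨hs.1.le.trans hr.1, hr.2.trans ht.2⟩]
        linarith [hlow r ⟨hs.1.le.trans hr.1, hr.2⟩])
    rwa [hpm t ht, hpm s ⟨hs.1.le, hs.2.le.trans ht.2⟩] at h2
  have hivt : ∀ t ∈ Icc 0 T, m t < μ / 2 → ∃ r ∈ Icc 0 t, m r = μ / 2 := by
    intro t ht hlt
    have := intermediate_value_Icc' ht.1 (hmc.mono (Icc_subset_Icc_right ht.2))
    exact this ⟨hlt.le, by rw [hm0]; linarith⟩
  have hlow : ∀ t ∈ Icc 0 T, μ / 2 ≤ m t := by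
    intro t ht
    by_contra! hlt
    obtain ⟨r, hr, hrm⟩ := hivt t ht hlt
    set Z := Icc 0 t ∩ m ⁻¹' {μ / 2} with hZ
    have hZc : IsCompact Z := isCompact_Icc.of_isClosed_subset
      ((hmc.mono (Icc_subset_Icc_right ht.2)).preimage_isClosed_of_isClosed isClosed_Icc
        isClosed_singleton) inter_subset_left
    obtain ⟨s, ⟨hsm, hsv⟩, hmin⟩ := hZc.exists_isLeast ⟨r, hr, hrm⟩
    have h1 := hconst s ⟨hsm.1, hsm.2.trans ht.2⟩ fun s' hs' => by
      by_contra! hlt'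
      obtain ⟨r', hr', hrm'⟩ := hivt s' ⟨hs'.1, (hs'.2.trans hsm.2).trans ht.2⟩ hlt'
      have h3 : s ≤ r' := hmin ⟨⟨hr'.1, (hr'.2.trans hs'.2).trans hsm.2⟩, hrm'⟩
      have h4 : r' = s' := le_antisymm hr'.2 (hs'.2.trans h3)
      rw [h4] at hrm'
      exact absurd hrm' hlt'.ne
    rw [mem_preimage, mem_singleton_iff] at hsv
    linarith
  intro t ht
  rw [hpm t ht]
  exact hconst t ht fun s hs => hlow s ⟨hs.1, hs.2.trans ht.2⟩

theorem integrable_meanStress (hσ : IsStress σ lam) (hμ : 0 < μ) (hp₀ : ∫ x, p₀ x ∂unitVol = μ)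
    (hp : IsSolutionOn σ p₀ T p) {a b : ℝ} (ha : 0 < a) (hab : a ≤ b) (hb : b ≤ T) :
    Integrable (meanStress σ p) (volume.restrict (Ioc a b)) :=
  (hp.isStrip ha hab hb).integrable_meanStress hσ hab (κ := μ / 2) (by positivity) fun t ht => by
    rw [hp.integral_eq hσ hμ hp₀ t ⟨ha.le.trans ht.1, ht.2.trans hb⟩]
    linarith

/-- Two solutions with the same mean approach each other, up to an exponential factor. -/
theorem integral_sq_sub_le (hσ : IsStress σ lam) (hμ : 0 < μ) (hp₀ : ∫ x, p₀ x ∂unitVol = μ)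
    (hq₀ : ∫ x, q₀ x ∂unitVol = μ) (hp : IsSolutionOn σ p₀ T p) (hq : IsSolutionOn σ q₀ T q)
    {s t : ℝ} (hs : 0 ≤ s) (hst : s ≤ t) (ht : t ≤ T) :
    ∫ x, (p x t - q x t) ^ 2 ∂unitVol ≤
      Real.exp (2 * lam * (t - s)) * ∫ x, (p x s - q x s) ^ 2 ∂unitVol := by
  have hlam := hσ.lam_nonneg
  obtain ⟨u, huc, -, hu⟩ := hp.continuous_L2
  obtain ⟨v, hvc, -, hv⟩ := hq.continuous_L2
  set φ : ℝ → ℝ := fun t => ∫ x, (p x t - q x t) ^ 2 ∂unitVol with hφ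
  have hφc : ContinuousOn φ (Icc 0 T) := by
    refine ((huc.sub hvc).norm.pow 2).congr fun t ht => ?_
    exact (norm_sq_sub_eq_integral (hu t ht) (hv t ht)).symm
  have hpos : ∀ s t, 0 < s → s ≤ t → t ≤ T →
      φ t ≤ Real.exp (2 * lam * (t - s)) * φ s := by
    intro s t hs hst ht
    have hsT : s ≤ T := hst.trans ht
    have hc' : ContinuousOn φ (Icc s T) := hφc.mono (Icc_subset_Icc_left hs.le)
    -- `f` extends `φ` continuously, so that its primitive is differentiable up to the end points.
    set f : ℝ → ℝ := IccExtend hsT ((Icc s T).domRestrict φ) with hf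
    have hfc : Continuous f := (continuousOn_iff_continuous_domRestrict.1 hc').Icc_extend'
    have hfφ : ∀ r ∈ Icc s T, f r = φ r := fun r hr => by
      simp only [hf]; rw [IccExtend_of_mem _ _ hr]; rfl
    have hineq : ∀ r ∈ Icc s T, φ r ≤ φ s + 2 * lam * ∫ t in s..r, f t := by
      intro r hr
      have h1 := (hp.isStrip hs hr.1 hr.2).integral_sq_sub_le hσ (hq.isStrip hs hr.1 hr.2) hr.1
        (hp.integrable_meanStress hσ hμ hp₀ hs hr.1 hr.2)
        (hq.integrable_meanStress hσ hμ hq₀ hs hr.1 hr.2) (fun t ht => by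
          rw [hp.integral_eq hσ hμ hp₀ t ⟨hs.le.trans ht.1, ht.2.trans hr.2⟩,
            hq.integral_eq hσ hμ hq₀ t ⟨hs.le.trans ht.1, ht.2.trans hr.2⟩])
      have h2 : ∫ t in s..r, f t = ∫ t in s..r, φ t := by
        refine intervalIntegral.integral_congr fun t ht => ?_
        rw [uIcc_of_le hr.1] at ht
        exact hfφ t ⟨ht.1, ht.2.trans hr.2⟩
      rw [h2]; exact h1
    have h3 := le_exp_mul_of_deriv_le (Q := fun r => φ s + 2 * lam * ∫ t in s..r, f t)
      (Q' := fun r => 2 * lam * f r) (k := 2 * lam) (a := s) (b := T) (fun r _ =>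
        (((hfc.integral_hasStrictDerivAt s r).hasDerivAt.const_mul _).const_add _).hasDerivWithinAt)
      (fun r hr => by
        rw [hfφ r hr]
        exact mul_le_mul_of_nonneg_left (hineq r hr) (by positivity)) le_rfl hst ht
    simp only [intervalIntegral.integral_same, mul_zero, add_zero] at h3
    exact (hineq t ⟨hst, ht⟩).trans h3
  rcases hs.eq_or_lt with rfl | hs
  · rcases hst.eq_or_lt with rfl | ht0
    · simp
    have hsub : 𝓝[>] (0 : ℝ) ≤ 𝓝[Icc 0 T] 0 :=
      nhdsWithin_le_of_mem (mem_of_superset (Ioo_mem_nhdsGT (ht0.trans_le ht)) Ioo_subset_Icc_self)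
    have h1 : Tendsto φ (𝓝[>] 0) (𝓝 (φ 0)) := (hφc 0 ⟨le_rfl, hst.trans ht⟩).mono_left hsub
    have h2 : Tendsto (fun s => Real.exp (2 * lam * (t - s))) (𝓝[>] 0)
        (𝓝 (Real.exp (2 * lam * (t - 0)))) :=
      (Continuous.tendsto (by fun_prop) 0).mono_left nhdsWithin_le_nhds
    refine ge_of_tendsto (h2.mul h1) ?_
    filter_upwards [Ioo_mem_nhdsGT ht0] with s hs
    exact hpos s t hs.1 hs.2.le ht
  · exact hpos s t hs hst ht

/-- The contraction estimate for the curves in `L²(0,1)`. -/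
theorem norm_sub_le (hσ : IsStress σ lam) (hμ : 0 < μ) (hp₀ : ∫ x, p₀ x ∂unitVol = μ)
    (hq₀ : ∫ x, q₀ x ∂unitVol = μ) (hp : IsSolutionOn σ p₀ T p) (hq : IsSolutionOn σ q₀ T q)
    {t : ℝ} (ht : t ∈ Icc 0 T) {f g : L2} (hf : ∀ᵐ x ∂unitVol, f x = p x t)
    (hg : ∀ᵐ x ∂unitVol, g x = q x t) : ‖f - g‖ ≤ Real.exp (lam * t) * ‖p₀ - q₀‖ := by
  obtain ⟨u, -, hu0, hu⟩ := hp.continuous_L2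
  obtain ⟨v, -, hv0, hv⟩ := hq.continuous_L2
  have h0 : (0 : ℝ) ∈ Icc 0 T := ⟨le_rfl, ht.1.trans ht.2⟩
  have h1 := integral_sq_sub_le hσ hμ hp₀ hq₀ hp hq le_rfl ht.1 ht.2
  rw [← norm_sq_sub_eq_integral hf hg, ← norm_sq_sub_eq_integral (hu 0 h0) (hv 0 h0), hu0, hv0,
    sub_zero] at h1
  refine abs_le_of_sq_le_sq' ?_ (by positivity) |>.2
  refine h1.trans_eq ?_
  rw [mul_pow, ← Real.exp_nat_mul]
  congr 2
  push_cast; ring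

theorem ae_eq (hσ : IsStress σ lam) (hμ : 0 < μ) (hp₀ : ∫ x, p₀ x ∂unitVol = μ)
    (hp : IsSolutionOn σ p₀ T p) (hq : IsSolutionOn σ p₀ T q) {t : ℝ} (ht : t ∈ Icc 0 T) :
    ∀ᵐ x ∂unitVol, p x t = q x t := by
  obtain ⟨u, -, hu0, hu⟩ := hp.continuous_L2
  obtain ⟨v, -, hv0, hv⟩ := hq.continuous_L2
  have h1 := norm_sub_le hσ hμ hp₀ hp₀ hp hq ht (hu t ht) (hv t ht)
  rw [sub_self, norm_zero, mul_zero] at h1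
  have h2 : u t = v t := sub_eq_zero.1 (norm_le_zero_iff.1 h1)
  filter_upwards [hu t ht, hv t ht] with x h3 h4
  rw [← h3, ← h4, h2]

end IsSolutionOn

/-! ### Classical solutions for a dense set of initial data -/

/-- A classical solution on `[0,T]`, with the two a priori bounds that pass to the limit: growth of
the variance, and the regularizing estimate on the velocity. The latter is stated for all `T' ≤ T`,
so that the bound obtained does not depend on `T`. -/
structure IsClassical (σ : ℝ → ℝ) (lam μ T : ℝ) (p : ℝ → ℝ → ℝ) : Prop where
  meas : Measurable (fun z : ℝ × ℝ => p z.1 z.2)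
  pos : ∀ x, ∀ t ∈ Icc 0 T, 0 < p x t
  hasDeriv : ∀ x, ∀ t ∈ Icc 0 T,
    HasDerivWithinAt (fun s => p x s) (-excessStress σ p x t) (Icc 0 T) t
  cont : ContinuousOn (meanStress σ p) (Icc 0 T)
  memLp : ∀ t, MemLp (fun x => p x t) 2 unitVol
  memLp_stress : ∀ t, MemLp (fun x => σ (p x t)) 2 unitVol
  variance_le : ∀ t ∈ Icc 0 T, ∫ x, (p x t - μ) ^ 2 ∂unitVol ≤
    Real.exp (2 * lam * t) * ∫ x, (p x 0 - μ) ^ 2 ∂unitVol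
  velocity_le : ∀ T' ≤ T, ∀ t, 0 < t → t < T' →
    t ^ 2 * ∫ x, excessStress σ p x t ^ 2 ∂unitVol ≤
      Real.exp (2 * lam * T') * ((1 + 2 * lam * T' * Real.exp (2 * lam * T')) *
        ∫ x, (p x 0 - μ) ^ 2 ∂unitVol)

section FiniteValued

variable {ι : Type*} [Fintype ι] [MeasurableSpace ι] [MeasurableSingletonClass ι] {i : ℝ → ι}

theorem memLp_comp_finite (hi : Measurable i) (G : ι → ℝ) :
    MemLp (fun x => G (i x)) 2 unitVol := by
  have : IsFiniteMeasure (unitVol.map i) := inferInstance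
  exact (MemLp.of_discrete (f := G) (μ := unitVol.map i)).comp_of_map hi.aemeasurable

theorem integral_comp_finite (hi : Measurable i) (G : ι → ℝ) :
    ∫ x, G (i x) ∂unitVol = ∑ j, unitVol.real (i ⁻¹' {j}) * G j := by
  rw [← integral_map hi.aemeasurable (f := G) (AEStronglyMeasurable.of_discrete),
    integral_fintype Integrable.of_finite]
  refine Finset.sum_congr rfl fun j _ => ?_
  rw [smul_eq_mul, measureReal_def, Measure.map_apply hi (measurableSet_singleton j)]
  rfl

theorem sum_measureReal_finite (hi : Measurable i) : ∑ j, unitVol.real (i ⁻¹' {j}) = 1 := by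
  have := integral_comp_finite hi fun _ => 1
  simpa using this.symm

variable {σ : ℝ → ℝ} {lam μ T : ℝ} {y : ℝ → ι → ℝ}

theorem meanStress_finite (hi : Measurable i) {p : ℝ → ℝ → ℝ} {t : ℝ} {v : ι → ℝ}
    (hp : ∀ x, p x t = v (i x)) :
    meanStress σ p t = ∑ j, unitVol.real (i ⁻¹' {j}) * σ (v j) := by
  simp only [meanStress, hp]
  exact integral_comp_finite hi fun j => σ (v j)

theorem excessStress_finite (hi : Measurable i) {p : ℝ → ℝ → ℝ} {t : ℝ} {v : ι → ℝ}
    (hp : ∀ x, p x t = v (i x)) (x : ℝ) :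
    -excessStress σ p x t =
      IsFiniteFlow.velocity σ (fun j => unitVol.real (i ⁻¹' {j})) v (i x) := by
  rw [excessStress_eq, meanStress_finite hi hp, hp, IsFiniteFlow.velocity]; ring

/-- A finite flow defines a classical solution. Time is clamped to `[0,T]`, which makes the function
measurable and square integrable for all times. -/
theorem isClassical_of_finite (hσ : IsStress σ lam) (hT : 0 < T) (hi : Measurable i) (hμ : 0 < μ)
    (hy : IsFiniteFlow σ (fun j => unitVol.real (i ⁻¹' {j})) T y)
    (hmean : ∑ j, unitVol.real (i ⁻¹' {j}) * y 0 j = μ) :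
    IsClassical σ lam μ T (fun x t => y (max 0 (min t T)) (i x)) := by
  set m : ι → ℝ := fun j => unitVol.real (i ⁻¹' {j}) with hm
  have hm0 : ∀ j, 0 ≤ m j := fun j => measureReal_nonneg
  have hm1 : ∑ j, m j = 1 := sum_measureReal_finite hi
  set p : ℝ → ℝ → ℝ := fun x t => y (max 0 (min t T)) (i x) with hp
  have hclamp : ∀ t ∈ Icc 0 T, max 0 (min t T) = t := fun t ht => by
    rw [min_eq_left ht.2, max_eq_right ht.1]
  have hpy : ∀ t ∈ Icc 0 T, ∀ x, p x t = y t (i x) := fun t ht x => by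
    simp only [hp]; rw [hclamp t ht]
  have h0 : (0 : ℝ) ∈ Icc 0 T := ⟨le_rfl, hT.le⟩
  refine ⟨?_, ?_, ?_, ?_, ?_, ?_, ?_, ?_⟩
  · have h1 : Measurable (fun z : ι × ℝ => y (max 0 (min z.2 T)) z.1) := by
      refine measurable_from_prod_countable_right fun j => Continuous.measurable ?_
      exact (hy.continuousOn j).comp_continuous (by fun_prop)
        fun t => ⟨le_max_left _ _, max_le hT.le (min_le_right _ _)⟩
    exact h1.comp ((hi.comp measurable_fst).prodMk measurable_snd)
  · intro x t ht
    rw [hpy t ht]; exact hy.pos t ht _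
  · intro x t ht
    rw [excessStress_finite hi (hpy t ht)]
    exact (hy.hasDeriv t ht (i x)).congr (fun s hs => hpy s hs x) (hpy t ht x)
  · refine ContinuousOn.congr (f := fun t => ∑ j, m j * σ (y t j)) ?_
      fun t ht => meanStress_finite hi (hpy t ht)
    refine continuousOn_finsetSum _ fun j _ => continuousOn_const.mul ?_
    exact hσ.continuousOn.comp (hy.continuousOn j) fun t ht => hy.pos t ht j
  · exact fun t => memLp_comp_finite hi _
  · exact fun t => memLp_comp_finite hi (fun j => σ (y (max 0 (min t T)) j))
  · intro t ht
    have := hy.sum_sq_sub_le hσ hm0 hm1 hT (IsFiniteFlow.const hm1 hμ) (by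
      rw [hmean, ← Finset.sum_mul, hm1, one_mul]) le_rfl ht.1 ht.2
    simp only [hpy t ht, hpy 0 h0]
    rw [integral_comp_finite hi fun j => (y t j - μ) ^ 2,
      integral_comp_finite hi fun j => (y 0 j - μ) ^ 2]
    rwa [sub_zero] at this
  · intro T' hT' t ht0 ht
    have := (hy.mono hT').sq_mul_sum_sq_velocity_le hσ hm0 hm1 hμ hmean ht0 ht
    have h1 : ∀ x, excessStress σ p x t ^ 2 = IsFiniteFlow.velocity σ m (y t) (i x) ^ 2 :=
      fun x => by
        rw [← excessStress_finite hi (hpy t ⟨ht0.le, (ht.trans_le hT').le⟩), neg_sq]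
    simp only [h1, hpy 0 h0]
    rw [integral_comp_finite hi fun j => (y 0 j - μ) ^ 2,
      integral_comp_finite hi fun j => IsFiniteFlow.velocity σ m (y t) j ^ 2]
    exact this

theorem isSolutionOn_of_finite (hσ : IsStress σ lam) (hT : 0 < T) (hi : Measurable i)
    (hy : IsFiniteFlow σ (fun j => unitVol.real (i ⁻¹' {j})) T y)
    (hp : IsClassical σ lam μ T (fun x t => y (max 0 (min t T)) (i x))) {q : L2}
    (hq : ∀ᵐ x ∂unitVol, q x = y 0 (i x)) :
    IsSolutionOn σ q T (fun x t => y (max 0 (min t T)) (i x)) := by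
  set p : ℝ → ℝ → ℝ := fun x t => y (max 0 (min t T)) (i x) with hpdef
  have hclamp : ∀ t ∈ Icc 0 T, max 0 (min t T) = t := fun t ht => by
    rw [min_eq_left ht.2, max_eq_right ht.1]
  have h0 : (0 : ℝ) ∈ Icc 0 T := ⟨le_rfl, hT.le⟩
  have hexc : ∀ x, ContinuousOn (fun t => excessStress σ p x t) (Icc 0 T) := fun x =>
    (hσ.continuousOn.comp (fun t ht => (hp.hasDeriv x t ht).continuousWithinAt)
      fun t ht => hp.pos x t ht).sub hp.cont
  refine ⟨hp.meas.aestronglyMeasurable, ?_, ?_, ?_, ?_, ?_⟩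
  · -- Functions with level sets `i ⁻¹' {j}` form a finite-dimensional subspace of `L²`.
    let Φ : (ι → ℝ) →ₗ[ℝ] L2 :=
      { toFun := fun v => (memLp_comp_finite hi v).toLp _
        map_add' := fun v w => MemLp.toLp_add (memLp_comp_finite hi v) (memLp_comp_finite hi w)
        map_smul' := fun c v => MemLp.toLp_const_smul c (memLp_comp_finite hi v) }
    have hΦ : ∀ v, ∀ᵐ x ∂unitVol, Φ v x = v (i x) := fun v =>
      (memLp_comp_finite hi v).coeFn_toLp
    refine ⟨fun t => Φ (y t), ?_, ?_, ?_⟩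
    · exact Φ.continuous_of_finiteDimensional.comp_continuousOn
        (continuousOn_pi.2 fun j => hy.continuousOn j)
    · refine Lp.ext ?_
      filter_upwards [hΦ (y 0), hq] with x h1 h2
      rw [h1, h2]
    · intro t ht
      filter_upwards [hΦ (y t)] with x h1
      rw [h1, hpdef]
      simp only
      rw [hclamp t ht]
  · refine (ae_restrict_mem (measurableSet_Ioo.prod measurableSet_Icc)).mono fun z hz => ?_
    exact hp.pos z.1 z.2 hz.2
  · exact Eventually.of_forall fun t => (hp.memLp_stress t).integrable (by norm_num)
  · refine Eventually.of_forall fun x τ hτ => ?_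
    exact ((hexc x).mono (Icc_subset_Icc_left hτ.1.le)).integrableOn_Icc.mono_set
      Ioo_subset_Icc_self
  · refine Eventually.of_forall fun x s hs t ht => ?_
    have hsub : uIcc s t ⊆ Icc 0 T := uIcc_subset_Icc (Ioc_subset_Icc_self hs)
      (Ioc_subset_Icc_self ht)
    have := intervalIntegral.integral_eq_sub_of_hasDeriv_right (f := fun r => p x r)
      (f' := fun r => -excessStress σ p x r) (a := s) (b := t)
      (fun r hr => ((hp.hasDeriv x r (hsub hr)).mono hsub).continuousWithinAt) (fun r hr => by
        have hr' : r ∈ Ioo 0 T := ⟨(le_min hs.1.le ht.1.le).trans_lt hr.1,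
          hr.2.trans_le (max_le hs.2 ht.2)⟩
        exact ((hp.hasDeriv x r (Ioo_subset_Icc_self hr')).hasDerivAt
          (Icc_mem_nhds hr'.1 hr'.2)).hasDerivWithinAt)
      ((hexc x).mono hsub).neg.intervalIntegrable
    rw [intervalIntegral.integral_neg] at this
    linarith

end FiniteValued

/-- Positive simple functions with mean `μ` approximate every admissible function: approximate by
simple functions, take positive parts, add a small constant, and rescale to restore the mean. -/
theorem exists_simpleFunc_norm_sub_lt {μ : ℝ} (hμ : 0 < μ) {p₀ : L2} (hp₀ : p₀ ∈ admissible μ)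
    {ε : ℝ} (hε : 0 < ε) :
    ∃ (f : SimpleFunc ℝ ℝ) (q : L2), (∀ x, 0 < f x) ∧ ∫ x, f x ∂unitVol = μ ∧
      (∀ᵐ x ∂unitVol, q x = f x) ∧ ‖q - p₀‖ < ε := by
  have hδ : ∀ k : ℕ, 0 < (1 : ℝ) / (k + 1) := fun k => by positivity
  have hex : ∀ k : ℕ, ∃ (h : SimpleFunc ℝ ℝ), (∀ x, 0 < h x) ∧
      eLpNorm (⇑p₀ - ⇑h) 2 unitVol ≤ 2 * ENNReal.ofReal (1 / (k + 1)) := by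
    intro k
    obtain ⟨g, hg, -⟩ := (Lp.memLp p₀).exists_simpleFunc_eLpNorm_sub_lt (by norm_num)
      (ENNReal.ofReal_pos.2 (hδ k)).ne'
    refine ⟨g.map fun r => max r 0 + 1 / (k + 1), fun x => ?_, ?_⟩
    · simp only [SimpleFunc.map_apply]
      have := le_max_right (g x) 0
      linarith [hδ k]
    · have h1 : eLpNorm (⇑p₀ - ⇑(g.map fun r => max r 0 + 1 / ((k : ℝ) + 1))) 2 unitVol ≤
          eLpNorm ((fun x => |(p₀ - ⇑g) x|) + fun _ => 1 / ((k : ℝ) + 1)) 2 unitVol := by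
        refine eLpNorm_mono_ae ?_
        filter_upwards [hp₀.1] with x hx
        simp only [Pi.sub_apply, SimpleFunc.map_apply, Pi.add_apply, Real.norm_eq_abs]
        have h2 : |p₀ x - max (g x) 0| ≤ |p₀ x - g x| := by
          have := abs_max_sub_max_le_abs (p₀ x) (g x) 0
          rwa [max_eq_left hx] at this
        rw [abs_of_nonneg (add_nonneg (abs_nonneg _) (hδ k).le)]
        calc |p₀ x - (max (g x) 0 + 1 / ((k : ℝ) + 1))|
            = |(p₀ x - max (g x) 0) - 1 / ((k : ℝ) + 1)| := by congr 1; ring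
          _ ≤ |p₀ x - max (g x) 0| + |1 / ((k : ℝ) + 1)| := abs_sub _ _
          _ ≤ _ := by rw [abs_of_pos (hδ k)]; gcongr
      have hm : AEStronglyMeasurable (⇑p₀ - ⇑g) unitVol :=
        (Lp.aestronglyMeasurable p₀).sub g.aestronglyMeasurable
      refine h1.trans ((eLpNorm_add_le hm.norm aestronglyMeasurable_const (by norm_num)).trans ?_)
      rw [two_mul]
      refine add_le_add ?_ ?_
      · rw [eLpNorm_norm]; exact hg.le
      · refine (eLpNorm_le_of_ae_bound (C := 1 / ((k : ℝ) + 1)) ?_).trans ?_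
        · exact Eventually.of_forall fun x => by rw [Real.norm_of_nonneg (hδ k).le]
        · simp
  choose h hpos hdist using hex
  have hL : ∀ k, MemLp (h k) 2 unitVol := fun k => (h k).memLp_of_isFiniteMeasure 2 unitVol
  set H : ℕ → L2 := fun k => (hL k).toLp _ with hH
  have hHae : ∀ k, ∀ᵐ x ∂unitVol, H k x = h k x := fun k => (hL k).coeFn_toLp
  have hlim : Tendsto H atTop (𝓝 p₀) := by
    have h1 : Tendsto (fun k => eLpNorm (⇑(h k) - ⇑p₀) 2 unitVol) atTop (𝓝 0) := by
      have h2 : Tendsto (fun k : ℕ => 2 * ENNReal.ofReal (1 / ((k : ℝ) + 1))) atTop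
          (𝓝 (2 * ENNReal.ofReal 0)) :=
        ENNReal.Tendsto.const_mul (ENNReal.tendsto_ofReal tendsto_one_div_add_atTop_nhds_zero_nat)
          (Or.inr (by norm_num))
      simp only [ENNReal.ofReal_zero, mul_zero] at h2
      refine tendsto_of_tendsto_of_tendsto_of_le_of_le tendsto_const_nhds h2
        (fun _ => zero_le) fun k => ?_
      rw [eLpNorm_sub_comm]; exact hdist k
    have h3 := (Lp.tendsto_Lp_iff_tendsto_eLpNorm'' (fun k => ⇑(h k)) hL p₀ (Lp.memLp p₀)).2 h1
    rwa [Lp.toLp_coeFn] at h3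
  set c : ℕ → ℝ := fun k => ∫ x, H k x ∂unitVol with hc
  have hclim : Tendsto c atTop (𝓝 μ) := by
    have := (continuous_integral_L2.tendsto p₀).comp hlim
    rwa [hp₀.2] at this
  have hscaled : Tendsto (fun k => (μ / c k) • H k) atTop (𝓝 p₀) := by
    have := ((tendsto_const_nhds (x := μ)).div hclim hμ.ne').smul hlim
    rwa [div_self hμ.ne', one_smul] at this
  have hev := (hscaled.eventually (Metric.ball_mem_nhds p₀ hε)).and
    (hclim.eventually (lt_mem_nhds hμ))
  obtain ⟨k, hk1, hk2⟩ := hev.exists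
  refine ⟨(h k).map fun r => μ / c k * r, (μ / c k) • H k, fun x => ?_, ?_, ?_, ?_⟩
  · simp only [SimpleFunc.map_apply]
    exact mul_pos (div_pos hμ hk2) (hpos k x)
  · simp only [SimpleFunc.map_apply]
    rw [integral_const_mul]
    have : ∫ x, h k x ∂unitVol = c k := integral_congr_ae ((hHae k).mono fun x hx => hx.symm)
    rw [this, div_mul_cancel₀ _ hk2.ne']
  · filter_upwards [Lp.coeFn_smul (μ / c k) (H k), hHae k] with x h1 h2
    rw [h1, Pi.smul_apply, h2, SimpleFunc.map_apply, smul_eq_mul]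
  · rwa [dist_eq_norm] at hk1

/-- Classical solutions exist for initial data in a dense set. -/
theorem exists_isClassical {σ : ℝ → ℝ} {lam μ : ℝ} (hσ : IsStress σ lam) (hμ : 0 < μ) {p₀ : L2}
    (hp₀ : p₀ ∈ admissible μ) {ε T : ℝ} (hε : 0 < ε) (hT : 0 < T) :
    ∃ (q : L2) (p : ℝ → ℝ → ℝ), ‖q - p₀‖ < ε ∧ ∫ x, q x ∂unitVol = μ ∧
      IsSolutionOn σ q T p ∧ IsClassical σ lam μ T p := by
  obtain ⟨f, q, hpos, hmean, hq, hdist⟩ := exists_simpleFunc_norm_sub_lt hμ hp₀ hε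
  set i : ℝ → f.range := fun x => ⟨f x, f.mem_range_self x⟩ with hi
  have him : Measurable i := f.measurable.subtype_mk
  obtain ⟨y, hy0, hy⟩ := exists_isFiniteFlow hσ (m := fun j => unitVol.real (i ⁻¹' {j}))
    (fun j => measureReal_nonneg) (sum_measureReal_finite him) (y₀ := fun j => (j : ℝ))
    (fun j => by
      obtain ⟨x, hx⟩ := SimpleFunc.mem_range.1 j.2
      rw [← hx]; exact hpos x) hT
  have hm : ∑ j, unitVol.real (i ⁻¹' {j}) * y 0 j = μ := by
    rw [hy0, ← integral_comp_finite him fun j => (j : ℝ)]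
    exact hmean
  have hcl := isClassical_of_finite hσ hT him hμ hy hm
  refine ⟨q, _, hdist, ?_, isSolutionOn_of_finite hσ hT him hy hcl ?_, hcl⟩
  · rw [← hmean]; exact integral_congr_ae hq
  · rw [hy0]; exact hq

/-! ### Tools for the passage to the limit -/

/-- Rapid convergence in `L²` implies convergence almost everywhere. -/
theorem ae_tendsto_of_norm_sub_le {f : ℕ → L2} {g : L2} {C : ℝ}
    (h : ∀ n, ‖f n - g‖ ≤ C * (1 / 2) ^ n) :
    ∀ᵐ x ∂unitVol, Tendsto (fun n => f n x) atTop (𝓝 (g x)) := by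
  have h1 : ∀ n, ∫⁻ x, ‖(f n - g : L2) x‖ₑ ∂unitVol ≤ ENNReal.ofReal (C * (1 / 2) ^ n) := by
    intro n
    rw [← eLpNorm_one_eq_lintegral_enorm]
    refine (eLpNorm_le_eLpNorm_of_exponent_le (q := 2) (by norm_num)
      (Lp.aestronglyMeasurable _)).trans ?_
    rw [← Lp.enorm_def, ← ofReal_norm]
    exact ENNReal.ofReal_le_ofReal (h n)
  have hsum : ∑' n, ENNReal.ofReal (C * (1 / 2) ^ n) ≠ ⊤ :=
    (summable_geometric_two.mul_left C).tsum_ofReal_ne_top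
  have h2 : ∫⁻ x, ∑' n, ‖(f n - g : L2) x‖ₑ ∂unitVol ≠ ⊤ := by
    rw [lintegral_tsum fun n => (Lp.aestronglyMeasurable _).enorm]
    exact ne_top_of_le_ne_top hsum (ENNReal.tsum_le_tsum h1)
  have h3 := ae_lt_top' (AEMeasurable.tsum fun n =>
    (Lp.aestronglyMeasurable (f n - g)).enorm) h2
  have h4 : ∀ᵐ x ∂unitVol, ∀ n, (f n - g : L2) x = f n x - g x :=
    ae_all_iff.2 fun n => Lp.coeFn_sub _ _
  filter_upwards [h3, h4] with x h5 h6
  have h7 := ENNReal.tendsto_atTop_zero_of_tsum_ne_top h5.ne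
  rw [tendsto_iff_edist_tendsto_0]
  refine h7.congr fun n => ?_
  rw [h6, edist_eq_enorm_sub]

/-- Passing to the limit in the stress: along an almost everywhere convergent sequence with stresses
bounded in `L²`, the limit is positive because `σ` is unbounded near `0`, and the stresses converge
in mean. -/
theorem IsStress.tendsto_integral {σ : ℝ → ℝ} {lam : ℝ} (hσ : IsStress σ lam) {f : ℕ → ℝ → ℝ}
    {g : ℝ → ℝ} (hpos : ∀ n, ∀ᵐ x ∂unitVol, 0 < f n x)
    (hL : ∀ n, MemLp (fun x => σ (f n x)) 2 unitVol) {C : ℝ}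
    (hC : ∀ n, ∫ x, σ (f n x) ^ 2 ∂unitVol ≤ C) (hg : AEStronglyMeasurable g unitVol)
    (hlim : ∀ᵐ x ∂unitVol, Tendsto (fun n => f n x) atTop (𝓝 (g x))) :
    (∀ᵐ x ∂unitVol, 0 < g x) ∧ MemLp (fun x => σ (g x)) 2 unitVol ∧
      ∫ x, σ (g x) ^ 2 ∂unitVol ≤ C ∧
      Tendsto (fun n => ∫ x, σ (f n x) ∂unitVol) atTop (𝓝 (∫ x, σ (g x) ∂unitVol)) := by
  have hC0 : 0 ≤ C := (integral_nonneg fun _ => sq_nonneg _).trans (hC 0)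
  have hm : ∀ n, AEMeasurable (fun x => ENNReal.ofReal (σ (f n x) ^ 2)) unitVol := fun n =>
    ((hL n).1.pow 2).aemeasurable.ennreal_ofReal
  have hfat : ∫⁻ x, liminf (fun n => ENNReal.ofReal (σ (f n x) ^ 2)) atTop ∂unitVol ≤
      ENNReal.ofReal C := by
    refine (lintegral_liminf_le' hm).trans ?_
    refine liminf_le_of_le (by isBoundedDefault) fun b hb => ?_
    obtain ⟨n, hn⟩ := hb.exists
    refine hn.trans ?_
    rw [← ofReal_integral_eq_lintegral_ofReal (hL n).integrable_sq
      (Eventually.of_forall fun _ => sq_nonneg _)]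
    exact ENNReal.ofReal_le_ofReal (hC n)
  have hlm : AEMeasurable (fun x => liminf (fun n => ENNReal.ofReal (σ (f n x) ^ 2)) atTop)
      unitVol := by
    simp only [liminf_eq_iSup_iInf_of_nat]
    exact AEMeasurable.iSup fun n => AEMeasurable.biInf _ (to_countable _) fun i _ => hm i
  have hfin : ∀ᵐ x ∂unitVol, liminf (fun n => ENNReal.ofReal (σ (f n x) ^ 2)) atTop < ⊤ :=
    ae_lt_top' hlm (ne_top_of_le_ne_top ENNReal.ofReal_ne_top hfat)
  have hpos' : ∀ᵐ x ∂unitVol, 0 < g x := by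
    filter_upwards [ae_all_iff.2 hpos, hlim, hfin] with x h1 h2 h3
    rcases (ge_of_tendsto' h2 fun n => (h1 n).le).eq_or_lt with h0 | h0
    · exfalso
      rw [← h0] at h2
      have h4 : Tendsto (fun n => f n x) atTop (𝓝[>] 0) :=
        tendsto_nhdsWithin_iff.2 ⟨h2, Eventually.of_forall h1⟩
      have h5 : Tendsto (fun n => σ (f n x) ^ 2) atTop atTop := by
        have h6 := tendsto_neg_atBot_atTop.comp (hσ.atBot.comp h4)
        have h7 := (tendsto_pow_atTop (α := ℝ) two_ne_zero).comp h6
        refine h7.congr fun n => ?_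
        simp
      have h8 := (ENNReal.tendsto_ofReal_atTop.comp h5).liminf_eq
      simp only [Function.comp_def] at h8
      rw [h8] at h3
      exact lt_irrefl _ h3
    · exact h0
  have hσlim : ∀ᵐ x ∂unitVol, Tendsto (fun n => σ (f n x)) atTop (𝓝 (σ (g x))) := by
    filter_upwards [hpos', hlim] with x h1 h2
    exact ((hσ.continuousOn.continuousAt (Ioi_mem_nhds h1)).tendsto).comp h2
  have hσg : AEStronglyMeasurable (fun x => σ (g x)) unitVol :=
    aestronglyMeasurable_comp_of_continuousOn_Ioi hσ.continuousOn hg hpos'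
  have hlint : ∫⁻ x, ENNReal.ofReal (σ (g x) ^ 2) ∂unitVol ≤ ENNReal.ofReal C := by
    refine le_trans (le_of_eq (lintegral_congr_ae ?_)) hfat
    filter_upwards [hσlim] with x hx
    exact ((ENNReal.tendsto_ofReal (hx.pow 2)).liminf_eq).symm
  have hmem : MemLp (fun x => σ (g x)) 2 unitVol := by
    rw [memLp_two_iff_integrable_sq hσg]
    refine ⟨hσg.pow 2, ?_⟩
    rw [hasFiniteIntegral_iff_ofReal (Eventually.of_forall fun _ => sq_nonneg _)]
    exact hlint.trans_lt ENNReal.ofReal_lt_top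
  have hsq : ∫ x, σ (g x) ^ 2 ∂unitVol ≤ C := by
    rw [← ofReal_integral_eq_lintegral_ofReal hmem.integrable_sq
      (Eventually.of_forall fun _ => sq_nonneg _)] at hlint
    exact (ENNReal.ofReal_le_ofReal_iff hC0).1 hlint
  refine ⟨hpos', hmem, hsq, ?_⟩
  -- `L²` bounds make the sequence uniformly integrable: use `|h| ≤ min |h| k + h² / k`.
  set h : ℕ → ℝ → ℝ := fun n x => σ (f n x) - σ (g x) with hh
  have hhL : ∀ n, MemLp (h n) 2 unitVol := fun n => (hL n).sub hmem
  have hhi : ∀ n, Integrable (h n) unitVol := fun n => (hhL n).integrable (by norm_num)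
  have hhsq : ∀ n, ∫ x, h n x ^ 2 ∂unitVol ≤ 4 * C := by
    intro n
    calc ∫ x, h n x ^ 2 ∂unitVol ≤ ∫ x, 2 * (σ (f n x) ^ 2 + σ (g x) ^ 2) ∂unitVol := by
          refine integral_mono (hhL n).integrable_sq
            (((hL n).integrable_sq.add hmem.integrable_sq).const_mul 2) fun x => ?_
          have := sq_nonneg (σ (f n x) + σ (g x))
          simp only [hh]; nlinarith
      _ = 2 * (∫ x, σ (f n x) ^ 2 ∂unitVol + ∫ x, σ (g x) ^ 2 ∂unitVol) := by
          rw [integral_const_mul, integral_add (hL n).integrable_sq hmem.integrable_sq]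
      _ ≤ 4 * C := by linarith [hC n]
  have hmin : ∀ k : ℝ, 0 < k →
      Tendsto (fun n => ∫ x, min |h n x| k ∂unitVol) atTop (𝓝 0) := by
    intro k hk
    have h0 : (0 : ℝ) = ∫ _, (0 : ℝ) ∂unitVol := by simp
    rw [h0]
    refine tendsto_integral_of_dominated_convergence (fun _ => k) (fun n => ?_)
      (integrable_const k) (fun n => Eventually.of_forall fun x => ?_) ?_
    · exact ((hhL n).1.norm).inf aestronglyMeasurable_const
    · rw [Real.norm_of_nonneg (le_min (abs_nonneg _) hk.le)]; exact min_le_right _ _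
    · filter_upwards [hσlim] with x hx
      have h1 : Tendsto (fun n => |h n x|) atTop (𝓝 0) := by
        have := (hx.sub_const (σ (g x))).abs
        simpa using this
      have h2 := h1.min (tendsto_const_nhds (x := k))
      rwa [min_eq_left hk.le] at h2
  rw [Metric.tendsto_atTop]
  intro ε hε
  set k := 8 * (C + 1) / ε with hk
  have hk0 : 0 < k := by positivity
  have hev := (hmin k hk0).eventually (gt_mem_nhds (half_pos hε))
  obtain ⟨N, hN⟩ := eventually_atTop.1 hev
  refine ⟨N, fun n hn => ?_⟩
  rw [Real.dist_eq, ← integral_sub ((hL n).integrable (by norm_num))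
    (hmem.integrable (by norm_num))]
  have hmi : Integrable (fun x => min |h n x| k) unitVol :=
    (hhi n).abs.inf (integrable_const k)
  calc |∫ x, h n x ∂unitVol| ≤ ∫ x, |h n x| ∂unitVol := abs_integral_le_integral_abs
    _ ≤ ∫ x, (min |h n x| k + h n x ^ 2 / k) ∂unitVol := by
        refine integral_mono (hhi n).abs (hmi.add ((hhL n).integrable_sq.div_const k)) fun x => ?_
        have h2 : 0 ≤ h n x ^ 2 / k := by positivity
        rcases le_total |h n x| k with h1 | h1
        · simp only [min_eq_left h1]; linarith
        · simp only [min_eq_right h1]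
          have : |h n x| ≤ h n x ^ 2 / k := by
            rw [le_div_iff₀ hk0, ← sq_abs]; nlinarith [abs_nonneg (h n x)]
          linarith
    _ = ∫ x, min |h n x| k ∂unitVol + (∫ x, h n x ^ 2 ∂unitVol) / k := by
        rw [integral_add hmi ((hhL n).integrable_sq.div_const k), integral_div]
    _ ≤ ∫ x, min |h n x| k ∂unitVol + 4 * C / k := by gcongr; exact hhsq n
    _ < ε / 2 + ε / 2 := by
        refine add_lt_add_of_lt_of_le (hN n hn) ?_
        rw [hk, div_div_eq_mul_div, div_le_div_iff₀ (by positivity) (by positivity)]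
        nlinarith
    _ = ε := by ring

theorem cauchySeq_of_sq_sub_le {f B : ℕ → ℝ} (h : ∀ n m, (f n - f m) ^ 2 ≤ B n + B m)
    (hB : Tendsto B atTop (𝓝 0)) : CauchySeq f := by
  rw [Metric.cauchySeq_iff]
  intro ε hε
  have : 0 < ε ^ 2 / 2 := by positivity
  obtain ⟨N, hN⟩ := eventually_atTop.1 (hB.eventually (gt_mem_nhds this))
  refine ⟨N, fun n hn m hm => ?_⟩
  rw [Real.dist_eq]
  refine abs_lt_of_sq_lt_sq ?_ hε.le
  linarith [h n m, hN n hn, hN m hm]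

/-- Passing to the limit in the scalar equation `y' = -σ(y) + c`: if the initial values converge to
a positive limit and the forcing terms converge boundedly, the solutions converge, and remain in
a compact subset of `(0,∞)`. -/
theorem IsStress.exists_tendsto_of_scalar {σ : ℝ → ℝ} {lam : ℝ} (hσ : IsStress σ lam) {s T : ℝ}
    (hsT : s ≤ T) {y c : ℕ → ℝ → ℝ} {d : ℝ → ℝ} {l C : ℝ}
    (hy : ∀ n, ∀ t ∈ Icc s T, HasDerivWithinAt (y n) (-(σ (y n t) - c n t)) (Icc s T) t)
    (hpos : ∀ n, ∀ t ∈ Icc s T, 0 < y n t) (hc : ∀ n, ContinuousOn (c n) (Icc s T))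
    (hC : ∀ n, ∀ t ∈ Icc s T, |c n t| ≤ C)
    (hlim : ∀ t ∈ Icc s T, Tendsto (fun n => c n t) atTop (𝓝 (d t)))
    (hl : 0 < l) (hys : Tendsto (fun n => y n s) atTop (𝓝 l)) :
    ∃ z : ℝ → ℝ, (∀ t ∈ Icc s T, Tendsto (fun n => y n t) atTop (𝓝 (z t))) ∧
      (∀ t ∈ Icc s T, 0 < z t) ∧
      IntervalIntegrable (fun r => σ (z r) - d r) volume s T ∧
      ∀ t ∈ Icc s T, z t = z s - ∫ r in s..t, (σ (z r) - d r) := by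
  have hlam := hσ.lam_nonneg
  have hC0 : 0 ≤ C := (abs_nonneg _).trans (hC 0 s (left_mem_Icc.2 hsT))
  have hdC : ∀ t ∈ Icc s T, |d t| ≤ C := fun t ht =>
    le_of_tendsto' (hlim t ht).abs fun n => hC n t ht
  have hIoc : ∀ t ∈ Icc s T, Ioc s t ⊆ Icc s T := fun t ht =>
    Ioc_subset_Icc_self.trans (Icc_subset_Icc_right ht.2)
  have hcm : ∀ n, AEStronglyMeasurable (c n) (volume.restrict (Icc s T)) := fun n =>
    (hc n).aestronglyMeasurable measurableSet_Icc
  have hdm : AEStronglyMeasurable d (volume.restrict (Icc s T)) :=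
    aestronglyMeasurable_of_tendsto_ae atTop hcm
      ((ae_restrict_mem measurableSet_Icc).mono fun t ht => hlim t ht)
  -- the forcing terms converge in `L²`
  set J : ℕ → ℝ := fun n => ∫ r in Icc s T, (c n r - d r) ^ 2 with hJ
  have hJi : ∀ n, IntegrableOn (fun r => (c n r - d r) ^ 2) (Icc s T) := by
    intro n
    refine Integrable.of_bound (((hcm n).sub hdm).pow 2) ((2 * C) ^ 2) ?_
    filter_upwards [ae_restrict_mem measurableSet_Icc] with r hr
    rw [Real.norm_of_nonneg (sq_nonneg _), ← sq_abs]
    have := abs_sub (c n r) (d r)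
    have := hC n r hr
    have := hdC r hr
    gcongr
    linarith
  have hJ0 : Tendsto J atTop (𝓝 0) := by
    have h0 : (0 : ℝ) = ∫ _ in Icc s T, (0 : ℝ) := by simp
    rw [h0]
    refine tendsto_integral_of_dominated_convergence (fun _ => (2 * C) ^ 2)
      (fun n => ((hcm n).sub hdm).pow 2) (integrable_const _) (fun n => ?_) ?_
    · filter_upwards [ae_restrict_mem measurableSet_Icc] with r hr
      rw [Real.norm_of_nonneg (sq_nonneg _), ← sq_abs]
      have := abs_sub (c n r) (d r)
      have := hC n r hr
      have := hdC r hr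
      gcongr
      linarith
    · filter_upwards [ae_restrict_mem measurableSet_Icc] with r hr
      have := ((hlim r hr).sub_const (d r)).pow 2
      simpa using this
  set E := Real.exp ((2 * lam + 1) * (T - s)) with hE
  have hE0 : 0 < E := Real.exp_pos _
  have hEt : ∀ t ∈ Icc s T, Real.exp ((2 * lam + 1) * (t - s)) ≤ E := fun t ht =>
    Real.exp_le_exp.2 (by nlinarith [ht.2])
  set B : ℕ → ℝ := fun n => E * (2 * (y n s - l) ^ 2 + 2 * J n) with hB
  have hB0 : Tendsto B atTop (𝓝 0) := by
    have h1 := ((hys.sub_const l).pow 2).const_mul 2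
    have h2 := (h1.add (hJ0.const_mul 2)).const_mul E
    simpa using h2
  have hcauchy : ∀ t ∈ Icc s T, ∀ n m, (y n t - y m t) ^ 2 ≤ B n + B m := by
    intro t ht n m
    have hsub : Icc s t ⊆ Icc s T := Icc_subset_Icc_right ht.2
    have h1 := sq_le_of_mul_deriv_le (w := fun r => y n r - y m r) (e := fun r => c n r - c m r)
      (w' := fun r => -(σ (y n r) - c n r) - -(σ (y m r) - c m r)) hlam ht.1
      (fun r hr => ((hy n r (hsub hr)).mono hsub).sub ((hy m r (hsub hr)).mono hsub))
      (((hc n).sub (hc m)).mono hsub) (fun r hr => by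
        have h2 := hσ.neg_le_sub_mul_sub (hpos n r (hsub hr)) (hpos m r (hsub hr))
        have h3 : (y n r - y m r) * (c n r - c m r) ≤ |y n r - y m r| * |c n r - c m r| := by
          rw [← abs_mul]; exact le_abs_self _
        nlinarith)
    have h4 : ∫ r in s..t, (c n r - c m r) ^ 2 ≤ 2 * J n + 2 * J m := by
      rw [intervalIntegral.integral_of_le ht.1, hJ, ← integral_const_mul, ← integral_const_mul,
        ← integral_add ((hJi n).const_mul 2) ((hJi m).const_mul 2)]
      refine (setIntegral_mono_set (t := Icc s T) ?_ ?_
        (hIoc t ht).eventuallyLE).trans ?_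
      · exact (((hc n).sub (hc m)).pow 2).integrableOn_Icc
      · exact Eventually.of_forall fun _ => sq_nonneg _
      · refine integral_mono (((hc n).sub (hc m)).pow 2).integrableOn_Icc
          (((hJi n).const_mul 2).add ((hJi m).const_mul 2)) fun r => ?_
        have := sq_nonneg ((c n r - d r) + (c m r - d r))
        simp only
        nlinarith
    have h5 : (y n s - y m s) ^ 2 ≤ 2 * (y n s - l) ^ 2 + 2 * (y m s - l) ^ 2 := by
      have := sq_nonneg ((y n s - l) + (y m s - l))
      nlinarith
    have h6 : 0 ≤ ∫ r in s..t, (c n r - c m r) ^ 2 :=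
      intervalIntegral.integral_nonneg ht.1 fun _ _ => sq_nonneg _
    calc (y n t - y m t) ^ 2
        ≤ E * ((y n s - y m s) ^ 2 + ∫ r in s..t, (c n r - c m r) ^ 2) :=
          h1.trans (mul_le_mul_of_nonneg_right (hEt t ht) (by positivity))
      _ ≤ E * ((2 * (y n s - l) ^ 2 + 2 * (y m s - l) ^ 2) + (2 * J n + 2 * J m)) := by gcongr
      _ = B n + B m := by simp only [hB]; ring
  have hex : ∀ t, ∃ z, t ∈ Icc s T → Tendsto (fun n => y n t) atTop (𝓝 z) := by
    intro t
    by_cases ht : t ∈ Icc s T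
    · obtain ⟨z, hz⟩ := cauchySeq_tendsto_of_complete (cauchySeq_of_sq_sub_le (hcauchy t ht) hB0)
      exact ⟨z, fun _ => hz⟩
    · exact ⟨0, fun h => absurd h ht⟩
  choose z hz using hex
  have hzs : z s = l := tendsto_nhds_unique (hz s (left_mem_Icc.2 hsT)) hys
  -- a lower barrier, uniform in `n`
  obtain ⟨a', ha'0, ha'⟩ := hσ.exists_le_of_lt (-C)
  set a := min a' (l / 2) with ha
  have ha0 : 0 < a := lt_min ha'0 (half_pos hl)
  obtain ⟨N, hN⟩ := eventually_atTop.1 (hys.eventually (lt_mem_nhds (half_lt_self hl)))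
  have hlow : ∀ n, N ≤ n → ∀ t ∈ Icc s T, a ≤ y n t := by
    intro n hn
    refine le_of_deriv_nonneg_of_le (hy n) ((min_le_right _ _).trans (hN n hn).le) ?_
    intro t ht hle
    have h1 := ha' (y n t) (hpos n t ht) (hle.trans (min_le_left _ _))
    have h2 := (abs_le.1 (hC n t ht)).1
    linarith
  obtain ⟨M, hM0, hM⟩ : ∃ M, 0 ≤ M ∧ ∀ n, |B n| ≤ M := by
    obtain ⟨M, hM⟩ := hB0.abs.bddAbove_range
    exact ⟨M, (abs_nonneg _).trans (hM ⟨0, rfl⟩), fun n => hM ⟨n, rfl⟩⟩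
  obtain ⟨b', hb'⟩ : ∃ b', ∀ t ∈ Icc s T, |y N t| ≤ b' := by
    obtain ⟨b', hb'⟩ := isCompact_Icc.exists_bound_of_continuousOn
      (f := y N) fun t ht => (hy N t ht).continuousWithinAt
    exact ⟨b', hb'⟩
  set b := b' + (M + M + 1) with hb
  have hup : ∀ n, ∀ t ∈ Icc s T, y n t ≤ b := by
    intro n t ht
    have h1 := hcauchy t ht n N
    have h2 := (abs_le.1 (hM n)).2
    have h3 := (abs_le.1 (hM N)).2
    have h4 : y n t - y N t ≤ M + M + 1 := by nlinarith
    have h5 := (abs_le.1 (hb' t ht)).2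
    linarith
  obtain ⟨S, hS0, hS⟩ := hσ.exists_abs_le ha0 b
  have hzmem : ∀ t ∈ Icc s T, z t ∈ Icc a b := fun t ht =>
    ⟨ge_of_tendsto (hz t ht) (eventually_atTop.2 ⟨N, fun n hn => hlow n hn t ht⟩),
      le_of_tendsto' (hz t ht) fun n => hup n t ht⟩
  have hzpos : ∀ t ∈ Icc s T, 0 < z t := fun t ht => ha0.trans_le (hzmem t ht).1
  have hycont : ∀ n, ContinuousOn (y n) (Icc s T) := fun n t ht =>
    (hy n t ht).continuousWithinAt
  have hgcont : ∀ n, ContinuousOn (fun r => σ (y n r) - c n r) (Icc s T) := fun n =>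
    (hσ.continuousOn.comp (hycont n) (hpos n)).sub (hc n)
  have hglim : ∀ t ∈ Icc s T, Tendsto (fun n => σ (y n t) - c n t) atTop (𝓝 (σ (z t) - d t)) :=
    fun t ht => (((hσ.continuousOn.continuousAt (Ioi_mem_nhds (hzpos t ht))).tendsto).comp
      (hz t ht)).sub (hlim t ht)
  have hgm : AEStronglyMeasurable (fun r => σ (z r) - d r) (volume.restrict (Icc s T)) :=
    aestronglyMeasurable_of_tendsto_ae atTop
      (fun n => (hgcont n).aestronglyMeasurable measurableSet_Icc)
      ((ae_restrict_mem measurableSet_Icc).mono fun t ht => hglim t ht)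
  have hgi : IntegrableOn (fun r => σ (z r) - d r) (Icc s T) := by
    refine Integrable.of_bound hgm (S + C) ?_
    filter_upwards [ae_restrict_mem measurableSet_Icc] with r hr
    exact (abs_sub _ _).trans (add_le_add (hS _ (hzmem r hr)) (hdC r hr))
  refine ⟨z, fun t ht => hz t ht, hzpos, ?_, ?_⟩
  · rw [intervalIntegrable_iff_integrableOn_Ioc_of_le hsT]
    exact hgi.mono_set Ioc_subset_Icc_self
  · intro t ht
    have hsub : Icc s t ⊆ Icc s T := Icc_subset_Icc_right ht.2
    have h1 : ∀ n, y n t = y n s - ∫ r in s..t, (σ (y n r) - c n r) := by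
      intro n
      have := intervalIntegral.integral_eq_sub_of_hasDeriv_right (f := y n)
        (f' := fun r => -(σ (y n r) - c n r)) (a := s) (b := t)
        (by rw [uIcc_of_le ht.1]; exact (hycont n).mono hsub) (fun r hr => by
          rw [min_eq_left ht.1, max_eq_right ht.1] at hr
          exact ((hy n r (hsub (Ioo_subset_Icc_self hr))).hasDerivAt
            (Icc_mem_nhds hr.1 (hr.2.trans_le ht.2))).hasDerivWithinAt)
        (ContinuousOn.intervalIntegrable (by
          rw [uIcc_of_le ht.1]; exact ((hgcont n).mono hsub).neg))
      rw [intervalIntegral.integral_neg] at this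
      linarith
    have h2 : Tendsto (fun n => ∫ r in s..t, (σ (y n r) - c n r)) atTop
        (𝓝 (∫ r in s..t, (σ (z r) - d r))) := by
      refine intervalIntegral.tendsto_integral_filter_of_dominated_convergence
        (fun _ => S + C) ?_ ?_ ?_ ?_
      · refine Eventually.of_forall fun n => ?_
        rw [uIoc_of_le ht.1]
        exact ((hgcont n).mono (hIoc t ht)).aestronglyMeasurable measurableSet_Ioc
      · filter_upwards [eventually_ge_atTop N] with n hn
        refine Eventually.of_forall fun r hr => ?_
        rw [uIoc_of_le ht.1] at hr
        have hr' := hIoc t ht hr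
        exact (abs_sub _ _).trans (add_le_add (hS _ ⟨hlow n hn r hr', hup n r hr'⟩) (hC n r hr'))
      · exact _root_.intervalIntegrable_const
      · refine Eventually.of_forall fun r hr => ?_
        rw [uIoc_of_le ht.1] at hr
        exact hglim r (hIoc t ht hr)
    have h3 : Tendsto (fun n => y n t) atTop (𝓝 (l - ∫ r in s..t, (σ (z r) - d r))) :=
      (hys.sub h2).congr fun n => (h1 n).symm
    rw [hzs]
    exact tendsto_nhds_unique (hz t ht) h3

/-! ### Existence of regular solutions -/

theorem IsSolutionOn.mono {σ : ℝ → ℝ} {p₀ : L2} {T T' : ℝ} {p : ℝ → ℝ → ℝ}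
    (hp : IsSolutionOn σ p₀ T p) (hT : T' ≤ T) : IsSolutionOn σ p₀ T' p := by
  have hsub : Icc 0 T' ⊆ Icc 0 T := Icc_subset_Icc_right hT
  have hle : (volume : Measure (ℝ × ℝ)).restrict (Ioo (0 : ℝ) 1 ×ˢ Icc 0 T') ≤
      (volume : Measure (ℝ × ℝ)).restrict (Ioo (0 : ℝ) 1 ×ˢ Icc 0 T) :=
    Measure.restrict_mono (prod_mono_right hsub) le_rfl
  obtain ⟨u, huc, hu0, hu⟩ := hp.continuous_L2
  refine ⟨hp.aestronglyMeasurable.mono_measure hle,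
    ⟨u, huc.mono hsub, hu0, fun t ht => hu t (hsub ht)⟩,
    (Measure.absolutelyContinuous_of_le hle).ae_le hp.pos,
    (Measure.absolutelyContinuous_of_le (Measure.restrict_mono hsub le_rfl)).ae_le
      hp.integrable_stress, ?_, ?_⟩
  · filter_upwards [hp.integrable_excess] with x hx τ hτ
    exact (hx τ ⟨hτ.1, hτ.2.trans_le hT⟩).mono_set (Ioo_subset_Ioo_right hT)
  · filter_upwards [hp.equation] with x hx s hs t ht
    exact hx s ⟨hs.1, hs.2.trans hT⟩ t ⟨ht.1, ht.2.trans hT⟩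

/-- Away from the initial time, the stress of classical solutions is bounded in `L²(0,1)` by a
constant that depends on the initial data only through their variance. -/
theorem IsStress.exists_stress_bound {σ : ℝ → ℝ} {lam μ : ℝ} (hσ : IsStress σ lam) (hμ : 0 < μ)
    {D τ T' : ℝ} (hD : 0 ≤ D) (hτ : 0 < τ) :
    ∃ C, ∀ (T : ℝ) (p : ℝ → ℝ → ℝ), T' + 1 ≤ T → IsClassical σ lam μ T p →
      (∀ t ∈ Icc 0 T, ∫ x, p x t ∂unitVol = μ) → ∫ x, (p x 0 - μ) ^ 2 ∂unitVol ≤ D →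
      ∀ t ∈ Icc τ T', |meanStress σ p t| ≤ C ∧ ∫ x, σ (p x t) ^ 2 ∂unitVol ≤ C := by
  have hlam := hσ.lam_nonneg
  set V := Real.exp (2 * lam * T') * D with hV
  set R := 2 * V + 2 * μ ^ 2 with hR
  have hR0 : 0 < R := by positivity
  obtain ⟨K, ε, hK0, hε, hK⟩ := hσ.exists_abs_le_excess (half_pos hμ) hR0
  set W := Real.exp (2 * lam * (T' + 1)) *
    ((1 + 2 * lam * (T' + 1) * Real.exp (2 * lam * (T' + 1))) * D) / τ ^ 2 with hW
  refine ⟨max (K * (W + 1 + 1)) (2 * W + 2 * (K * (W + 1 + 1)) ^ 2), ?_⟩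
  intro T p hT hp hmean hp0 t ht
  have ht0 : 0 < t := hτ.trans_le ht.1
  have htT : t ∈ Icc 0 T := ⟨ht0.le, by linarith [ht.2]⟩
  have hT'0 : 0 ≤ T' := ht0.le.trans ht.2
  have hvar : ∫ x, (p x t - μ) ^ 2 ∂unitVol ≤ V := by
    refine (hp.variance_le t htT).trans ?_
    have : Real.exp (2 * lam * t) ≤ Real.exp (2 * lam * T') :=
      Real.exp_le_exp.2 (mul_le_mul_of_nonneg_left ht.2 (by positivity))
    exact mul_le_mul this hp0 (integral_nonneg fun _ => sq_nonneg _) (Real.exp_pos _).le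
  have hsq : ∫ x, p x t ^ 2 ∂unitVol ≤ R := by
    have h1 : MemLp (fun x => p x t - μ) 2 unitVol := (hp.memLp t).sub (memLp_const μ)
    calc ∫ x, p x t ^ 2 ∂unitVol ≤ ∫ x, (2 * (p x t - μ) ^ 2 + 2 * μ ^ 2) ∂unitVol := by
          refine integral_mono (hp.memLp t).integrable_sq
            ((h1.integrable_sq.const_mul 2).add (integrable_const _)) fun x => ?_
          have := sq_nonneg ((p x t - μ) - μ)
          simp only; nlinarith
      _ = 2 * ∫ x, (p x t - μ) ^ 2 ∂unitVol + 2 * μ ^ 2 := by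
          rw [integral_add (h1.integrable_sq.const_mul 2) (integrable_const _),
            integral_const_mul]
          simp
      _ ≤ R := by linarith
  have hexL : MemLp (fun x => excessStress σ p x t) 2 unitVol :=
    (hp.memLp_stress t).sub (memLp_const _)
  have hex2 : ∫ x, excessStress σ p x t ^ 2 ∂unitVol ≤ W := by
    have h1 := hp.velocity_le (T' + 1) hT t ht0 (by linarith [ht.2])
    rw [hW, le_div_iff₀ (by positivity), mul_comm]
    have h2 : τ ^ 2 ≤ t ^ 2 := by gcongr; exact ht.1
    have h3 : 0 ≤ ∫ x, excessStress σ p x t ^ 2 ∂unitVol := integral_nonneg fun _ => sq_nonneg _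
    refine (mul_le_mul_of_nonneg_right h2 h3).trans (h1.trans ?_)
    gcongr
  have hc : |meanStress σ p t| ≤ K * (W + 1 + 1) := by
    have h1 := hK (fun x => p x t) (meanStress σ p t) univ (hp.memLp t)
      (by rw [hmean t htT]; linarith) hsq MeasurableSet.univ (by simpa using hε.le)
      ((hexL.integrable (by norm_num)).integrableOn)
    rw [Measure.restrict_univ] at h1
    refine h1.trans ?_
    gcongr
    exact IsStrip.integral_abs_le hexL hex2
  refine ⟨hc.trans (le_max_left _ _), le_trans ?_ (le_max_right _ _)⟩
  calc ∫ x, σ (p x t) ^ 2 ∂unitVol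
      ≤ ∫ x, (2 * excessStress σ p x t ^ 2 + 2 * meanStress σ p t ^ 2) ∂unitVol := by
        refine integral_mono (hp.memLp_stress t).integrable_sq
          ((hexL.integrable_sq.const_mul 2).add (integrable_const _)) fun x => ?_
        have := sq_nonneg (excessStress σ p x t - meanStress σ p t)
        have h2 : σ (p x t) = excessStress σ p x t + meanStress σ p t := by
          rw [excessStress_eq]; ring
        simp only [h2]
        nlinarith
    _ = 2 * ∫ x, excessStress σ p x t ^ 2 ∂unitVol + 2 * meanStress σ p t ^ 2 := by
        rw [integral_add (hexL.integrable_sq.const_mul 2) (integrable_const _),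
          integral_const_mul]
        simp
    _ ≤ 2 * W + 2 * (K * (W + 1 + 1)) ^ 2 := by
        have : meanStress σ p t ^ 2 ≤ (K * (W + 1 + 1)) ^ 2 := by
          rw [← sq_abs]; gcongr
        linarith

/-- Regularity of a solution at positive times: positivity for almost every `x` and all times, and
local boundedness of the stress in `L²(0,1)`. -/
structure IsRegular (σ : ℝ → ℝ) (p : ℝ → ℝ → ℝ) : Prop where
  pos : ∀ᵐ x ∂unitVol, ∀ t, 0 < t → 0 < p x t
  bound : ∀ τ T, 0 < τ → ∃ C, ∀ t ∈ Icc τ T,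
    MemLp (fun x => σ (p x t)) 2 unitVol ∧ ∫ x, σ (p x t) ^ 2 ∂unitVol ≤ C

/-- Existence of a regular solution, as the limit of classical solutions with approximating initial
data. -/
theorem exists_isSolution_isRegular {σ : ℝ → ℝ} {lam μ : ℝ} (hσ : IsStress σ lam) (hμ : 0 < μ)
    {p₀ : L2} (hp₀ : p₀ ∈ admissible μ) : ∃ p, IsSolution σ p₀ p ∧ IsRegular σ p := by
  have hlam := hσ.lam_nonneg
  have hex : ∀ n : ℕ, ∃ (q : L2) (p : ℝ → ℝ → ℝ), ‖q - p₀‖ < (1 / 2) ^ n ∧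
      ∫ x, q x ∂unitVol = μ ∧ IsSolutionOn σ q (n + 1) p ∧ IsClassical σ lam μ (n + 1) p :=
    fun n => exists_isClassical hσ hμ hp₀ (by positivity) (by positivity)
  choose q p hq hqm hsol hcl using hex
  choose U hUc hU0 hU using fun n => (hsol n).continuous_L2
  have hqlim : Tendsto q atTop (𝓝 p₀) := by
    rw [tendsto_iff_norm_sub_tendsto_zero]
    exact squeeze_zero (fun n => norm_nonneg _) (fun n => (hq n).le)
      (tendsto_pow_atTop_nhds_zero_of_lt_one (by norm_num) (by norm_num))
  -- convergence in `L²(0,1)`, locally uniformly in time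
  have hcon : ∀ n m : ℕ, ∀ t : ℝ, 0 ≤ t → t ≤ n + 1 → t ≤ m + 1 →
      ‖U n t - U m t‖ ≤ Real.exp (lam * t) * ‖q n - q m‖ := by
    intro n m t h0 hn hm
    have ht : t ∈ Icc 0 (min ((n : ℝ) + 1) (m + 1)) := ⟨h0, le_min hn hm⟩
    exact ((hsol n).mono (min_le_left _ _)).norm_sub_le hσ hμ (hqm n) (hqm m)
      ((hsol m).mono (min_le_right _ _)) ht (hU n t ⟨h0, hn⟩) (hU m t ⟨h0, hm⟩)
  have hle : ∀ (t : ℝ) (n : ℕ), ⌈t⌉₊ ≤ n → t ≤ n := fun t n h =>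
    (Nat.le_ceil t).trans (by exact_mod_cast h)
  have hexu : ∀ t, ∃ w : L2, 0 ≤ t → Tendsto (fun n => U n t) atTop (𝓝 w) := by
    intro t
    by_cases ht : 0 ≤ t
    · have : CauchySeq (fun n => U n t) := by
        rw [Metric.cauchySeq_iff]
        intro ε hε
        obtain ⟨N, hN⟩ := Metric.cauchySeq_iff.1 hqlim.cauchySeq (ε / Real.exp (lam * t))
          (by positivity)
        refine ⟨max N ⌈t⌉₊, fun n hn m hm => ?_⟩
        have hn' := hle t n ((le_max_right _ _).trans hn)
        have hm' := hle t m ((le_max_right _ _).trans hm)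
        have h1 := hN n ((le_max_left _ _).trans hn) m ((le_max_left _ _).trans hm)
        rw [dist_eq_norm, lt_div_iff₀ (Real.exp_pos _), mul_comm] at h1
        rw [dist_eq_norm]
        exact (hcon n m t ht (by linarith) (by linarith)).trans_lt h1
      obtain ⟨w, hw⟩ := cauchySeq_tendsto_of_complete this
      exact ⟨w, fun _ => hw⟩
    · exact ⟨0, fun h => absurd h ht⟩
  choose u hu using hexu
  have hUu : ∀ n : ℕ, ∀ t : ℝ, 0 ≤ t → t ≤ n + 1 →
      ‖U n t - u t‖ ≤ Real.exp (lam * t) * (1 / 2) ^ n := by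
    intro n t h0 hn
    have h1 : Tendsto (fun m => ‖U n t - U m t‖) atTop (𝓝 ‖U n t - u t‖) :=
      ((hu t h0).const_sub _).norm
    have h2 : Tendsto (fun m => Real.exp (lam * t) * ‖q n - q m‖) atTop
        (𝓝 (Real.exp (lam * t) * ‖q n - p₀‖)) := ((hqlim.const_sub _).norm).const_mul _
    refine (le_of_tendsto_of_tendsto h1 h2 ?_).trans
      (mul_le_mul_of_nonneg_left (hq n).le (Real.exp_pos _).le)
    filter_upwards [eventually_ge_atTop ⌈t⌉₊] with m hm
    exact hcon n m t h0 hn (by linarith [hle t m hm])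
  have hu0 : u 0 = p₀ := by
    refine tendsto_nhds_unique (hu 0 le_rfl) (hqlim.congr fun n => (hU0 n).symm)
  have hucont : ∀ T, ContinuousOn u (Icc 0 T) := by
    intro T
    refine TendstoUniformlyOn.continuousOn (F := U) (p := atTop) ?_ ?_
    · rw [Metric.tendstoUniformlyOn_iff]
      intro ε hε
      have h1 : Tendsto (fun n : ℕ => Real.exp (lam * T) * (1 / 2 : ℝ) ^ n) atTop (𝓝 0) := by
        simpa using (tendsto_pow_atTop_nhds_zero_of_lt_one (r := (1 / 2 : ℝ)) (by norm_num)
          (by norm_num)).const_mul (Real.exp (lam * T))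
      filter_upwards [h1.eventually (gt_mem_nhds hε), eventually_ge_atTop ⌈T⌉₊] with n h2 h3 t ht
      rw [dist_comm, dist_eq_norm]
      refine ((hUu n t ht.1 (by linarith [hle T n h3, ht.2])).trans ?_).trans_lt h2
      gcongr
      exact ht.2
    · refine Eventually.frequently ?_
      filter_upwards [eventually_ge_atTop ⌈T⌉₊] with n hn
      exact (hUc n).mono (Icc_subset_Icc_right (by linarith [hle T n hn]))
  have hpae : ∀ t, 0 ≤ t → ∀ᵐ x ∂unitVol, Tendsto (fun n => p n x t) atTop (𝓝 (u t x)) := by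
    intro t ht
    have hmem : ∀ k : ℕ, t ∈ Icc (0 : ℝ) ((k + ⌈t⌉₊ : ℕ) + 1) := fun k =>
      ⟨ht, by linarith [hle t (k + ⌈t⌉₊) (Nat.le_add_left _ _)]⟩
    have h1 := ae_tendsto_of_norm_sub_le (f := fun k => U (k + ⌈t⌉₊) t) (g := u t)
      (C := Real.exp (lam * t)) fun k => by
        refine (hUu _ t ht (hmem k).2).trans ?_
        exact mul_le_mul_of_nonneg_left
          (pow_le_pow_of_le_one (by norm_num) (by norm_num) (Nat.le_add_right _ _))
          (Real.exp_pos _).le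
    filter_upwards [h1, ae_all_iff.2 fun k => hU (k + ⌈t⌉₊) t (hmem k)] with x h2 h3
    refine (tendsto_add_atTop_iff_nat ⌈t⌉₊).1 (h2.congr fun k => h3 k)
  -- bounds on the stress
  set D := 2 * (‖p₀‖ + 1) ^ 2 + 2 * μ ^ 2 with hD
  have hvar : ∀ n, ∫ x, (p n x 0 - μ) ^ 2 ∂unitVol ≤ D := by
    intro n
    have h0 : (0 : ℝ) ∈ Icc (0 : ℝ) (n + 1) := ⟨le_rfl, by positivity⟩
    have h1 : ∫ x, (p n x 0) ^ 2 ∂unitVol = ‖q n‖ ^ 2 := by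
      rw [norm_sq_eq_integral, ← hU0 n]
      exact integral_congr_ae ((hU n 0 h0).mono fun x hx => by simp only [hx])
    have h2 : ‖q n‖ ≤ ‖p₀‖ + 1 := by
      have h3 : ‖q n‖ ≤ ‖q n - p₀‖ + ‖p₀‖ := by
        simpa using norm_add_le (q n - p₀) p₀
      have h4 : ((1 : ℝ) / 2) ^ n ≤ 1 := pow_le_one₀ (by norm_num) (by norm_num)
      linarith [hq n]
    have h5 : MemLp (fun x => p n x 0 - μ) 2 unitVol := ((hcl n).memLp 0).sub (memLp_const μ)
    calc ∫ x, (p n x 0 - μ) ^ 2 ∂unitVol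
        ≤ ∫ x, (2 * p n x 0 ^ 2 + 2 * μ ^ 2) ∂unitVol := by
          refine integral_mono h5.integrable_sq
            ((((hcl n).memLp 0).integrable_sq.const_mul 2).add (integrable_const _)) fun x => ?_
          have := sq_nonneg (p n x 0 + μ)
          simp only; nlinarith
      _ = 2 * ‖q n‖ ^ 2 + 2 * μ ^ 2 := by
          rw [integral_add (((hcl n).memLp 0).integrable_sq.const_mul 2) (integrable_const _),
            integral_const_mul, h1]
          simp
      _ ≤ D := by simp only [hD]; gcongr
  have hmean : ∀ n : ℕ, ∀ t ∈ Icc (0 : ℝ) (n + 1), ∫ x, p n x t ∂unitVol = μ := fun n =>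
    (hsol n).integral_eq hσ hμ (hqm n)
  have hbd : ∀ τ T : ℝ, 0 < τ → ∃ C, ∀ n : ℕ, T ≤ n → ∀ t ∈ Icc τ T,
      |meanStress σ (p n) t| ≤ C ∧ ∫ x, σ (p n x t) ^ 2 ∂unitVol ≤ C := by
    intro τ T hτ
    obtain ⟨C, hC⟩ := hσ.exists_stress_bound hμ (D := D) (τ := τ) (T' := T) (by positivity) hτ
    exact ⟨C, fun n hn => hC (n + 1) (p n) (by linarith) (hcl n) (hmean n) (hvar n)⟩
  set c : ℝ → ℝ := fun t => ∫ x, σ (u t x) ∂unitVol with hc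
  have hpass : ∀ τ T, 0 < τ → ∃ C, ∀ t ∈ Icc τ T, (∀ᵐ x ∂unitVol, 0 < u t x) ∧
      MemLp (fun x => σ (u t x)) 2 unitVol ∧ ∫ x, σ (u t x) ^ 2 ∂unitVol ≤ C ∧
      Tendsto (fun n => meanStress σ (p n) t) atTop (𝓝 (c t)) := by
    intro τ T hτ
    obtain ⟨C, hC⟩ := hbd τ T hτ
    refine ⟨C, fun t ht => ?_⟩
    have ht0 : 0 < t := hτ.trans_le ht.1
    have hTk : ∀ k : ℕ, T ≤ (k + ⌈T⌉₊ : ℕ) := fun k => hle T _ (Nat.le_add_left _ _)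
    obtain ⟨h1, h2, h3, h4⟩ := hσ.tendsto_integral (f := fun k x => p (k + ⌈T⌉₊) x t)
      (g := u t) (C := C)
      (fun k => Eventually.of_forall fun x =>
        (hcl _).pos x t ⟨ht0.le, by linarith [hTk k, ht.2]⟩)
      (fun k => (hcl _).memLp_stress t) (fun k => (hC _ (hTk k) t ht).2)
      (Lp.aestronglyMeasurable _) (by
        filter_upwards [hpae t ht0.le] with x hx
        exact (tendsto_add_atTop_iff_nat ⌈T⌉₊).2 hx)
    refine ⟨h1, h2, h3, ?_⟩
    exact (tendsto_add_atTop_iff_nat (f := fun n => meanStress σ (p n) t) ⌈T⌉₊).1 h4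
  have hposu : ∀ t, 0 < t → ∀ᵐ x ∂unitVol, 0 < u t x := fun t ht => by
    obtain ⟨C, hC⟩ := hpass t t ht
    exact (hC t ⟨le_rfl, le_rfl⟩).1
  have hclim : ∀ t, 0 < t → Tendsto (fun n => meanStress σ (p n) t) atTop (𝓝 (c t)) :=
    fun t ht => by
      obtain ⟨C, hC⟩ := hpass t t ht
      exact (hC t ⟨le_rfl, le_rfl⟩).2.2.2
  -- pointwise convergence for all positive times, for almost every `x`
  -- The representative `P` of the limit is a pointwise limit, so that for almost every `x` the
  -- equation holds at all times. At time `0` pointwise limits need not exist.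
  set P : ℝ → ℝ → ℝ := fun x t => if t = 0 then p₀ x else limUnder atTop fun n => p n x t with hP
  have hkpos : ∀ k : ℕ, (0 : ℝ) < 1 / (k + 1) := fun k => by positivity
  have hG : ∀ᵐ x ∂unitVol, ∀ k : ℕ,
      Tendsto (fun n => p n x (1 / (k + 1))) atTop (𝓝 (u (1 / (k + 1)) x)) ∧
        0 < u (1 / (k + 1)) x :=
    ae_all_iff.2 fun k => (hpae _ (hkpos k).le).and (hposu _ (hkpos k))
  have hscalar : ∀ᵐ x ∂unitVol, ∀ s T, 0 < s → s ≤ T →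
      (∀ t ∈ Icc s T, Tendsto (fun n => p n x t) atTop (𝓝 (P x t))) ∧
      (∀ t ∈ Icc s T, 0 < P x t) ∧
      IntervalIntegrable (fun r => σ (P x r) - c r) volume s T ∧
      P x T = P x s - ∫ r in s..T, (σ (P x r) - c r) := by
    filter_upwards [hG] with x hx s T hs hsT
    obtain ⟨k, hk⟩ := exists_nat_one_div_lt hs
    set τ : ℝ := 1 / ((k : ℝ) + 1) with hτ
    have hτ0 : 0 < τ := hkpos k
    have hτT : τ ≤ T := hk.le.trans hsT
    obtain ⟨C, hC⟩ := hbd τ T hτ0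
    have hTj : ∀ j : ℕ, T ≤ (j + ⌈T⌉₊ : ℕ) := fun j => hle T _ (Nat.le_add_left _ _)
    have hsub : ∀ j : ℕ, Icc τ T ⊆ Icc (0 : ℝ) ((j + ⌈T⌉₊ : ℕ) + 1) := fun j =>
      Icc_subset_Icc hτ0.le (by linarith [hTj j])
    obtain ⟨z, hz1, hz2, hz3, hz4⟩ := hσ.exists_tendsto_of_scalar hτT
      (y := fun j => p (j + ⌈T⌉₊) x) (c := fun j => meanStress σ (p (j + ⌈T⌉₊))) (d := c)
      (l := u τ x) (C := C)
      (fun j t ht => ((hcl _).hasDeriv x t (hsub j ht)).mono (hsub j))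
      (fun j t ht => (hcl _).pos x t (hsub j ht))
      (fun j => (hcl _).cont.mono (hsub j))
      (fun j t ht => (hC _ (hTj j) t ht).1)
      (fun t ht => (tendsto_add_atTop_iff_nat (f := fun n => meanStress σ (p n) t) ⌈T⌉₊).2
        (hclim t (hτ0.trans_le ht.1)))
      (hx k).2 ((tendsto_add_atTop_iff_nat (f := fun n => p n x τ) ⌈T⌉₊).2 (hx k).1)
    have hzlim : ∀ t ∈ Icc τ T, Tendsto (fun n => p n x t) atTop (𝓝 (z t)) := fun t ht =>
      (tendsto_add_atTop_iff_nat (f := fun n => p n x t) ⌈T⌉₊).1 (hz1 t ht)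
    have hPz : ∀ t ∈ Icc τ T, P x t = z t := by
      intro t ht
      simp only [hP]
      rw [if_neg (hτ0.trans_le ht.1).ne']
      exact (hzlim t ht).limUnder_eq
    have hsI : Icc s T ⊆ Icc τ T := Icc_subset_Icc_left hk.le
    have hsm : s ∈ Icc τ T := ⟨hk.le, hsT⟩
    have hTm : T ∈ Icc τ T := ⟨hτT, le_rfl⟩
    have hz3' : IntervalIntegrable (fun r => σ (z r) - c r) volume s T :=
      hz3.mono_set (by rw [uIcc_of_le hsT, uIcc_of_le hτT]; exact hsI)
    have hcongr : EqOn (fun r => σ (z r) - c r) (fun r => σ (P x r) - c r) (uIcc s T) := by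
      intro r hr
      rw [uIcc_of_le hsT] at hr
      simp only [hPz r (hsI hr)]
    refine ⟨fun t ht => by rw [hPz t (hsI ht)]; exact hzlim t (hsI ht),
      fun t ht => by rw [hPz t (hsI ht)]; exact hz2 t (hsI ht), ?_, ?_⟩
    · exact (intervalIntegrable_congr (hcongr.mono uIoc_subset_uIcc)).1 hz3'
    · rw [hPz T hTm, hPz s hsm, hz4 T hTm, hz4 s hsm, ← intervalIntegral.integral_congr hcongr]
      have h1 := intervalIntegral.integral_add_adjacent_intervals
        (hz3.mono_set (by rw [uIcc_of_le hk.le, uIcc_of_le hτT]; exact Icc_subset_Icc_right hsT))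
        hz3'
      linarith
  have hPu : ∀ t, 0 ≤ t → ∀ᵐ x ∂unitVol, u t x = P x t := by
    intro t ht
    rcases ht.eq_or_lt with rfl | ht0
    · refine Eventually.of_forall fun x => ?_
      simp only [hP, if_true]
      rw [hu0]
    · filter_upwards [hpae t ht, hscalar] with x h1 h2
      exact tendsto_nhds_unique h1 ((h2 t t ht0 le_rfl).1 t ⟨le_rfl, le_rfl⟩)
  have hcP : ∀ t, 0 < t → meanStress σ P t = c t := fun t ht =>
    integral_congr_ae ((hPu t ht.le).mono fun x hx => by simp only [hx])
  have hexP : ∀ x s t, 0 < s → 0 < t → EqOn (fun r => σ (P x r) - c r)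
      (fun r => excessStress σ P x r) (uIcc s t) := by
    intro x s t hs ht r hr
    have : 0 < r := (lt_min hs ht).trans_le hr.1
    simp only [excessStress_eq, hcP r this]
  refine ⟨P, fun T hT => ?_, ?_⟩
  · have hprod : (volume : Measure (ℝ × ℝ)).restrict (Ioo (0 : ℝ) 1 ×ˢ Icc 0 T) =
        unitVol.prod (volume.restrict (Icc 0 T)) := by
      rw [Measure.prod_restrict, ← Measure.volume_eq_prod]
    have haez : ∀ᵐ z ∂(volume : Measure (ℝ × ℝ)).restrict (Ioo (0 : ℝ) 1 ×ˢ Icc 0 T),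
        Tendsto (fun n => p n z.1 z.2) atTop (𝓝 (P z.1 z.2)) ∧ 0 < P z.1 z.2 := by
      rw [hprod]
      have h2 : ∀ᵐ t ∂(volume : Measure ℝ).restrict (Icc 0 T), 0 < t := by
        filter_upwards [ae_restrict_mem measurableSet_Icc,
          ae_restrict_of_ae (Measure.ae_ne volume (0 : ℝ))] with t h3 h4
        exact lt_of_le_of_ne h3.1 (Ne.symm h4)
      filter_upwards [Measure.quasiMeasurePreserving_fst.ae hscalar,
        Measure.quasiMeasurePreserving_snd.ae h2] with z h3 h4
      have h5 := h3 z.2 z.2 h4 le_rfl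
      exact ⟨h5.1 _ ⟨le_rfl, le_rfl⟩, h5.2.1 _ ⟨le_rfl, le_rfl⟩⟩
    refine ⟨?_, ⟨u, hucont T, hu0, fun t ht => hPu t ht.1⟩, haez.mono fun z hz => hz.2, ?_, ?_, ?_⟩
    · exact aestronglyMeasurable_of_tendsto_ae atTop
        (fun n => (hcl n).meas.aestronglyMeasurable) (haez.mono fun z hz => hz.1)
    · have h2 : ∀ᵐ t ∂(volume : Measure ℝ).restrict (Icc 0 T), 0 < t := by
        filter_upwards [ae_restrict_mem measurableSet_Icc,
          ae_restrict_of_ae (Measure.ae_ne volume (0 : ℝ))] with t h3 h4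
        exact lt_of_le_of_ne h3.1 (Ne.symm h4)
      filter_upwards [h2] with t ht
      obtain ⟨C, hC⟩ := hpass t t ht
      have h1 := ((hC t ⟨le_rfl, le_rfl⟩).2.1).integrable (by norm_num)
      exact h1.congr ((hPu t ht.le).mono fun x hx => by simp only [hx])
    · filter_upwards [hscalar] with x hx τ hτ
      have h1 := (intervalIntegrable_congr ((hexP x τ T hτ.1 hT).mono uIoc_subset_uIcc)).1
        (hx τ T hτ.1 hτ.2.le).2.2.1
      rw [intervalIntegrable_iff_integrableOn_Ioo_of_le hτ.2.le] at h1
      exact h1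
    · filter_upwards [hscalar] with x hx
      have key : ∀ s t, 0 < s → s ≤ t →
          P x t = P x s - ∫ r in s..t, excessStress σ P x r := by
        intro s t hs hst
        rw [← intervalIntegral.integral_congr (hexP x s t hs (hs.trans_le hst))]
        exact (hx s t hs hst).2.2.2
      intro s hs t ht
      rcases le_total s t with hst | hst
      · exact key s t hs.1 hst
      · rw [intervalIntegral.integral_symm, key t s ht.1 hst]; ring
  · refine ⟨?_, fun τ T hτ => ?_⟩
    · filter_upwards [hscalar] with x hx t ht
      exact (hx t t ht le_rfl).2.1 t ⟨le_rfl, le_rfl⟩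
    · obtain ⟨C, hC⟩ := hpass τ T hτ
      refine ⟨C, fun t ht => ?_⟩
      obtain ⟨-, h2, h3, -⟩ := hC t ht
      have h4 : ∀ᵐ x ∂unitVol, σ (u t x) = σ (P x t) :=
        (hPu t (hτ.le.trans ht.1)).mono fun x hx => by rw [hx]
      refine ⟨h2.ae_eq h4, ?_⟩
      rw [← integral_congr_ae (h4.mono fun x hx => congrArg (· ^ 2) hx)]
      exact h3

/-! ### Regularity at positive times and the energy equation -/

namespace IsSolution

variable {σ : ℝ → ℝ} {lam μ : ℝ} {p₀ : L2} {p q : ℝ → ℝ → ℝ}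

theorem isStrip (hp : IsSolution σ p₀ p) {a b : ℝ} (ha : 0 < a) (hab : a ≤ b) :
    IsStrip σ a b p := (hp b (ha.trans_le hab)).isStrip ha hab le_rfl

theorem memLp (hp : IsSolution σ p₀ p) {t : ℝ} (ht : 0 ≤ t) :
    MemLp (fun x => p x t) 2 unitVol := by
  obtain ⟨u, -, -, hu⟩ := (hp (t + 1) (by linarith)).continuous_L2
  exact (Lp.memLp (u t)).ae_eq (hu t ⟨ht, by linarith⟩)

theorem integral_eq (hσ : IsStress σ lam) (hμ : 0 < μ) (hp₀ : ∫ x, p₀ x ∂unitVol = μ)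
    (hp : IsSolution σ p₀ p) {t : ℝ} (ht : 0 ≤ t) : ∫ x, p x t ∂unitVol = μ :=
  (hp (t + 1) (by linarith)).integral_eq hσ hμ hp₀ t ⟨ht, by linarith⟩

theorem exists_mem_Ioo {t : ℝ} (ht : 0 < t) :
    ∃ k : ℕ, t ∈ Ioo (1 / ((k : ℝ) + 1)) ((k : ℝ) + 1) := by
  obtain ⟨k, hk⟩ := exists_nat_one_div_lt ht
  obtain ⟨l, hl⟩ := exists_nat_gt t
  refine ⟨max k l, ?_, ?_⟩
  · refine lt_of_le_of_lt ?_ hk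
    gcongr
    exact le_max_left _ _
  · push_cast
    have : (l : ℝ) ≤ max (k : ℝ) l := le_max_right _ _
    linarith

theorem continuousOn (hp : IsSolution σ p₀ p) :
    ∀ᵐ x ∂unitVol, ContinuousOn (fun t => p x t) (Ioi 0) := by
  have h : ∀ᵐ x ∂unitVol, ∀ k : ℕ,
      ContinuousOn (fun t => p x t) (Icc (1 / ((k : ℝ) + 1)) ((k : ℝ) + 1)) := by
    refine ae_all_iff.2 fun k => ?_
    have h1 : (1 : ℝ) / ((k : ℝ) + 1) ≤ (k : ℝ) + 1 := by
      rw [div_le_iff₀ (by positivity)]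
      nlinarith [(Nat.cast_nonneg k : (0 : ℝ) ≤ k)]
    exact (hp.isStrip (by positivity) h1).continuousOn h1
  filter_upwards [h] with x hx t ht
  obtain ⟨k, hk⟩ := exists_mem_Ioo ht
  exact ((hx k).continuousAt (Icc_mem_nhds hk.1 hk.2)).continuousWithinAt

/-- By continuity in time, two solutions agree at all positive times for almost every `x`. -/
theorem ae_forall_eq (hσ : IsStress σ lam) (hμ : 0 < μ) (hp₀ : ∫ x, p₀ x ∂unitVol = μ)
    (hp : IsSolution σ p₀ p) (hq : IsSolution σ p₀ q) :
    ∀ᵐ x ∂unitVol, ∀ t, 0 < t → p x t = q x t := by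
  -- The exponentials of rational numbers form a countable dense set of positive times.
  have h1 : ∀ᵐ x ∂unitVol, ∀ r : ℚ, p x (Real.exp r) = q x (Real.exp r) := by
    refine ae_all_iff.2 fun r => ?_
    exact (hp _ (Real.exp_pos r)).ae_eq hσ hμ hp₀ (hq _ (Real.exp_pos r))
      ⟨(Real.exp_pos r).le, le_rfl⟩
  filter_upwards [h1, hp.continuousOn, hq.continuousOn] with x h2 h3 h4 t ht
  have h5 := h3.comp_continuous Real.continuous_exp fun s => Real.exp_pos s
  have h6 := h4.comp_continuous Real.continuous_exp fun s => Real.exp_pos s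
  have h7 := Rat.denseRange_cast (𝕜 := ℝ) |>.equalizer h5 h6 (funext h2)
  have := congrFun h7 (Real.log t)
  simpa [Real.exp_log ht] using this

/-- Every solution is regular, because it agrees with the regular solution constructed above. -/
theorem isRegular (hσ : IsStress σ lam) (hμ : 0 < μ) (hp₀ : p₀ ∈ admissible μ)
    (hp : IsSolution σ p₀ p) : IsRegular σ p := by
  obtain ⟨q, hq, hqr⟩ := exists_isSolution_isRegular hσ hμ hp₀
  have h := ae_forall_eq hσ hμ hp₀.2 hp hq
  refine ⟨?_, fun τ T hτ => ?_⟩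
  · filter_upwards [h, hqr.pos] with x h1 h2 t ht
    rw [h1 t ht]; exact h2 t ht
  · obtain ⟨C, hC⟩ := hqr.bound τ T hτ
    refine ⟨C, fun t ht => ?_⟩
    have h1 : ∀ᵐ x ∂unitVol, σ (q x t) = σ (p x t) :=
      h.mono fun x hx => by rw [hx t (hτ.trans_le ht.1)]
    refine ⟨(hC t ht).1.ae_eq h1, ?_⟩
    rw [← integral_congr_ae (h1.mono fun x hx => congrArg (· ^ 2) hx)]
    exact (hC t ht).2

theorem continuousOn_meanStress (hσ : IsStress σ lam) (hp : IsSolution σ p₀ p)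
    (hr : IsRegular σ p) : ContinuousOn (meanStress σ p) (Ioi 0) := by
  intro t ht
  have ht0 : (0 : ℝ) < t := ht
  refine ContinuousAt.continuousWithinAt (tendsto_of_seq_tendsto fun s hs => ?_)
  obtain ⟨N, hN⟩ := eventually_atTop.1
    (hs.eventually (Icc_mem_nhds (half_lt_self ht0) (lt_two_mul_self ht0)))
  obtain ⟨C, hC⟩ := hr.bound (t / 2) (2 * t) (half_pos ht0)
  have hmem : ∀ k, s (k + N) ∈ Icc (t / 2) (2 * t) := fun k => hN _ (Nat.le_add_left _ _)
  have hs0 : ∀ k, 0 < s (k + N) := fun k => (half_pos ht0).trans_le (hmem k).1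
  have := (hσ.tendsto_integral (f := fun k x => p x (s (k + N))) (g := fun x => p x t) (C := C)
    (fun k => hr.pos.mono fun x hx => hx _ (hs0 k)) (fun k => (hC _ (hmem k)).1)
    (fun k => (hC _ (hmem k)).2) (hp.memLp ht0.le).1 (by
      filter_upwards [hp.continuousOn] with x hx
      exact ((hx.continuousAt (Ioi_mem_nhds ht0)).tendsto.comp
        ((tendsto_add_atTop_iff_nat N).2 hs)))).2.2.2
  exact (tendsto_add_atTop_iff_nat (f := fun n => meanStress σ p (s n)) N).1 this

theorem continuousOn_excess (hσ : IsStress σ lam) (hp : IsSolution σ p₀ p)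
    (hr : IsRegular σ p) :
    ∀ᵐ x ∂unitVol, ContinuousOn (fun t => excessStress σ p x t) (Ioi 0) := by
  filter_upwards [hp.continuousOn, hr.pos] with x h1 h2
  exact (hσ.continuousOn.comp h1 fun t ht => h2 t ht).sub (hp.continuousOn_meanStress hσ hr)

/-- At positive times the equation holds in the classical sense, for almost every `x`. -/
theorem hasDerivAt (hσ : IsStress σ lam) (hp : IsSolution σ p₀ p) (hr : IsRegular σ p) :
    ∀ᵐ x ∂unitVol, ∀ t, 0 < t → HasDerivAt (fun s => p x s) (-excessStress σ p x t) t := by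
  have heq : ∀ᵐ x ∂unitVol, ∀ n : ℕ, ∀ s ∈ Ioc (0 : ℝ) (n + 1), ∀ t ∈ Ioc (0 : ℝ) (n + 1),
      p x t = p x s - ∫ r in s..t, excessStress σ p x r :=
    ae_all_iff.2 fun n => (hp (n + 1) (by positivity)).equation
  filter_upwards [heq, hp.continuousOn_excess hσ hr] with x h1 h2 t ht
  obtain ⟨n, hn⟩ := exists_nat_gt t
  have h3 : HasDerivAt (fun r => p x t - ∫ s in t..r, excessStress σ p x s)
      (-excessStress σ p x t) t := by
    refine HasDerivAt.const_sub _ ?_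
    refine intervalIntegral.integral_hasDerivAt_right IntervalIntegrable.refl ?_ ?_
    · exact h2.stronglyMeasurableAtFilter isOpen_Ioi t ht
    · exact h2.continuousAt (Ioi_mem_nhds ht)
  refine h3.congr_of_eventuallyEq ?_
  filter_upwards [Ioo_mem_nhds ht hn] with r hr
  exact h1 n t ⟨ht, by linarith⟩ r ⟨hr.1, by linarith [hr.2]⟩

theorem ae_differentiableAt (hσ : IsStress σ lam) (hp : IsSolution σ p₀ p) (hr : IsRegular σ p) :
    ∀ᵐ z ∂((volume : Measure (ℝ × ℝ)).restrict (Ioo (0 : ℝ) 1 ×ˢ Ioi (0 : ℝ))),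
      DifferentiableAt ℝ (fun s => p z.1 s) z.2 := by
  rw [Measure.volume_eq_prod, ← Measure.prod_restrict]
  filter_upwards [Measure.quasiMeasurePreserving_fst.ae (hp.hasDerivAt hσ hr),
    Measure.quasiMeasurePreserving_snd.ae (ae_restrict_mem measurableSet_Ioi)] with z h1 h2
  exact (h1 z.2 h2).differentiableAt

end IsSolution

theorem IsStress.abs_storedEnergy_le {σ : ℝ → ℝ} {lam : ℝ} (hσ : IsStress σ lam) {p : ℝ}
    (hp : 0 < p) : |storedEnergy σ p| ≤
      |σ p * (p - 1)| + |σ 1 * (p - 1)| + lam / 2 * (p - 1) ^ 2 := by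
  have h1 : storedEnergy σ 1 = 0 := by simp [storedEnergy]
  have h2 := hσ.storedEnergy_tangent one_pos hp
  have h3 := hσ.storedEnergy_tangent hp one_pos
  have h4 := le_abs_self (σ p * (p - 1))
  have h5 := neg_abs_le (σ 1 * (p - 1))
  have h6 := abs_nonneg (σ p * (p - 1))
  have h7 := abs_nonneg (σ 1 * (p - 1))
  rw [h1] at h2 h3
  rw [abs_le]
  constructor <;> nlinarith

namespace IsSolution

variable {σ : ℝ → ℝ} {lam μ : ℝ} {p₀ : L2} {p q : ℝ → ℝ → ℝ}

theorem storedEnergyExt_eq (hr : IsRegular σ p) {t : ℝ} (ht : 0 < t) :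
    ∀ᵐ x ∂unitVol, storedEnergyExt σ (p x t) = (storedEnergy σ (p x t) : EReal) := by
  filter_upwards [hr.pos] with x hx
  rw [storedEnergyExt, if_pos (hx t ht)]

theorem integrable_storedEnergy (hσ : IsStress σ lam) (hp : IsSolution σ p₀ p)
    (hr : IsRegular σ p) {t : ℝ} (ht : 0 < t) :
    Integrable (fun x => storedEnergy σ (p x t)) unitVol := by
  have hpos : ∀ᵐ x ∂unitVol, 0 < p x t := hr.pos.mono fun x hx => hx t ht
  have hWc : ContinuousOn (storedEnergy σ) (Ioi 0) := fun r hr' =>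
    (hasDerivAt_storedEnergy hσ.continuousOn hr').continuousAt.continuousWithinAt
  have h1 : MemLp (fun x => p x t - 1) 2 unitVol := (hp.memLp ht.le).sub (memLp_const 1)
  obtain ⟨C, hC⟩ := hr.bound t t ht
  have h2 := (hC t ⟨le_rfl, le_rfl⟩).1
  have h3 : Integrable (fun x => |σ (p x t) * (p x t - 1)|) unitVol := (h2.integrable_mul h1).abs
  have h4 : Integrable (fun x => |σ 1 * (p x t - 1)|) unitVol :=
    ((h1.integrable (by norm_num)).const_mul _).abs
  refine Integrable.mono' ((h3.add h4).add (h1.integrable_sq.const_mul (lam / 2)))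
    (aestronglyMeasurable_comp_of_continuousOn_Ioi hWc (hp.memLp ht.le).1 hpos) ?_
  filter_upwards [hpos] with x hx
  exact hσ.abs_storedEnergy_le hx

theorem hasFiniteEnergy (hσ : IsStress σ lam) (hp : IsSolution σ p₀ p) (hr : IsRegular σ p)
    {t : ℝ} (ht : 0 < t) : HasFiniteEnergy σ (fun x => p x t) := by
  refine ⟨?_, ?_⟩
  · filter_upwards [storedEnergyExt_eq hr ht] with x hx
    rw [hx]; exact EReal.coe_ne_top _
  · refine (hp.integrable_storedEnergy hσ hr ht).congr ?_
    filter_upwards [storedEnergyExt_eq hr ht] with x hx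
    rw [hx, EReal.toReal_coe]

theorem energy_eq (hr : IsRegular σ p) {t : ℝ} (ht : 0 < t) :
    energy σ (fun x => p x t) = ∫ x, storedEnergy σ (p x t) ∂unitVol := by
  refine integral_congr_ae ?_
  filter_upwards [storedEnergyExt_eq hr ht] with x hx
  rw [hx, EReal.toReal_coe]

theorem integrable_excess_sq (hσ : IsStress σ lam) (hp : IsSolution σ p₀ p) (hr : IsRegular σ p)
    {τ t : ℝ} (hτ : 0 < τ) (hτt : τ ≤ t) :
    Integrable (fun z : ℝ × ℝ => excessStress σ p z.1 z.2 ^ 2)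
        (unitVol.prod (volume.restrict (Ioc τ t))) ∧
      Integrable (fun z : ℝ × ℝ => excessStress σ p z.1 z.2 * meanStress σ p z.2)
        (unitVol.prod (volume.restrict (Ioc τ t))) := by
  have hc : ContinuousOn (meanStress σ p) (Icc τ t) :=
    (hp.continuousOn_meanStress hσ hr).mono fun r hr' => hτ.trans_le hr'.1
  obtain ⟨C, hC⟩ := hr.bound τ t hτ
  obtain ⟨B, hB⟩ := isCompact_Icc.exists_bound_of_continuousOn hc
  have hex : ∀ᵐ r ∂(volume.restrict (Ioc τ t)), MemLp (fun x => excessStress σ p x r) 2 unitVol ∧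
      ∫ x, excessStress σ p x r ^ 2 ∂unitVol ≤ 2 * C + 2 * B ^ 2 := by
    filter_upwards [ae_restrict_mem measurableSet_Ioc] with r hr'
    have hm := Ioc_subset_Icc_self hr'
    have h1 := hC r hm
    have h2 : MemLp (fun x => excessStress σ p x r) 2 unitVol := h1.1.sub (memLp_const _)
    refine ⟨h2, ?_⟩
    calc ∫ x, excessStress σ p x r ^ 2 ∂unitVol
        ≤ ∫ x, (2 * σ (p x r) ^ 2 + 2 * meanStress σ p r ^ 2) ∂unitVol := by
          refine integral_mono h2.integrable_sq
            ((h1.1.integrable_sq.const_mul 2).add (integrable_const _)) fun x => ?_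
          have := sq_nonneg (σ (p x r) + meanStress σ p r)
          simp only [excessStress_eq]; nlinarith
      _ = 2 * ∫ x, σ (p x r) ^ 2 ∂unitVol + 2 * meanStress σ p r ^ 2 := by
          rw [integral_add (h1.1.integrable_sq.const_mul 2) (integrable_const _),
            integral_const_mul]
          simp
      _ ≤ 2 * C + 2 * B ^ 2 := by
          have h3 : meanStress σ p r ^ 2 ≤ B ^ 2 := by
            rw [← sq_abs]
            have := hB r hm
            rw [Real.norm_eq_abs] at this
            gcongr
          linarith [h1.2]
  have hm := (hp.isStrip hτ hτt).aesm_excess hσ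
  exact ⟨IsStrip.integrable_sq_sub hm hex, IsStrip.integrable_mul_snd hm hex
    (hc.integrableOn_Icc.mono_set Ioc_subset_Icc_self)⟩

/-- The energy equation, with `-p_t` written as the excess stress. For almost every `x` it is the
chain rule for `W(p(x,·))`; the term with the mean stress vanishes on integration over `x`. -/
theorem energy_sub_energy (hσ : IsStress σ lam) (hp : IsSolution σ p₀ p) (hr : IsRegular σ p)
    {τ t : ℝ} (hτ : 0 < τ) (hτt : τ ≤ t) :
    energy σ (fun x => p x t) = energy σ (fun x => p x τ) -
      ∫ s in τ..t, ∫ x, excessStress σ p x s ^ 2 ∂unitVol := by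
  set ν := (volume : Measure ℝ).restrict (Ioc τ t) with hν
  obtain ⟨h1, h2⟩ := hp.integrable_excess_sq hσ hr hτ hτt
  have hsub : Icc τ t ⊆ Ioi 0 := fun r hr' => hτ.trans_le hr'.1
  have key : ∀ᵐ x ∂unitVol, storedEnergy σ (p x t) = storedEnergy σ (p x τ) -
      ∫ r, excessStress σ p x r ^ 2 ∂ν - ∫ r, excessStress σ p x r * meanStress σ p r ∂ν := by
    filter_upwards [hp.hasDerivAt hσ hr, hr.pos, hp.continuousOn_excess hσ hr, h1.prod_right_ae,
      h2.prod_right_ae] with x h3 h4 h5 h6 h7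
    have hpc : ContinuousOn (fun r => σ (p x r)) (Icc τ t) := by
      refine (hσ.continuousOn.comp (fun r hr' => ?_) fun r (hr' : r ∈ Ioi 0) => h4 r hr').mono hsub
      exact (h3 r hr').continuousAt.continuousWithinAt
    have h8 := intervalIntegral.integral_eq_sub_of_hasDerivAt
      (f := fun r => storedEnergy σ (p x r)) (f' := fun r => σ (p x r) * -excessStress σ p x r)
      (a := τ) (b := t) (fun r hr' => by
        rw [uIcc_of_le hτt] at hr'
        exact (hasDerivAt_storedEnergy hσ.continuousOn (h4 r (hsub hr'))).comp r
          (h3 r (hsub hr')))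
      (ContinuousOn.intervalIntegrable (by
        rw [uIcc_of_le hτt]; exact hpc.mul (h5.mono hsub).neg))
    rw [intervalIntegral.integral_of_le hτt] at h8
    have h9 : (fun r => σ (p x r) * -excessStress σ p x r) = fun r =>
        -(excessStress σ p x r ^ 2 + excessStress σ p x r * meanStress σ p r) := by
      funext r
      simp only [excessStress_eq]; ring
    rw [h9, integral_neg] at h8
    have h6' : Integrable (fun r => excessStress σ p x r ^ 2) ν := h6
    rw [integral_add h6' h7] at h8
    linarith
  have h10 : ∫ x, ∫ r, excessStress σ p x r * meanStress σ p r ∂ν ∂unitVol = 0 := by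
    rw [integral_integral_swap h2]
    refine integral_eq_zero_of_ae ?_
    filter_upwards [ae_restrict_mem measurableSet_Ioc] with r hr'
    obtain ⟨C, hC⟩ := hr.bound r r (hτ.trans hr'.1)
    have h11 := (hC r ⟨le_rfl, le_rfl⟩).1.integrable (by norm_num)
    rw [integral_mul_const]
    simp only [excessStress_eq]
    rw [integral_sub h11 (integrable_const _)]
    simp [meanStress]
  rw [energy_eq hr (hτ.trans_le hτt), energy_eq hr hτ, integral_congr_ae key]
  have hWi := hp.integrable_storedEnergy hσ hr hτ
  have hWi' : Integrable (fun x => storedEnergy σ (p x τ) -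
      ∫ r, excessStress σ p x r ^ 2 ∂ν) unitVol := hWi.sub h1.integral_prod_left
  rw [integral_sub hWi' h2.integral_prod_left, integral_sub hWi h1.integral_prod_left]
  simp only at h10 ⊢
  rw [h10, sub_zero, intervalIntegral.integral_of_le hτt, integral_integral_swap h1]

theorem energy_equation (hσ : IsStress σ lam) (hp : IsSolution σ p₀ p) (hr : IsRegular σ p)
    {τ t : ℝ} (hτ : 0 < τ) (hτt : τ ≤ t) :
    IntegrableOn (fun z : ℝ × ℝ => (deriv (fun s => p z.1 s) z.2) ^ 2)
        (Ioo (0 : ℝ) 1 ×ˢ Ioo τ t) volume ∧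
      energy σ (fun x => p x t) = energy σ (fun x => p x τ) -
        ∫ s in τ..t, ∫ x, (deriv (fun r => p x r) s) ^ 2 ∂unitVol := by
  have hd := hp.hasDerivAt hσ hr
  refine ⟨?_, ?_⟩
  · have hm : (volume : Measure (ℝ × ℝ)).restrict (Ioo (0 : ℝ) 1 ×ˢ Ioo τ t) =
        unitVol.prod (volume.restrict (Ioc τ t)) := by
      rw [Measure.volume_eq_prod, ← Measure.prod_restrict,
        Measure.restrict_congr_set (Ioo_ae_eq_Ioc (a := τ) (b := t))]
    rw [IntegrableOn, hm]
    refine (hp.integrable_excess_sq hσ hr hτ hτt).1.congr ?_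
    filter_upwards [Measure.quasiMeasurePreserving_fst.ae hd,
      Measure.quasiMeasurePreserving_snd.ae (ae_restrict_mem measurableSet_Ioc)] with z h1 h2
    rw [(h1 z.2 (hτ.trans h2.1)).deriv, neg_sq]
  · rw [hp.energy_sub_energy hσ hr hτ hτt]
    congr 1
    refine intervalIntegral.integral_congr fun s hs => ?_
    rw [uIcc_of_le hτt] at hs
    refine integral_congr_ae ?_
    filter_upwards [hd] with x hx
    rw [(hx s (hτ.trans_le hs.1)).deriv, neg_sq]

end IsSolution

/-- The solution map on `X × [0,∞)`. The contraction estimate gives continuity in the initial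
datum, locally uniformly in time. -/
theorem exists_continuous_solutionMap {σ : ℝ → ℝ} {lam μ : ℝ} (hσ : IsStress σ lam) (hμ : 0 < μ) :
    ∃ S : admissible μ × ℝ≥0 → L2, Continuous S ∧
      ∀ (p₀ : admissible μ) (p : ℝ → ℝ → ℝ), IsSolution σ p₀ p →
        ∀ t : ℝ≥0, ∀ᵐ x ∂unitVol, S (p₀, t) x = p x t := by
  choose p hp using fun p₀ : admissible μ => exists_isSolution_isRegular hσ hμ p₀.2
  have hex : ∀ z : admissible μ × ℝ≥0, ∃ f : L2, ∀ᵐ x ∂unitVol, f x = p z.1 x z.2 := fun z =>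
    ⟨((hp z.1).1.memLp z.2.2).toLp _, ((hp z.1).1.memLp z.2.2).coeFn_toLp⟩
  choose S hS using hex
  refine ⟨S, ?_, ?_⟩
  · have hcurve : ∀ (p₀ : admissible μ) (t : ℝ≥0),
        Tendsto (fun s : ℝ≥0 => S (p₀, s)) (𝓝 t) (𝓝 (S (p₀, t))) := by
      intro p₀ t
      have hT : (0 : ℝ) < t + 1 := by positivity
      obtain ⟨u, huc, -, hu⟩ := ((hp p₀).1 (t + 1) hT).continuous_L2
      have hSu : ∀ s : ℝ≥0, (s : ℝ) ≤ t + 1 → u s = S (p₀, s) := by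
        intro s hs
        refine Lp.ext ?_
        filter_upwards [hu s ⟨s.2, hs⟩, hS (p₀, s)] with x h1 h2
        rw [h1, h2]
      have hmem : ∀ᶠ s : ℝ≥0 in 𝓝 t, (s : ℝ) ∈ Icc (0 : ℝ) (t + 1) := by
        have : ∀ᶠ s : ℝ≥0 in 𝓝 t, (s : ℝ) < t + 1 :=
          (NNReal.continuous_coe.tendsto t).eventually (gt_mem_nhds (by linarith))
        filter_upwards [this] with s hs
        exact ⟨s.2, hs.le⟩
      have h1 : Tendsto (fun s : ℝ≥0 => (s : ℝ)) (𝓝 t) (𝓝[Icc (0 : ℝ) (t + 1)] (t : ℝ)) :=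
        tendsto_nhdsWithin_iff.2 ⟨NNReal.continuous_coe.tendsto t, hmem⟩
      have h2 := (huc t ⟨t.2, le_add_of_nonneg_right zero_le_one⟩).tendsto.comp h1
      rw [hSu t (by linarith)] at h2
      refine h2.congr' ?_
      filter_upwards [hmem] with s hs
      exact hSu s hs.2
    have hdata : ∀ (q₀ p₀ : admissible μ) (s : ℝ≥0),
        ‖S (q₀, s) - S (p₀, s)‖ ≤ Real.exp (lam * s) * ‖(q₀ : L2) - p₀‖ := by
      intro q₀ p₀ s
      have hT : (0 : ℝ) < s + 1 := by positivity
      exact ((hp q₀).1 _ hT).norm_sub_le hσ hμ q₀.2.2 p₀.2.2 ((hp p₀).1 _ hT)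
        ⟨s.2, le_add_of_nonneg_right zero_le_one⟩ (hS (q₀, s)) (hS (p₀, s))
    refine continuous_iff_continuousAt.2 fun z => ?_
    obtain ⟨p₀, t⟩ := z
    rw [ContinuousAt, tendsto_iff_norm_sub_tendsto_zero]
    refine squeeze_zero (g := fun z => Real.exp (lam * z.2) * ‖(z.1 : L2) - p₀‖ +
      ‖S (p₀, z.2) - S (p₀, t)‖) (fun _ => norm_nonneg _) (fun z => ?_) ?_
    · have : S z - S (p₀, t) = (S (z.1, z.2) - S (p₀, z.2)) + (S (p₀, z.2) - S (p₀, t)) := by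
        abel
      rw [this]
      exact (norm_add_le _ _).trans (by gcongr; exact hdata z.1 p₀ z.2)
    · have h1 : Continuous fun z : admissible μ × ℝ≥0 =>
          Real.exp (lam * z.2) * ‖(z.1 : L2) - p₀‖ := by fun_prop
      have h2 := h1.tendsto (p₀, t)
      simp only [sub_self, norm_zero, mul_zero] at h2
      have h3 : Tendsto (fun z : admissible μ × ℝ≥0 => S (p₀, z.2)) (𝓝 (p₀, t))
          (𝓝 (S (p₀, t))) := (hcurve p₀ t).comp (continuous_snd.tendsto (p₀, t))
      have h4 := (tendsto_iff_norm_sub_tendsto_zero.1 h3)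
      simpa using h2.add h4
  · intro p₀ q hq t
    have hT : (0 : ℝ) < t + 1 := by positivity
    filter_upwards [hS (p₀, t), ((hp p₀).1 _ hT).ae_eq hσ hμ p₀.2.2 (hq _ hT)
      ⟨t.2, le_add_of_nonneg_right zero_le_one⟩] with x h1 h2
    rw [h1]; exact h2

end Viscoelastic

theorem theoremt (σ : ℝ → ℝ) (μ : ℝ) (hμ : 0 < μ)
    (H1 : LocallyLipschitzOn (Ioi (0 : ℝ)) σ)
    (H2 : Tendsto σ (𝓝[>] (0 : ℝ)) atBot)
    (hW : Viscoelastic.IsLambdaConvexOn (Ioi (0 : ℝ)) (Viscoelastic.storedEnergy σ)) :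
    -- existence of a global solution
    (∀ p₀ ∈ Viscoelastic.admissible μ, ∃ p : ℝ → ℝ → ℝ, Viscoelastic.IsSolution σ p₀ p) ∧
    -- uniqueness, on every bounded time interval
    (∀ p₀ ∈ Viscoelastic.admissible μ, ∀ T : ℝ, 0 < T → ∀ p q : ℝ → ℝ → ℝ,
      Viscoelastic.IsSolutionOn σ p₀ T p → Viscoelastic.IsSolutionOn σ p₀ T q →
      ∀ t ∈ Icc 0 T, ∀ᵐ x ∂Viscoelastic.unitVol, p x t = q x t) ∧
    -- the constraint on the mean value is preserved
    (∀ p₀ ∈ Viscoelastic.admissible μ, ∀ p : ℝ → ℝ → ℝ, Viscoelastic.IsSolution σ p₀ p →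
      ∀ t : ℝ, 0 ≤ t → ∫ x, p x t ∂Viscoelastic.unitVol = μ) ∧
    -- joint continuity of the solution map
    (∃ S : Viscoelastic.admissible μ × ℝ≥0 → Viscoelastic.L2, Continuous S ∧
      ∀ (p₀ : Viscoelastic.admissible μ) (p : ℝ → ℝ → ℝ), Viscoelastic.IsSolution σ p₀ p →
        ∀ t : ℝ≥0, ∀ᵐ x ∂Viscoelastic.unitVol, S (p₀, t) x = p x t) ∧
    -- the time derivative exists almost everywhere, and the energy equation holds
    (∀ p₀ ∈ Viscoelastic.admissible μ, ∀ p : ℝ → ℝ → ℝ, Viscoelastic.IsSolution σ p₀ p →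
      (∀ᵐ z ∂((volume : Measure (ℝ × ℝ)).restrict (Ioo (0 : ℝ) 1 ×ˢ Ioi (0 : ℝ))),
        DifferentiableAt ℝ (fun s => p z.1 s) z.2) ∧
      (∀ t : ℝ, 0 < t → Viscoelastic.HasFiniteEnergy σ (fun x => p x t)) ∧
      (∀ τ t : ℝ, 0 < τ → τ ≤ t →
        IntegrableOn (fun z : ℝ × ℝ => (deriv (fun s => p z.1 s) z.2) ^ 2)
          (Ioo (0 : ℝ) 1 ×ˢ Ioo τ t) volume ∧
        Viscoelastic.energy σ (fun x => p x t) =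
          Viscoelastic.energy σ (fun x => p x τ) -
            ∫ s in τ..t, ∫ x, (deriv (fun r => p x r) s) ^ 2 ∂Viscoelastic.unitVol)) := by
  obtain ⟨lam, hσ⟩ := Viscoelastic.exists_isStress H1 H2 hW
  refine ⟨fun p₀ hp₀ => ?_, fun p₀ hp₀ T _ p q hp hq t ht => hp.ae_eq hσ hμ hp₀.2 hq ht,
    fun p₀ hp₀ p hp t ht => hp.integral_eq hσ hμ hp₀.2 ht,
    Viscoelastic.exists_continuous_solutionMap hσ hμ, fun p₀ hp₀ p hp => ?_⟩
  · obtain ⟨p, hp, -⟩ := Viscoelastic.exists_isSolution_isRegular hσ hμ hp₀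
    exact ⟨p, hp⟩
  · have hr := hp.isRegular hσ hμ hp₀
    exact ⟨hp.ae_differentiableAt hσ hr, fun t ht => hp.hasFiniteEnergy hσ hr ht,
      fun τ t hτ hτt => hp.energy_equation hσ hr hτ hτt⟩
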